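/- Let $0<\alpha<1$ and $0<\gamma\le\alpha$. Consider rooted trees without degree-2 vertices, with a degree-1 vertex called the root and $n$ further degree-1 vertices, the leaves, labelled by $[n]=\{1,\dots,n\}$; all other vertices are called branch points. Let $(T_n,n\ge1)$ be a sequence of random trees resulting from the alpha-gamma growth rules: $T_1$ and $T_2$ are the unique trees with one and with two leaves and, for $n\ge2$, given $T_1,\dots,T_n$, assign weight $1-\alpha$ to each edge of $T_n$ adjacent to a leaf, weight $\gamma$ to each other edge and weight $(c-1)\alpha-\gamma$ to each branch point of degree $c+1\ge3$; select an edge or a branch point at random with probability proportional to the weights. If an edge $a\to c$ (directed away from the root) is selected, replace it by three edges $a\to b$, $b\to c$, $b\to n+1$ with a new branch point $b$ and a new leaf $n+1$; if a branch point $v$ is selected, add an edge $v\to n+1$ to a new leaf $n+1$. The resulting tree is $T_{n+1}$. For $1\le k\le n$ denote by $R(T_n,[k])$ the subtree of $T_n$ spanned by the root and the leaves $1,\dots,k$, reduced by removing degree-2 vertices, with graph distances in $T_n$ as edge lengths. Then, for every $k\ge1$, $$\frac{R(T_n,[k])}{n^\gamma}\to\mathcal R_k\qquad\text{a.s. as }n\to\infty,$$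 in the sense that the tree shapes are eventually equal and all edge lengths converge, for some random discrete tree $\mathcal R_k$ with shape $T_k$ and edge lengths. The vector of edge lengths of $\mathcal R_k$ is a.s. $L_kW_k^\gamma D_k$, where $W_k$, $L_k$ and $D_k$ are random variables on the same probability space such that, conditionally given $T_k$, on the event that $T_k$ has $k+\ell$ edges (and hence also conditionally given only that $T_k$ has $k+\ell$ edges), $W_k$, $L_k$ and $D_k$ are independent and - $W_k\sim\mathrm{beta}(k(1-\alpha)+\ell\gamma,\,(k-1)\alpha-\ell\gamma)$, where $\mathrm{beta}(a,b)$ has density $B(a,b)^{-1}x^{a-1}(1-x)^{b-1}$ on $(0,1)$ for $a,b>0$, and $\mathrm{beta}(a,0)$ denotes the unit mass at $1$; - $L_k$ has density $$\frac{\Gamma(1+k(1-\alpha)+\ell\gamma)}{\Gamma(1+\ell+k(1-\alpha)/\gamma)}\,s^{\ell+k(1-\alpha)/\gamma}\,g_\gamma(s),$$ where $g_\gamma$ is the Mittag-Leffler density, i.e. the density of $\sigma_1^{-\gamma}$ for a subordinator $\sigma$ with Laplace exponent $\lambda^\gamma$, that is, $\mathbb E(e^{-\lambda\sigma_1})=e^{-\lambda^\gamma}$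 for $\lambda\ge0$; - $D_k$, the vector of edge length proportions, enumerated with the $k$ edges adjacent to leaves first and then the $\ell$ other edges (in each group in any order determined by $T_k$, e.g. by depth first search), has the Dirichlet distribution with parameters $(1-\alpha)/\gamma$ ($k$ times) and $1$ ($\ell$ times). Here $\mathrm{Dirichlet}(a_1,\dots,a_m)$ is the distribution on $\{x\in[0,1]^m:x_1+\dots+x_m=1\}$ whose first $m-1$ marginals have joint density proportional to $x_1^{a_1-1}\cdots x_{m-1}^{a_{m-1}-1}(1-x_1-\dots-x_{m-1})^{a_m-1}$; for $m=1$ it is the unit mass at $1$. -/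

import Mathlib

open MeasureTheory ProbabilityTheory Filter Topology
open scoped ENNReal

namespace AlphaGamma

/-! ### Leaf-labelled rooted trees

A tree with leaf set `[n] = {1, …, n}` and an additional vertex called the root is encoded by the
family `t` of its non-root vertices, each vertex being identified with the set of labels of the
leaves at or above it (away from the root).  The root is joined to the vertex `[n]`.  Every
non-root vertex `C` has exactly one edge leading to it from its parent; so the edges of the tree
are indexed by the members `C` of `t`, the leaf edges by the singletons and the inner edges by the
branch points, the members of `t` with at least two elements. -/

/-- The space of trees with leaves labelled by `[n]`. -/
def trees (n : ℕ) : Set (Finset (Finset ℕ)) :=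
  {t | (∀ A ∈ t, A.Nonempty ∧ A ⊆ Finset.Icc 1 n) ∧
    Finset.Icc 1 n ∈ t ∧
    (∀ i ∈ Finset.Icc 1 n, {i} ∈ t) ∧
    ∀ A ∈ t, ∀ C ∈ t, Disjoint A C ∨ A ⊆ C ∨ C ⊆ A}

/-- The children of the vertex `V` in the tree `t`. -/
def children (t : Finset (Finset ℕ)) (V : Finset ℕ) : Finset (Finset ℕ) :=
  t.filter fun A => A ⊂ V ∧ ∀ D ∈ t, ¬ (A ⊂ D ∧ D ⊂ V)

/-- The branch points of `t`: the vertices that are neither leaves nor the root. -/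
def branchPoints (t : Finset (Finset ℕ)) : Finset (Finset ℕ) :=
  t.filter fun A => 1 < A.card

/-! ### The alpha-gamma growth rules -/

/-- The weight of the edge that leads to the vertex `C`: `1 - α` if `C` is a leaf, else `γ`. -/
noncomputable def edgeWeight (α γ : ℝ) (C : Finset ℕ) : ℝ :=
  if C.card = 1 then 1 - α else γ

/-- The weight `(c - 1) α - γ` of a branch point `V` with `c` children (so of degree `c + 1`). -/
noncomputable def vertexWeight (α γ : ℝ) (t : Finset (Finset ℕ)) (V : Finset ℕ) : ℝ :=
  (((children t V).card : ℝ) - 1) * α - γ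

/-- The sum of all edge and vertex weights of `t`. -/
noncomputable def totalWeight (α γ : ℝ) (t : Finset (Finset ℕ)) : ℝ :=
  ∑ C ∈ t, edgeWeight α γ C + ∑ V ∈ branchPoints t, vertexWeight α γ t V

/-- Insert a new leaf `x` in the edge `a → C` leading to `C`: this edge is replaced by the three
edges `a → b`, `b → C` and `b → x`, where the new branch point `b` is `C ∪ {x}`. -/
def insertAtEdge (t : Finset (Finset ℕ)) (C : Finset ℕ) (x : ℕ) : Finset (Finset ℕ) :=
  t.image (fun A => if C ⊂ A then insert x A else A) ∪ {insert x C, {x}}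

/-- Insert a new leaf `x` at the branch point `V`: an edge `V → x` is added. -/
def insertAtVertex (t : Finset (Finset ℕ)) (V : Finset ℕ) (x : ℕ) : Finset (Finset ℕ) :=
  t.image (fun A => if V ⊆ A then insert x A else A) ∪ {{x}}

/-- The probability that `t'` is the tree obtained from `t` when the new leaf `x` is inserted in an
edge or at a branch point of `t` selected with probability proportional to the weights. -/
noncomputable def growthProb (α γ : ℝ) (t : Finset (Finset ℕ)) (x : ℕ)
    (t' : Finset (Finset ℕ)) : ℝ :=
  (∑ C ∈ t.filter (fun C => insertAtEdge t C x = t'), edgeWeight α γ C +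
    ∑ V ∈ (branchPoints t).filter (fun V => insertAtVertex t V x = t'), vertexWeight α γ t V) /
    totalWeight α γ t

/-- `T n`, `n ≥ 1`, is a sequence of random trees that results from the alpha-gamma growth rules.
There is one tree with one leaf and one tree with two leaves; given `T 1, …, T n` for `n ≥ 2`, the
tree `T (n + 1)` is grown from `T n` by the insertion of leaf `n + 1`. (`T 0` is irrelevant.) -/
structure IsAlphaGammaSequence {Ω : Type*} [MeasurableSpace Ω] (P : Measure Ω) (α γ : ℝ)
    (T : ℕ → Ω → Finset (Finset ℕ)) : Prop where
  mem_trees : ∀ n, 1 ≤ n → ∀ ω, T n ω ∈ trees n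
  measurableSet_eq : ∀ n, 1 ≤ n → ∀ t, MeasurableSet {ω | T n ω = t}
  growth : ∀ n, 2 ≤ n → ∀ (s : ℕ → Finset (Finset ℕ)) (t' : Finset (Finset ℕ)),
    P.real {ω | (∀ m, 1 ≤ m → m ≤ n → T m ω = s m) ∧ T (n + 1) ω = t'} =
      P.real {ω | ∀ m, 1 ≤ m → m ≤ n → T m ω = s m} * growthProb α γ (s n) (n + 1) t'

/-! ### Reduced subtrees -/

/-- Vertices including the root: the root is `⊤`, and `u < v` says that `v` is a proper ancestor
of `u`. -/
abbrev Node : Type := WithTop (Finset ℕ)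

/-- All vertices of the tree `t`, including the root. -/
def nodes (t : Finset (Finset ℕ)) : Set Node :=
  {v | v = ⊤ ∨ ∃ A ∈ t, v = (A : Node)}

/-- Within the vertex set `V`, the vertex `u` is the parent of the vertex `v`. -/
def IsParent (V : Set Node) (u v : Node) : Prop :=
  u ∈ V ∧ v ∈ V ∧ v < u ∧ ∀ w ∈ V, ¬ (v < w ∧ w < u)

/-- The tree `t` as a graph, with an edge between each non-root vertex and its parent. -/
def treeGraph (t : Finset (Finset ℕ)) : SimpleGraph Node where
  Adj u v := IsParent (nodes t) u v ∨ IsParent (nodes t) v u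
  symm := ⟨fun _ _ h => h.symm⟩
  loopless := ⟨fun _ h => h.elim (fun h => lt_irrefl _ h.2.2.1) (fun h => lt_irrefl _ h.2.2.1)⟩

/-- The vertices of the subtree of `t` spanned by the root and the leaves `1, …, k`: those on the
ancestral line from one of these leaves to the root. -/
def spanned (t : Finset (Finset ℕ)) (k : ℕ) : Set Node :=
  {v | v ∈ nodes t ∧ ∃ i ∈ Finset.Icc 1 k, (({i} : Finset ℕ) : Node) ≤ v}

/-- The vertices that remain when the vertices of degree 2 of the spanned subtree are removed. -/
def reducedNodes (t : Finset (Finset ℕ)) (k : ℕ) : Set Node :=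
  {v | v ∈ spanned t k ∧ {u | u ∈ spanned t k ∧ (treeGraph t).Adj v u}.ncard ≠ 2}

open Classical in
/-- The set of those labels in `[k]` whose leaves are at or above the vertex `v`. -/
noncomputable def labelsAt (k : ℕ) (v : Node) : Finset ℕ :=
  (Finset.Icc 1 k).filter fun i => (({i} : Finset ℕ) : Node) ≤ v

/-- A discrete tree with edge lengths: a tree shape, and for every member `C` of the shape the
length `len C` of the edge that leads to the vertex `C` from its parent.  (The values of `len`
outside the shape have no meaning.) -/
structure EdgeLengthTree where
  shape : Finset (Finset ℕ)
  len : Finset ℕ → ℝ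

open Classical in
/-- The reduced subtree `R(t, [k])`: the vertices of the spanned subtree that are not of degree 2,
each (except the root) identified with the set of labels in `[k]` of the leaves at or above it;
the length of an edge is the graph distance in `t` between its two ends. -/
noncomputable def reducedSubtree (t : Finset (Finset ℕ)) (k : ℕ) : EdgeLengthTree where
  shape := (Finset.Icc 1 k).powerset.filter fun C =>
    ∃ v ∈ reducedNodes t k, v ≠ ⊤ ∧ labelsAt k v = C
  len C :=
    if h : ∃ p : Node × Node, IsParent (reducedNodes t k) p.1 p.2 ∧ labelsAt k p.2 = C
    then ((treeGraph t).dist h.choose.1 h.choose.2 : ℝ) else 0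

/-- Multiplication of all edge lengths by `c`. -/
def EdgeLengthTree.scale (c : ℝ) (τ : EdgeLengthTree) : EdgeLengthTree where
  shape := τ.shape
  len C := c * τ.len C

/-- Convergence of trees with edge lengths: the shapes are eventually equal to the shape of the
limit, and all edge lengths converge. -/
def EdgeLengthsConverge (τ : ℕ → EdgeLengthTree) (ρ : EdgeLengthTree) : Prop :=
  (∀ᶠ n in atTop, (τ n).shape = ρ.shape) ∧
    ∀ C ∈ ρ.shape, Tendsto (fun n => (τ n).len C) atTop (𝓝 (ρ.len C))

/-- `f` enumerates the edges of the tree `t`, first the `k` leaf edges and then the others. -/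
def IsLeafFirstEnumeration (k : ℕ) {m : ℕ} (t : Finset (Finset ℕ)) (f : Fin m → Finset ℕ) : Prop :=
  Function.Injective f ∧ Set.range f = (t : Set (Finset ℕ)) ∧
    ∀ j : Fin m, (f j).card = 1 ↔ (j : ℕ) < k

/-! ### The distributions in the limit -/

/-- The beta distribution with parameters `a > 0` and `b ≥ 0`; for `b = 0` this is the unit mass
at `1`. -/
noncomputable def betaLaw (a b : ℝ) : Measure ℝ :=
  if b = 0 then Measure.dirac 1 else betaMeasure a b

/-- `σ` is the distribution of `σ₁` for a subordinator with Laplace exponent `x ↦ x ^ γ`, i.e. the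
probability measure on `[0, ∞)` with Laplace transform `x ↦ exp (- x ^ γ)`. -/
def IsStableLaw (γ : ℝ) (σ : Measure ℝ) : Prop :=
  IsProbabilityMeasure σ ∧ σ (Set.Iio 0) = 0 ∧
    ∀ x : ℝ, 0 ≤ x → ∫ s, Real.exp (-(x * s)) ∂σ = Real.exp (-(x ^ γ))

/-- `g` is the Mittag-Leffler density, the density of `σ₁ ^ (-γ)` for a subordinator with Laplace
exponent `x ↦ x ^ γ`. -/
def IsMittagLefflerDensity (γ : ℝ) (g : ℝ → ℝ) : Prop :=
  Measurable g ∧ (∀ s, 0 ≤ g s) ∧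
    ∃ σ : Measure ℝ, IsStableLaw γ σ ∧
      σ.map (fun s => s ^ (-γ)) = volume.withDensity (fun s => ENNReal.ofReal (g s))

/-- For `w = k (1 - α) + ℓ γ`, the measure with density
`Γ(1 + w) / Γ(1 + w / γ) * s ^ (w / γ) * g s`, where `w / γ = ℓ + k (1 - α) / γ`. -/
noncomputable def tiltedLaw (α γ : ℝ) (g : ℝ → ℝ) (k ℓ : ℕ) : Measure ℝ :=
  volume.withDensity fun s => ENNReal.ofReal
    (Real.Gamma (1 + k * (1 - α) + ℓ * γ) / Real.Gamma (1 + ℓ + k * (1 - α) / γ) *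
      s ^ ((ℓ : ℝ) + k * (1 - α) / γ) * g s)

/-- The point of the hyperplane `x₁ + ⋯ + x_m = 1` with given first `m - 1` coordinates. -/
noncomputable def simplexPoint {m : ℕ} (x : Fin (m - 1) → ℝ) : Fin m → ℝ :=
  fun i => if h : (i : ℕ) < m - 1 then x ⟨i, h⟩ else 1 - ∑ j, x j

open Classical in
/-- The measure with density `x₁ ^ (a₁ - 1) ⋯ x_m ^ (a_m - 1)` in the first `m - 1` coordinates,
where `x_m = 1 - x₁ - ⋯ - x_{m-1}`, on the region where all `m` coordinates are positive. -/
noncomputable def dirichletWeight {m : ℕ} (a : Fin m → ℝ) : Measure (Fin (m - 1) → ℝ) :=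
  volume.withDensity fun x =>
    if ∀ i, 0 < simplexPoint x i then ENNReal.ofReal (∏ i, simplexPoint x i ^ (a i - 1)) else 0

/-- The Dirichlet distribution with parameters `a₁, …, a_m > 0`, where `m ≥ 1`. -/
noncomputable def dirichletLaw {m : ℕ} (a : Fin m → ℝ) : Measure (Fin m → ℝ) :=
  ((dirichletWeight a Set.univ)⁻¹ • dirichletWeight a).map simplexPoint

/-- The Dirichlet parameters: `(1 - α) / γ` for the first `k` edges and `1` for the others. -/
noncomputable def dirichletParam (α γ : ℝ) (k m : ℕ) : Fin m → ℝ :=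
  fun j => if (j : ℕ) < k then (1 - α) / γ else 1

end AlphaGamma

open AlphaGamma

namespace AlphaGamma

/-! ### Weights of subtrees -/

/-! Fix `k` and put `K = [k]`. Inserting a label outside `K` does not change the family of traces `A
∩ K`, so the reduced tree almost surely keeps the shape `T k`. The length of its edge `B` is the
number `N_B` of vertices with trace `B` (`dist_eq_card_fibre`). Let `M` be the number of labels
attached in the interior of some edge of the reduced tree.

Write `w_B` for the weight of the edge `B` of `T k`, and `θ` for the sum of these weights. At time
`n` the total weight is `n - α`, the places whose selection increases `M` have weight `M + θ`
(`sum_hits`), and among them the places that lengthen the edge `B` have weight `γ (N_B - 1) + w_B`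
(`sum_edgeWeight_fibre`). This is a nested pair of urn schemes, and rising factorials are adapted to
it: under one growth step the conditional mean of the product of `rising (M + θ + γ ∑ p_B) q` and
all `rising (N_B - 1 + w_B / γ) (p_B)` is its present value times `(n - α + γ ∑ p_B + q) / (n - α)`
(`drift_momentFunctional`).

Divided by the product of these factors, every such functional is a nonnegative martingale given `T
k`. The cases of total degree one yield the almost sure limits `W` of `M / n` and `X_B` of `N_B / n
^ γ`. Squares are dominated by the functionals with doubled exponents, so there is boundedness in
`L²`, and all mixed moments of `W` and the `X_B` are obtained in closed form (`joint_moments`).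

It remains to recognize the law. The moments coincide with those of `W` and `L W ^ γ D_B` for
independent beta, tilted Mittag-Leffler and Dirichlet variables
(`lintegral_prod_pow_massAndLengths`). They grow at most like `C b ^ p p!`, so they determine the
law (`ext_of_moments`), and `W`, `L`, `D` are recovered as `W`, `∑ X_B / W ^ γ` and `X_B / ∑ X_B`
(`map_massAndProportions_eq`). The law depends on `T k` only through its number of edges, which
permits conditioning on a set of trees (`cond_mem_map_eq`).

The existence of the Mittag-Leffler density comes from the same process: for `k = 1` the limit of
the single edge length has the moments of a tilted Mittag-Leffler law, and removing the tilt gives a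
law with the moments `Γ(1 + r) / Γ(1 + γ r)` (`exists_isMittagLefflerLaw`). Its link with the stable
law and its absolute continuity follow from two identities in law, `map_mul_rpow_gammaMeasure` and
`map_mul_rpow_betaMeasure`. -/

lemma mem_trees_iff {n : ℕ} {t : Finset (Finset ℕ)} : t ∈ trees n ↔
    (∀ A ∈ t, A.Nonempty ∧ A ⊆ Finset.Icc 1 n) ∧ Finset.Icc 1 n ∈ t ∧
    (∀ i ∈ Finset.Icc 1 n, {i} ∈ t) ∧
    ∀ A ∈ t, ∀ C ∈ t, Disjoint A C ∨ A ⊆ C ∨ C ⊆ A := Iff.rfl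

lemma subset_or_subset {n : ℕ} {t : Finset (Finset ℕ)} (ht : t ∈ trees n) {A C : Finset ℕ}
    (hA : A ∈ t) (hC : C ∈ t) {x : ℕ} (hxA : x ∈ A) (hxC : x ∈ C) : A ⊆ C ∨ C ⊆ A := by
  rcases ht.2.2.2 A hA C hC with h | h | h
  · exact absurd hxC (Finset.disjoint_left.1 h hxA)
  · exact Or.inl h
  · exact Or.inr h

lemma exists_parent {n : ℕ} {t : Finset (Finset ℕ)} (ht : t ∈ trees n) {A D : Finset ℕ}
    (hA : A ∈ t) (hD : D ∈ t) (hDA : D ⊂ A) :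
    ∃ V ∈ t, V ⊆ A ∧ D ∈ children t V := by
  obtain ⟨V, hV, hmin⟩ := (t.filter fun V => D ⊂ V).exists_min_image Finset.card
    ⟨A, by simp [hA, hDA]⟩
  simp only [Finset.mem_filter] at hV hmin
  obtain ⟨x, hx⟩ := (ht.1 D hD).1
  refine ⟨V, hV.1, ?_, ?_⟩
  · rcases subset_or_subset ht hV.1 hA (hV.2.1 hx) (hDA.1 hx) with h | h
    · exact h
    · exact (Finset.eq_of_subset_of_card_le h (hmin A ⟨hA, hDA⟩)).symm.subset
  · simp only [children, Finset.mem_filter]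
    exact ⟨hD, hV.2, fun E hE h => (Finset.card_lt_card h.2).not_ge (hmin E ⟨hE, h.1⟩)⟩

lemma child_parent_unique {n : ℕ} {t : Finset (Finset ℕ)} (ht : t ∈ trees n) {D V V' : Finset ℕ}
    (hV : V ∈ t) (hV' : V' ∈ t) (h : D ∈ children t V) (h' : D ∈ children t V') : V = V' := by
  simp only [children, Finset.mem_filter] at h h'
  obtain ⟨x, hx⟩ := (ht.1 D h.1).1
  by_contra hne
  rcases subset_or_subset ht hV hV' (h.2.1.1 hx) (h'.2.1.1 hx) with hs | hs
  · exact h'.2.2 V hV ⟨h.2.1, hs.ssubset_of_ne hne⟩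
  · exact h.2.2 V' hV' ⟨h'.2.1, hs.ssubset_of_ne (Ne.symm hne)⟩

lemma card_singletons {n : ℕ} {t : Finset (Finset ℕ)} (ht : t ∈ trees n) {A : Finset ℕ}
    (hA : A ∈ t) : (t.filter fun D => D ⊆ A ∧ D.card = 1).card = A.card := by
  have : (t.filter fun D => D ⊆ A ∧ D.card = 1) = A.image (fun i => ({i} : Finset ℕ)) := by
    ext D
    simp only [Finset.mem_filter, Finset.mem_image]
    constructor
    · rintro ⟨-, h1, h2⟩
      obtain ⟨i, rfl⟩ := Finset.card_eq_one.1 h2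
      exact ⟨i, by simpa using h1, rfl⟩
    · rintro ⟨i, hi, rfl⟩
      exact ⟨ht.2.2.1 i ((ht.1 A hA).2 hi), by simpa using hi, by simp⟩
  rw [this, Finset.card_image_of_injective _ Finset.singleton_injective]

/-- Every vertex of the subtree except its top `A` is a child of exactly one branch point of the
subtree. -/
lemma sum_card_children {n : ℕ} {t : Finset (Finset ℕ)} (ht : t ∈ trees n) {A : Finset ℕ}
    (hA : A ∈ t) : ∑ V ∈ (branchPoints t).filter (· ⊆ A), (children t V).card + 1 =
      (t.filter (· ⊆ A)).card := by
  have h1 : (t.filter (· ⊆ A)).erase A =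
      ((branchPoints t).filter (· ⊆ A)).biUnion (children t) := by
    ext D
    simp only [Finset.mem_erase, Finset.mem_filter, Finset.mem_biUnion, branchPoints]
    constructor
    · rintro ⟨h, hD, hDA⟩
      obtain ⟨V, hV, hVA, hc⟩ := exists_parent ht hA hD (hDA.ssubset_of_ne h)
      refine ⟨V, ⟨⟨hV, ?_⟩, hVA⟩, hc⟩
      simp only [children, Finset.mem_filter] at hc
      have := Finset.card_lt_card hc.2.1
      have := (ht.1 D hD).1.card_pos
      omega
    · rintro ⟨V, ⟨⟨hV, -⟩, hVA⟩, hc⟩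
      simp only [children, Finset.mem_filter] at hc
      exact ⟨(hc.2.1.trans_subset hVA).ne, hc.1, hc.2.1.1.trans hVA⟩
  rw [← Finset.card_erase_add_one (s := t.filter (· ⊆ A)) (a := A) (by simp [hA]), h1,
    Finset.card_biUnion]
  intro V hV V' hV' hne
  simp only [Finset.coe_filter, Finset.mem_filter, branchPoints, Set.mem_ofPred_eq] at hV hV'
  refine Finset.disjoint_left.2 fun D hD hD' => hne ?_
  exact child_parent_unique ht hV.1.1 hV'.1.1 hD hD'

lemma sum_edgeWeight (α γ : ℝ) (s : Finset (Finset ℕ)) :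
    ∑ C ∈ s, edgeWeight α γ C = (s.filter fun C => C.card = 1).card * (1 - α) +
      (s.filter fun C => ¬ C.card = 1).card * γ := by
  simp only [edgeWeight, Finset.sum_ite, Finset.sum_const, nsmul_eq_mul]

/-- The `-γ` of each branch point cancels the `γ` of the edge leading to it. The leaf edges give
`|A| (1 - α)`, and by counting children the sum of `c - 1` over the branch points is `|A| - 1`. -/
lemma subtree_weight (α γ : ℝ) {n : ℕ} {t : Finset (Finset ℕ)} (ht : t ∈ trees n) {A : Finset ℕ}
    (hA : A ∈ t) : ∑ D ∈ t.filter (· ⊆ A), edgeWeight α γ D +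
      ∑ V ∈ (branchPoints t).filter (· ⊆ A), vertexWeight α γ t V = A.card - α := by
  have h1 := card_singletons ht hA
  have h2 := sum_card_children ht hA
  have h3 := Finset.card_filter_add_card_filter_not (s := t.filter (· ⊆ A)) (fun C => C.card = 1)
  have h4 : (t.filter (· ⊆ A)).filter (fun C => ¬ C.card = 1) =
      (branchPoints t).filter (· ⊆ A) := by
    ext D
    simp only [Finset.mem_filter, branchPoints]
    constructor
    · rintro ⟨⟨hD, hDA⟩, h⟩
      have := (ht.1 D hD).1.card_pos
      exact ⟨⟨hD, by omega⟩, hDA⟩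
    · rintro ⟨⟨hD, h⟩, hDA⟩
      exact ⟨⟨hD, hDA⟩, by omega⟩
  rw [sum_edgeWeight, h4, Finset.filter_filter, h1]
  rw [Finset.filter_filter, h1, h4, ← h2] at h3
  have h5 : ((A.card : ℝ) + ((branchPoints t).filter (· ⊆ A)).card) =
      ∑ V ∈ (branchPoints t).filter (· ⊆ A), ((children t V).card : ℝ) + 1 := by
    exact_mod_cast h3
  simp only [vertexWeight, Finset.sum_sub_distrib, ← Finset.sum_mul, Finset.sum_const,
    nsmul_eq_mul]
  linear_combination (-α) * h5

lemma totalWeight_eq (α γ : ℝ) {n : ℕ} {t : Finset (Finset ℕ)} (ht : t ∈ trees n) :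
    totalWeight α γ t = n - α := by
  have h := subtree_weight α γ ht ht.2.1
  rw [Finset.filter_true_of_mem (fun D hD => (ht.1 D hD).2), Finset.filter_true_of_mem
    (s := branchPoints t) (fun D hD => (ht.1 D (Finset.mem_filter.1 hD).1).2)] at h
  simpa [totalWeight] using h

/-! ### Traces on a set of labels -/

/-- The vertices of `t` at or above which exactly the labels `B` of `K` are found. -/
def fibre (K : Finset ℕ) (t : Finset (Finset ℕ)) (B : Finset ℕ) : Finset (Finset ℕ) :=
  t.filter fun A => A ∩ K = B

/-- The shape of the tree `t` reduced to the labels in `K`. -/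
def traceShape (K : Finset ℕ) (t : Finset (Finset ℕ)) : Finset (Finset ℕ) :=
  (t.image (· ∩ K)).erase ∅

/-- The pair of vertices `A`, `A'` lies on the same edge of the reduced tree. -/
def SameEdge (K : Finset ℕ) (t : Finset (Finset ℕ)) (A A' : Finset ℕ) : Prop :=
  A ∈ t ∧ A' ∈ t ∧ A ∩ K = A' ∩ K ∧ (A ∩ K).Nonempty

open Classical in
/-- The labels of the leaves attached in the interior of an edge of the reduced tree. -/
noncomputable def attached (K : Finset ℕ) (t : Finset (Finset ℕ)) : Finset ℕ :=
  (t.biUnion id).filter fun x => ∃ A A', SameEdge K t A A' ∧ x ∈ A ∧ x ∉ A'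

lemma mem_attached {K : Finset ℕ} {t : Finset (Finset ℕ)} {x : ℕ} :
    x ∈ attached K t ↔ ∃ A A', SameEdge K t A A' ∧ x ∈ A ∧ x ∉ A' := by
  simp only [attached, Finset.mem_filter, Finset.mem_biUnion, id, and_iff_right_iff_imp]
  rintro ⟨A, A', h, hx, -⟩
  exact ⟨A, h.1, hx⟩

/-- Insertion in the edge leading to `C` adds to the leaves on the edges of the reduced tree. -/
def EdgeHits (K : Finset ℕ) (t : Finset (Finset ℕ)) (C : Finset ℕ) : Prop :=
  ∃ A A', SameEdge K t A A' ∧ C ⊆ A ∧ ¬ C ⊂ A'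

/-- Insertion at the vertex `V` adds to the leaves on the edges of the reduced tree. -/
def VertexHits (K : Finset ℕ) (t : Finset (Finset ℕ)) (V : Finset ℕ) : Prop :=
  ∃ A A', SameEdge K t A A' ∧ V ⊆ A ∧ ¬ V ⊆ A'

lemma mem_fibre {K : Finset ℕ} {t : Finset (Finset ℕ)} {A B : Finset ℕ} :
    A ∈ fibre K t B ↔ A ∈ t ∧ A ∩ K = B := by simp [fibre]

lemma mem_traceShape {K : Finset ℕ} {t : Finset (Finset ℕ)} {B : Finset ℕ} :
    B ∈ traceShape K t ↔ B.Nonempty ∧ (fibre K t B).Nonempty := by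
  rw [Finset.nonempty_iff_ne_empty (s := B)]
  simp only [traceShape, Finset.mem_erase, Finset.mem_image, Finset.Nonempty, mem_fibre]

lemma exists_fibre_min {n : ℕ} {t : Finset (Finset ℕ)} (ht : t ∈ trees n) {K B : Finset ℕ}
    (hB : B ∈ traceShape K t) : ∃ m ∈ fibre K t B, ∀ A ∈ fibre K t B, m ⊆ A := by
  obtain ⟨⟨x, hx⟩, hF⟩ := mem_traceShape.1 hB
  obtain ⟨m, hm, hmin⟩ := (fibre K t B).exists_min_image Finset.card hF
  refine ⟨m, hm, fun A hA => ?_⟩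
  have h1 := mem_fibre.1 hm
  have h2 := mem_fibre.1 hA
  rcases subset_or_subset ht h1.1 h2.1 (x := x) (Finset.mem_inter.1 (h1.2 ▸ hx)).1
    (Finset.mem_inter.1 (h2.2 ▸ hx)).1 with h | h
  · exact h
  · exact (Finset.eq_of_subset_of_card_le h (hmin A hA)).symm.subset

lemma exists_fibre_max {n : ℕ} {t : Finset (Finset ℕ)} (ht : t ∈ trees n) {K B : Finset ℕ}
    (hB : B ∈ traceShape K t) : ∃ m ∈ fibre K t B, ∀ A ∈ fibre K t B, A ⊆ m := by
  obtain ⟨⟨x, hx⟩, hF⟩ := mem_traceShape.1 hB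
  obtain ⟨m, hm, hmax⟩ := (fibre K t B).exists_max_image Finset.card hF
  refine ⟨m, hm, fun A hA => ?_⟩
  have h1 := mem_fibre.1 hm
  have h2 := mem_fibre.1 hA
  rcases subset_or_subset ht h1.1 h2.1 (x := x) (Finset.mem_inter.1 (h1.2 ▸ hx)).1
    (Finset.mem_inter.1 (h2.2 ▸ hx)).1 with h | h
  · exact (Finset.eq_of_subset_of_card_le h (hmax A hA)).symm.subset
  · exact h

/-- The minimal vertex of a fibre is a leaf if and only if the trace is a single label. -/
lemma card_fibre_min {n : ℕ} {t : Finset (Finset ℕ)} (ht : t ∈ trees n) {K B m : Finset ℕ}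
    (hK : K ⊆ Finset.Icc 1 n) (hm : m ∈ fibre K t B) (hB : B.Nonempty)
    (hmin : ∀ A ∈ fibre K t B, m ⊆ A) : m.card = 1 ↔ B.card = 1 := by
  have h1 := mem_fibre.1 hm
  have hBm : B ⊆ m := h1.2 ▸ Finset.inter_subset_left
  constructor
  · intro h
    have := Finset.card_le_card hBm
    have := hB.card_pos
    omega
  · intro h
    obtain ⟨i, rfl⟩ := Finset.card_eq_one.1 h
    have hiK : i ∈ K := (Finset.mem_inter.1 (h1.2 ▸ Finset.mem_singleton_self i)).2
    have h2 : m ⊆ {i} := hmin _ (mem_fibre.2 ⟨ht.2.2.1 i (hK hiK), by simp [hiK]⟩)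
    have h3 := Finset.card_le_card h2
    have h4 := (Finset.card_pos.2 (ht.1 m h1.1).1)
    rw [Finset.card_singleton] at h3
    omega

lemma edgeWeight_congr {α γ : ℝ} {A B : Finset ℕ} (h : A.card = 1 ↔ B.card = 1) :
    edgeWeight α γ A = edgeWeight α γ B := by simp [edgeWeight, h]

/-- A fibre is a chain, so only its minimal vertex can be a leaf, and it is one exactly if `B` is a
single label. All other vertices of the fibre have inner edges of weight `γ`. -/
lemma sum_edgeWeight_fibre (α γ : ℝ) {n : ℕ} {t : Finset (Finset ℕ)} (ht : t ∈ trees n)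
    {K B : Finset ℕ} (hK : K ⊆ Finset.Icc 1 n) (hB : B ∈ traceShape K t) :
    ∑ C ∈ fibre K t B, edgeWeight α γ C = γ * ((fibre K t B).card - 1) + edgeWeight α γ B := by
  obtain ⟨m, hm, hmin⟩ := exists_fibre_min ht hB
  rw [← Finset.sum_erase_add _ _ hm, edgeWeight_congr
    (card_fibre_min ht hK hm (mem_traceShape.1 hB).1 hmin)]
  congr 1
  rw [Finset.sum_congr rfl (g := fun _ => γ), Finset.sum_const, Finset.card_erase_of_mem hm,
    nsmul_eq_mul, Nat.cast_sub (Finset.card_pos.2 ⟨m, hm⟩)]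
  · push_cast; ring
  · intro D hD
    have hD' := Finset.mem_erase.1 hD
    have h1 := Finset.card_lt_card ((hmin D hD'.2).ssubset_of_ne (Ne.symm hD'.1))
    have h2 := (ht.1 m (mem_fibre.1 hm).1).1.card_pos
    simp only [edgeWeight]
    rw [if_neg (by omega)]

/-! ### The weight of the insertions on the edges of the reduced tree -/

lemma exists_fibre_bounds {n : ℕ} {t : Finset (Finset ℕ)} (ht : t ∈ trees n) (K : Finset ℕ) :
    ∃ lo hi : Finset ℕ → Finset ℕ, ∀ B ∈ traceShape K t, lo B ∈ fibre K t B ∧ hi B ∈ fibre K t B ∧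
      ∀ A ∈ fibre K t B, lo B ⊆ A ∧ A ⊆ hi B := by
  classical
  choose! lo hlo hlo' using fun B (hB : B ∈ traceShape K t) => exists_fibre_min ht hB
  choose! hi hhi hhi' using fun B (hB : B ∈ traceShape K t) => exists_fibre_max ht hB
  exact ⟨lo, hi, fun B hB => ⟨hlo B hB, hhi B hB, fun A hA => ⟨hlo' B hB A hA, hhi' B hB A hA⟩⟩⟩

section Bands

variable {n : ℕ} {t : Finset (Finset ℕ)} {K : Finset ℕ} {lo hi : Finset ℕ → Finset ℕ}

/-- `attached`, `EdgeHits` and `VertexHits` all have this form with monotone `p` and `q`, so it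
suffices to test the two extreme vertices of each fibre. -/
lemma exists_sameEdge_iff
    (h : ∀ B ∈ traceShape K t, lo B ∈ fibre K t B ∧ hi B ∈ fibre K t B ∧
      ∀ A ∈ fibre K t B, lo B ⊆ A ∧ A ⊆ hi B)
    {p q : Finset ℕ → Prop} (hp : ∀ A A', A ⊆ A' → p A → p A') (hq : ∀ A A', A ⊆ A' → q A → q A') :
    (∃ A A', SameEdge K t A A' ∧ p A ∧ ¬ q A') ↔ ∃ B ∈ traceShape K t, p (hi B) ∧ ¬ q (lo B) := by
  constructor
  · rintro ⟨A, A', ⟨hA, hA', he, hne⟩, h1, h2⟩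
    have hB : A ∩ K ∈ traceShape K t := mem_traceShape.2 ⟨hne, A, mem_fibre.2 ⟨hA, rfl⟩⟩
    obtain ⟨-, -, h3⟩ := h _ hB
    exact ⟨_, hB, hp _ _ (h3 A (mem_fibre.2 ⟨hA, rfl⟩)).2 h1,
      fun h4 => h2 (hq _ _ (h3 A' (mem_fibre.2 ⟨hA', he.symm⟩)).1 h4)⟩
  · rintro ⟨B, hB, h1, h2⟩
    obtain ⟨hl, hh, -⟩ := h _ hB
    rw [mem_fibre] at hl hh
    exact ⟨hi B, lo B, ⟨hh.1, hl.1, hh.2.trans hl.2.symm, by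
      rw [hh.2]; exact (mem_traceShape.1 hB).1⟩, h1, h2⟩

lemma hi_subset_lo (ht : t ∈ trees n)
    (h : ∀ B ∈ traceShape K t, lo B ∈ fibre K t B ∧ hi B ∈ fibre K t B ∧
      ∀ A ∈ fibre K t B, lo B ⊆ A ∧ A ⊆ hi B) {B B' : Finset ℕ} (hB : B ∈ traceShape K t)
    (hB' : B' ∈ traceShape K t) (hne : B ≠ B') (hs : hi B ⊆ hi B') : hi B ⊂ lo B' := by
  obtain ⟨-, hh, -⟩ := h B hB
  obtain ⟨hl', hh', -⟩ := h B' hB'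
  rw [mem_fibre] at hh hl' hh'
  obtain ⟨x, hx⟩ := (mem_traceShape.1 hB).1
  have hBB' : B ⊆ B' := by rw [← hh.2, ← hh'.2]; exact Finset.inter_subset_inter_right hs
  rcases subset_or_subset ht hh.1 hl'.1 (x := x) (Finset.mem_inter.1 (hh.2 ▸ hx)).1
    (Finset.mem_inter.1 (hl'.2 ▸ hBB' hx)).1 with h1 | h1
  · refine h1.ssubset_of_ne fun h2 => hne ?_
    rw [← hh.2, ← hl'.2, h2]
  · exfalso; apply hne; apply hBB'.antisymm
    rw [← hh.2, ← hl'.2]; exact Finset.inter_subset_inter_right h1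

/-- The point `x` makes the tops of the two fibres comparable. If the traces differ, one fibre then
lies strictly inside the bottom of the other, and `hpq` contradicts `¬ q` there. -/
lemma band_unique (ht : t ∈ trees n)
    (h : ∀ B ∈ traceShape K t, lo B ∈ fibre K t B ∧ hi B ∈ fibre K t B ∧
      ∀ A ∈ fibre K t B, lo B ⊆ A ∧ A ⊆ hi B) {B B' : Finset ℕ} (hB : B ∈ traceShape K t)
    (hB' : B' ∈ traceShape K t) {p q : Finset ℕ → Prop} (hpq : ∀ A A', A ⊂ A' → p A → q A')
    {x : ℕ} (hx : ∀ A, p A → x ∈ A)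
    (h1 : p (hi B)) (h2 : ¬ q (lo B)) (h1' : p (hi B')) (h2' : ¬ q (lo B')) : B = B' := by
  by_contra hne
  rcases subset_or_subset ht (mem_fibre.1 (h B hB).2.1).1 (mem_fibre.1 (h B' hB').2.1).1
    (hx _ h1) (hx _ h1') with hs | hs
  · exact h2' (hpq _ _ (hi_subset_lo ht h hB hB' hne hs) h1)
  · exact h2 (hpq _ _ (hi_subset_lo ht h hB' hB (Ne.symm hne) hs) h1')

end Bands

open Classical in
-- The places that hit the edge `B` form the difference of the subtrees at `hi B` and `lo B`, except
-- that the edge leading to `lo B` is also included. By `subtree_weight` the two terms `-α` cancel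
-- and `|hi B| - |lo B|` plus the weight of that edge remains. Different edges are hit at disjoint
-- sets of places.
lemma sum_hits (α γ : ℝ) {n : ℕ} {t : Finset (Finset ℕ)} (ht : t ∈ trees n)
    {K : Finset ℕ} (hK : K ⊆ Finset.Icc 1 n) :
    ∑ C ∈ t.filter (EdgeHits K t), edgeWeight α γ C +
      ∑ V ∈ (branchPoints t).filter (VertexHits K t), vertexWeight α γ t V =
    (attached K t).card + ∑ B ∈ traceShape K t, edgeWeight α γ B := by
  obtain ⟨lo, hi, h⟩ := exists_fibre_bounds ht K
  have hlohi : ∀ B ∈ traceShape K t, lo B ⊆ hi B := fun B hB => ((h B hB).2.2 _ (h B hB).1).2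
  have e1 : t.filter (EdgeHits K t) = (traceShape K t).biUnion
      (fun B => (t.filter (· ⊆ hi B)) \ (t.filter (· ⊂ lo B))) := by
    ext C
    simp only [Finset.mem_filter, Finset.mem_biUnion, Finset.mem_sdiff, EdgeHits]
    rw [exists_sameEdge_iff h (p := (C ⊆ ·)) (q := (C ⊂ ·)) (fun _ _ h h' => h'.trans h)
      (fun _ _ h h' => h'.trans_subset h)]
    constructor
    · rintro ⟨hC, B, hB, h1, h2⟩; exact ⟨B, hB, ⟨hC, h1⟩, fun h3 => h2 h3.2⟩
    · rintro ⟨B, hB, ⟨hC, h1⟩, h2⟩; exact ⟨hC, B, hB, h1, fun h3 => h2 ⟨hC, h3⟩⟩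
  have e2 : (branchPoints t).filter (VertexHits K t) = (traceShape K t).biUnion
      (fun B => ((branchPoints t).filter (· ⊆ hi B)) \ ((branchPoints t).filter (· ⊆ lo B))) := by
    ext C
    simp only [Finset.mem_filter, Finset.mem_biUnion, Finset.mem_sdiff, VertexHits]
    rw [exists_sameEdge_iff h (p := (C ⊆ ·)) (q := (C ⊆ ·)) (fun _ _ h h' => h'.trans h)
      (fun _ _ h h' => h'.trans h)]
    constructor
    · rintro ⟨hC, B, hB, h1, h2⟩; exact ⟨B, hB, ⟨hC, h1⟩, fun h3 => h2 h3.2⟩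
    · rintro ⟨B, hB, ⟨hC, h1⟩, h2⟩; exact ⟨hC, B, hB, h1, fun h3 => h2 ⟨hC, h3⟩⟩
  have e3 : attached K t = (traceShape K t).biUnion (fun B => hi B \ lo B) := by
    ext x
    simp only [mem_attached, Finset.mem_biUnion, Finset.mem_sdiff]
    rw [exists_sameEdge_iff h (p := (x ∈ ·)) (q := (x ∈ ·)) (fun _ _ h h' => h h')
      (fun _ _ h h' => h h')]
  rw [e1, e2, e3, Finset.sum_biUnion, Finset.sum_biUnion, Finset.card_biUnion, Nat.cast_sum,
    ← Finset.sum_add_distrib, ← Finset.sum_add_distrib]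
  · refine Finset.sum_congr rfl fun B hB => ?_
    obtain ⟨hl, hh, -⟩ := h B hB
    have hlm := (mem_fibre.1 hl).1
    have w1 := subtree_weight α γ ht (mem_fibre.1 hh).1
    have w2 := subtree_weight α γ ht hlm
    have e4 : t.filter (· ⊂ lo B) = (t.filter (· ⊆ lo B)).erase (lo B) := by
      ext C; simp only [Finset.mem_filter, Finset.mem_erase, Finset.ssubset_iff_subset_ne]; tauto
    have s1 := Finset.sum_sdiff (f := edgeWeight α γ) (s₁ := t.filter (· ⊂ lo B))
      (s₂ := t.filter (· ⊆ hi B)) (fun C hC => by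
        simp only [Finset.mem_filter] at hC ⊢; exact ⟨hC.1, hC.2.1.trans (hlohi B hB)⟩)
    have s2 := Finset.sum_sdiff (f := vertexWeight α γ t)
      (s₁ := (branchPoints t).filter (· ⊆ lo B))
      (s₂ := (branchPoints t).filter (· ⊆ hi B)) (fun C hC => by
        simp only [Finset.mem_filter] at hC ⊢; exact ⟨hC.1, hC.2.trans (hlohi B hB)⟩)
    have s3 := Finset.sum_erase_add (t.filter (· ⊆ lo B)) (edgeWeight α γ) (a := lo B)
      (by simp [hlm])
    rw [← e4] at s3
    have s4 := edgeWeight_congr (α := α) (γ := γ)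
      (card_fibre_min ht hK hl (mem_traceShape.1 hB).1 fun A hA => ((h B hB).2.2 A hA).1)
    rw [Finset.card_sdiff_of_subset (hlohi B hB), Nat.cast_sub (Finset.card_le_card (hlohi B hB))]
    linarith
  · intro B hB B' hB' hne
    refine Finset.disjoint_left.2 fun x hx hx' => hne ?_
    rw [Finset.mem_sdiff] at hx hx'
    exact band_unique ht h hB hB' (p := (x ∈ ·)) (q := (x ∈ ·)) (fun _ _ h h' => h.1 h')
      (fun _ h => h) hx.1 hx.2 hx'.1 hx'.2
  · intro B hB B' hB' hne
    refine Finset.disjoint_left.2 fun C hx hx' => hne ?_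
    simp only [Finset.mem_sdiff, Finset.mem_filter, not_and, branchPoints] at hx hx'
    obtain ⟨y, hy⟩ := (ht.1 C hx.1.1.1).1
    exact band_unique ht h hB hB' (p := (C ⊆ ·)) (q := (C ⊆ ·)) (fun _ _ h h' => h'.trans h.1)
      (fun _ h => h hy) hx.1.2 (hx.2 hx.1.1) hx'.1.2 (hx'.2 hx.1.1)
  · intro B hB B' hB' hne
    refine Finset.disjoint_left.2 fun C hx hx' => hne ?_
    simp only [Finset.mem_sdiff, Finset.mem_filter, not_and] at hx hx'
    obtain ⟨y, hy⟩ := (ht.1 C hx.1.1).1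
    exact band_unique ht h hB hB' (p := (C ⊆ ·)) (q := (C ⊂ ·)) (fun _ _ h h' => h'.trans_ssubset h)
      (fun _ h => h hy) hx.1.2 (hx.2 hx.1.1) hx'.1.2 (hx'.2 hx.1.1)

/-! ### Insertion of a leaf -/

/-- `t'` arises from `t` when the label `x` is added to copies of the vertices that satisfy `Q`,
the vertices that do not satisfy `P` being kept. -/
def IsGrowth (t t' : Finset (Finset ℕ)) (x : ℕ) (P Q : Finset ℕ → Prop) : Prop :=
  ∀ D, D ∈ t' ↔ (D ∈ t ∧ ¬ P D) ∨ (∃ A ∈ t, Q A ∧ D = insert x A) ∨ D = {x}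

lemma isGrowth_insertAtEdge {t : Finset (Finset ℕ)} {C : Finset ℕ} (hC : C ∈ t) (x : ℕ) :
    IsGrowth t (insertAtEdge t C x) x (C ⊂ ·) (C ⊆ ·) := by
  intro D
  simp only [insertAtEdge, Finset.mem_union, Finset.mem_image, Finset.mem_insert,
    Finset.mem_singleton]
  constructor
  · rintro (⟨A, hA, rfl⟩ | rfl | h)
    · split_ifs with h
      · exact Or.inr (Or.inl ⟨A, hA, h.1, rfl⟩)
      · exact Or.inl ⟨hA, h⟩
    · exact Or.inr (Or.inl ⟨C, hC, subset_rfl, rfl⟩)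
    · exact Or.inr (Or.inr h)
  · rintro (⟨h1, h2⟩ | ⟨A, hA, h, rfl⟩ | h)
    · exact Or.inl ⟨D, h1, by simp [h2]⟩
    · rcases h.eq_or_ssubset with rfl | h
      · exact Or.inr (Or.inl rfl)
      · exact Or.inl ⟨A, hA, by simp [h]⟩
    · exact Or.inr (Or.inr h)

lemma isGrowth_insertAtVertex {t : Finset (Finset ℕ)} (V : Finset ℕ) (x : ℕ) :
    IsGrowth t (insertAtVertex t V x) x (V ⊆ ·) (V ⊆ ·) := by
  intro D
  simp only [insertAtVertex, Finset.mem_union, Finset.mem_image, Finset.mem_singleton]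
  constructor
  · rintro (⟨A, hA, rfl⟩ | h)
    · split_ifs with h
      · exact Or.inr (Or.inl ⟨A, hA, h, rfl⟩)
      · exact Or.inl ⟨hA, h⟩
    · exact Or.inr (Or.inr h)
  · rintro (⟨h1, h2⟩ | ⟨A, hA, h, rfl⟩ | h)
    · exact Or.inl ⟨D, h1, by simp [h2]⟩
    · exact Or.inl ⟨A, hA, by simp [h]⟩
    · exact Or.inr h

section Growth

variable {n : ℕ} {t t' : Finset (Finset ℕ)} {P Q : Finset ℕ → Prop} {K : Finset ℕ}

lemma not_mem_of_mem_trees (ht : t ∈ trees n) {A : Finset ℕ} (hA : A ∈ t) : n + 1 ∉ A :=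
  fun h => by have := Finset.mem_Icc.1 ((ht.1 A hA).2 h); omega

lemma IsGrowth.mem_trees (ht : t ∈ trees n) (hg : IsGrowth t t' (n + 1) P Q)
    {C : Finset ℕ} (hC : C ∈ t) (hQ : ∀ A, Q A ↔ C ⊆ A) (hP : ∀ A, C ⊂ A → P A)
    (hP1 : ∀ i, ¬ P {i}) : t' ∈ trees (n + 1) := by
  have hIcc : Finset.Icc 1 (n + 1) = insert (n + 1) (Finset.Icc 1 n) := by
    ext x; simp only [Finset.mem_Icc, Finset.mem_insert]; omega
  obtain ⟨c, hc⟩ := (ht.1 C hC).1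
  -- A vertex that is kept cannot strictly contain a copied one: above `C` the only possibly kept
  -- vertex is `C` itself.
  have key : ∀ A ∈ t, ¬ P A → ∀ A' ∈ t, Q A' →
      Disjoint A (insert (n + 1) A') ∨ A ⊆ insert (n + 1) A' := by
    intro A hA hPA A' hA' hQA'
    rw [hQ] at hQA'
    rcases ht.2.2.2 A hA A' hA' with h | h | h
    · exact Or.inl (Finset.disjoint_insert_right.2 ⟨not_mem_of_mem_trees ht hA, h⟩)
    · exact Or.inr (h.trans (Finset.subset_insert _ _))
    · have h1 : C = A := by
        by_contra hne
        exact hPA (hP A ((hQA'.trans h).ssubset_of_ne hne))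
      exact Or.inr ((h1 ▸ hQA').trans (Finset.subset_insert _ _))
  refine mem_trees_iff.2 ⟨?_, ?_, ?_, ?_⟩
  · intro D hD
    rw [hIcc]
    rcases (hg D).1 hD with ⟨h, -⟩ | ⟨A, hA, -, rfl⟩ | rfl
    · exact ⟨(ht.1 D h).1, (ht.1 D h).2.trans (Finset.subset_insert _ _)⟩
    · exact ⟨Finset.insert_nonempty _ _, Finset.insert_subset_insert _ (ht.1 A hA).2⟩
    · simp
  · rw [hIcc]
    exact (hg _).2 (Or.inr (Or.inl ⟨_, ht.2.1, (hQ _).2 (ht.1 C hC).2, rfl⟩))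
  · intro i hi
    rw [hIcc, Finset.mem_insert] at hi
    rcases hi with rfl | hi
    · exact (hg _).2 (Or.inr (Or.inr rfl))
    · exact (hg _).2 (Or.inl ⟨ht.2.2.1 i hi, hP1 i⟩)
  · intro D hD D' hD'
    rcases (hg D).1 hD with ⟨h, hp⟩ | ⟨A, hA, hq, rfl⟩ | rfl <;>
      rcases (hg D').1 hD' with ⟨h', hp'⟩ | ⟨A', hA', hq', rfl⟩ | rfl
    · exact ht.2.2.2 D h D' h'
    · exact (key D h hp A' hA' hq').imp_right Or.inl
    · exact Or.inl (Finset.disjoint_singleton_right.2 (not_mem_of_mem_trees ht h))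
    · exact (key D' h' hp' A hA hq).imp (fun h => h.symm) Or.inr
    · rw [hQ] at hq hq'
      exact Or.inr ((subset_or_subset ht hA hA' (hq hc) (hq' hc)).imp
        (Finset.insert_subset_insert _) (Finset.insert_subset_insert _))
    · exact Or.inr (Or.inr (by simp))
    · exact Or.inl (Finset.disjoint_singleton_left.2 (not_mem_of_mem_trees ht h'))
    · exact Or.inr (Or.inl (by simp))
    · exact Or.inr (Or.inl subset_rfl)

open Classical in
-- Keeping or copying a vertex preserves its trace because `x ∉ K`, and the new leaf has empty
-- trace. Kept vertices lack `x` and copies contain it, so nothing is counted twice.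
lemma IsGrowth.card_fibre {x : ℕ} (hxt : ∀ A ∈ t, x ∉ A) (hg : IsGrowth t t' x P Q) (hx : x ∉ K)
    {B : Finset ℕ} (hB : B.Nonempty) : (fibre K t' B).card =
      ((fibre K t B).filter fun A => ¬ P A).card + ((fibre K t B).filter Q).card := by
  have h1 : fibre K t' B = (fibre K t B).filter (fun A => ¬ P A) ∪
      ((fibre K t B).filter Q).image (insert x) := by
    ext D
    simp only [Finset.mem_union, Finset.mem_image, Finset.mem_filter, mem_fibre, hg D]
    constructor
    · rintro ⟨⟨h, hp⟩ | ⟨A, hA, hq, rfl⟩ | rfl, hD⟩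
      · exact Or.inl ⟨⟨h, hD⟩, hp⟩
      · rw [Finset.insert_inter_of_notMem hx] at hD
        exact Or.inr ⟨A, ⟨⟨hA, hD⟩, hq⟩, rfl⟩
      · rw [Finset.singleton_inter_of_notMem hx] at hD
        exact absurd hD.symm hB.ne_empty
    · rintro (⟨⟨h, hD⟩, hp⟩ | ⟨A, ⟨⟨hA, hD⟩, hq⟩, rfl⟩)
      · exact ⟨Or.inl ⟨h, hp⟩, hD⟩
      · exact ⟨Or.inr (Or.inl ⟨A, hA, hq, rfl⟩), by rwa [Finset.insert_inter_of_notMem hx]⟩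
  rw [h1, Finset.card_union_of_disjoint, Finset.card_image_of_injOn]
  · intro A hA A' hA' h
    simp only [Finset.coe_filter, mem_fibre, Set.mem_ofPred_eq] at hA hA'
    rw [← Finset.erase_insert (hxt A hA.1.1), ← Finset.erase_insert (hxt A' hA'.1.1)]
    exact congrArg (Finset.erase · x) h
  · refine Finset.disjoint_left.2 fun D hD hD' => ?_
    simp only [Finset.mem_filter, Finset.mem_image, mem_fibre] at hD hD'
    obtain ⟨A, -, rfl⟩ := hD'
    exact hxt _ hD.1.1 (Finset.mem_insert_self _ _)

open Classical in
-- Erasing `x` maps vertices with nonempty trace back to `t` with the same trace, and by `hPQ` every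
-- vertex of `t` survives in some version. Hence only the status of `x` is in question: it is
-- attached when a copied and a kept vertex share an edge.
lemma IsGrowth.attached {x : ℕ} (hxt : ∀ A ∈ t, x ∉ A) (hg : IsGrowth t t' x P Q) (hx : x ∉ K)
    (hPQ : ∀ A, P A → Q A) : attached K t' = attached K t ∪
      if ∃ A A', SameEdge K t A A' ∧ Q A ∧ ¬ P A' then {x} else ∅ := by
  have back : ∀ D ∈ t', (D ∩ K).Nonempty → (D.erase x) ∈ t ∧ D ∩ K = (D.erase x) ∩ K ∧
      (x ∈ D → Q (D.erase x)) ∧ (x ∉ D → ¬ P (D.erase x)) := by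
    intro D hD hne
    rcases (hg D).1 hD with ⟨h, hp⟩ | ⟨A, hA, hq, rfl⟩ | rfl
    · rw [Finset.erase_eq_of_notMem (hxt D h)]
      exact ⟨h, rfl, fun h' => absurd h' (hxt D h), fun _ => hp⟩
    · rw [Finset.erase_insert (hxt A hA)]
      exact ⟨hA, Finset.insert_inter_of_notMem hx, fun _ => hq, fun h => by simp at h⟩
    · rw [Finset.singleton_inter_of_notMem hx] at hne
      exact absurd hne Finset.not_nonempty_empty
  have keep : ∀ A ∈ t, ¬ P A → A ∈ t' := fun A hA h => (hg A).2 (Or.inl ⟨hA, h⟩)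
  have copy : ∀ A ∈ t, Q A → insert x A ∈ t' := fun A hA h => (hg _).2 (Or.inr (Or.inl ⟨A, hA, h, rfl⟩))
  have forth : ∀ A ∈ t, ∃ D ∈ t', D ∩ K = A ∩ K ∧ ∀ y, y ≠ x → (y ∈ D ↔ y ∈ A) := by
    intro A hA
    by_cases h : P A
    · exact ⟨insert x A, copy A hA (hPQ A h), Finset.insert_inter_of_notMem hx,
        fun y hy => by simp [hy]⟩
    · exact ⟨A, keep A hA h, rfl, fun y hy => Iff.rfl⟩
  ext y
  by_cases hy : y = x
  · subst hy
    have h1 : y ∉ AlphaGamma.attached K t := by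
      rw [mem_attached]
      rintro ⟨A, A', h, h2, -⟩
      exact hxt A h.1 h2
    have h2 : y ∈ (if ∃ A A', SameEdge K t A A' ∧ Q A ∧ ¬ P A' then {y} else ∅ : Finset ℕ) ↔
        ∃ A A', SameEdge K t A A' ∧ Q A ∧ ¬ P A' := by split_ifs with h <;> simp [h]
    rw [Finset.mem_union, h2, mem_attached, or_iff_right h1]
    constructor
    · rintro ⟨D, D', ⟨hD, hD', he, hne⟩, h3, h4⟩
      obtain ⟨b1, b2, b3, -⟩ := back D hD hne
      obtain ⟨c1, c2, -, c3⟩ := back D' hD' (he ▸ hne)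
      exact ⟨_, _, ⟨b1, c1, b2.symm.trans (he.trans c2), b2 ▸ hne⟩, b3 h3, c3 h4⟩
    · rintro ⟨A, A', ⟨hA, hA', he, hne⟩, h3, h4⟩
      refine ⟨insert y A, A', ⟨copy A hA h3, keep A' hA' h4, ?_, ?_⟩,
        Finset.mem_insert_self _ _, hxt A' hA'⟩ <;> rw [Finset.insert_inter_of_notMem hx]
      exacts [he, hne]
  · have h2 : y ∉ (if ∃ A A', SameEdge K t A A' ∧ Q A ∧ ¬ P A' then {x} else ∅ : Finset ℕ) := by
      split_ifs <;> simp [hy]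
    rw [Finset.mem_union, or_iff_left h2, mem_attached, mem_attached]
    constructor
    · rintro ⟨D, D', ⟨hD, hD', he, hne⟩, h3, h4⟩
      obtain ⟨b1, b2, -⟩ := back D hD hne
      obtain ⟨c1, c2, -⟩ := back D' hD' (he ▸ hne)
      exact ⟨_, _, ⟨b1, c1, b2.symm.trans (he.trans c2), b2 ▸ hne⟩, by simp [hy, h3],
        by simp [h4]⟩
    · rintro ⟨A, A', ⟨hA, hA', he, hne⟩, h3, h4⟩
      obtain ⟨D, hD, e1, i1⟩ := forth A hA
      obtain ⟨D', hD', e2, i2⟩ := forth A' hA'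
      exact ⟨D, D', ⟨hD, hD', e1.trans (he.trans e2.symm), e1 ▸ hne⟩, (i1 y hy).2 h3,
        fun h => h4 ((i2 y hy).1 h)⟩

end Growth

lemma insertAtEdge_mem_trees {n : ℕ} {t : Finset (Finset ℕ)} (ht : t ∈ trees n) {C : Finset ℕ}
    (hC : C ∈ t) : insertAtEdge t C (n + 1) ∈ trees (n + 1) := by
  refine (isGrowth_insertAtEdge hC _).mem_trees ht hC (fun _ => Iff.rfl) (fun _ h => h) ?_
  intro i h
  have h1 := Finset.card_lt_card h
  have h2 := (ht.1 C hC).1.card_pos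
  rw [Finset.card_singleton] at h1
  omega

lemma insertAtVertex_mem_trees {n : ℕ} {t : Finset (Finset ℕ)} (ht : t ∈ trees n) {V : Finset ℕ}
    (hV : V ∈ branchPoints t) : insertAtVertex t V (n + 1) ∈ trees (n + 1) := by
  simp only [branchPoints, Finset.mem_filter] at hV
  refine (isGrowth_insertAtVertex V _).mem_trees ht hV.1 (fun _ => Iff.rfl) (fun _ h => h.1) ?_
  intro i h
  have h1 := Finset.card_le_card h
  rw [Finset.card_singleton] at h1
  omega

/-- The vertex `C` is the only one that is both kept and copied. Every other vertex leaves exactly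
one descendant in its fibre. -/
lemma card_fibre_insertAtEdge {n : ℕ} {t : Finset (Finset ℕ)} (ht : t ∈ trees n) {C B K : Finset ℕ}
    (hC : C ∈ t) (hK : K ⊆ Finset.Icc 1 n) (hB : B.Nonempty) :
    (fibre K (insertAtEdge t C (n + 1)) B).card =
      (fibre K t B).card + if C ∩ K = B then 1 else 0 := by
  have hx : n + 1 ∉ K := fun h => by have := Finset.mem_Icc.1 (hK h); omega
  rw [(isGrowth_insertAtEdge hC _).card_fibre (fun A hA => not_mem_of_mem_trees ht hA) hx hB,
    ← Finset.card_filter_add_card_filter_not (s := fibre K t B) (C ⊂ ·)]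
  have : ((fibre K t B).filter (C ⊆ ·)).card = ((fibre K t B).filter (C ⊂ ·)).card +
      if C ∩ K = B then 1 else 0 := by
    split_ifs with h
    · rw [← Finset.card_erase_add_one (s := (fibre K t B).filter (C ⊆ ·)) (a := C)
        (by simp [mem_fibre, hC, h])]
      congr 2
      ext A
      simp only [Finset.mem_erase, Finset.mem_filter, Finset.ssubset_iff_subset_ne]
      constructor
      · rintro ⟨h1, h2, h3⟩; exact ⟨h2, h3, Ne.symm h1⟩
      · rintro ⟨h1, h2, h3⟩; exact ⟨Ne.symm h3, h1, h2⟩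
    · rw [add_zero]
      congr 1
      ext A
      simp only [Finset.mem_filter, mem_fibre]
      constructor
      · rintro ⟨⟨h1, h1'⟩, h2⟩
        exact ⟨⟨h1, h1'⟩, h2.ssubset_of_ne fun e => h (e ▸ h1')⟩
      · rintro ⟨h1, h2⟩; exact ⟨h1, h2.1⟩
  convert congrArg (((fibre K t B).filter (fun A => ¬ C ⊂ A)).card + ·) this using 1
  · congr
  · rw [add_assoc, add_left_comm]

/-- Here the kept and the copied vertices are complementary, so each vertex leaves exactly one
descendant. -/
lemma card_fibre_insertAtVertex {n : ℕ} {t : Finset (Finset ℕ)} (ht : t ∈ trees n)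
    {V B K : Finset ℕ} (hK : K ⊆ Finset.Icc 1 n) (hB : B.Nonempty) :
    (fibre K (insertAtVertex t V (n + 1)) B).card = (fibre K t B).card := by
  have hx : n + 1 ∉ K := fun h => by have := Finset.mem_Icc.1 (hK h); omega
  rw [(isGrowth_insertAtVertex V _).card_fibre (fun A hA => not_mem_of_mem_trees ht hA) hx hB,
    ← Finset.card_filter_add_card_filter_not (s := fibre K t B) (V ⊆ ·), add_comm]
  congr

lemma not_mem_attached {n : ℕ} {t : Finset (Finset ℕ)} (ht : t ∈ trees n) (K : Finset ℕ) :
    n + 1 ∉ attached K t := by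
  rw [mem_attached]
  rintro ⟨A, A', h, h2, -⟩
  exact not_mem_of_mem_trees ht h.1 h2

open Classical in
lemma card_attached_insertAtEdge {n : ℕ} {t : Finset (Finset ℕ)} (ht : t ∈ trees n)
    {C K : Finset ℕ} (hC : C ∈ t) (hK : K ⊆ Finset.Icc 1 n) :
    (attached K (insertAtEdge t C (n + 1))).card =
      (attached K t).card + if EdgeHits K t C then 1 else 0 := by
  have hx : n + 1 ∉ K := fun h => by have := Finset.mem_Icc.1 (hK h); omega
  rw [(isGrowth_insertAtEdge hC _).attached (fun A hA => not_mem_of_mem_trees ht hA) hx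
    (fun _ h => h.1)]
  by_cases h : ∃ A A', SameEdge K t A A' ∧ C ⊆ A ∧ ¬ C ⊂ A'
  · rw [if_pos h, if_pos (show EdgeHits K t C from h), Finset.card_union_of_disjoint, Finset.card_singleton]
    exact Finset.disjoint_singleton_right.2 (not_mem_attached ht K)
  · rw [if_neg h, if_neg (show ¬ EdgeHits K t C from h), Finset.union_empty, add_zero]

open Classical in
lemma card_attached_insertAtVertex {n : ℕ} {t : Finset (Finset ℕ)} (ht : t ∈ trees n)
    {V K : Finset ℕ} (hK : K ⊆ Finset.Icc 1 n) :
    (attached K (insertAtVertex t V (n + 1))).card =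
      (attached K t).card + if VertexHits K t V then 1 else 0 := by
  have hx : n + 1 ∉ K := fun h => by have := Finset.mem_Icc.1 (hK h); omega
  rw [(isGrowth_insertAtVertex V _).attached (fun A hA => not_mem_of_mem_trees ht hA) hx
    (fun _ h => h)]
  by_cases h : ∃ A A', SameEdge K t A A' ∧ V ⊆ A ∧ ¬ V ⊆ A'
  · rw [if_pos h, if_pos (show VertexHits K t V from h), Finset.card_union_of_disjoint, Finset.card_singleton]
    exact Finset.disjoint_singleton_right.2 (not_mem_attached ht K)
  · rw [if_neg h, if_neg (show ¬ VertexHits K t V from h), Finset.union_empty, add_zero]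

lemma traceShape_insertAtEdge {n : ℕ} {t : Finset (Finset ℕ)} (ht : t ∈ trees n) {C K : Finset ℕ}
    (hC : C ∈ t) (hK : K ⊆ Finset.Icc 1 n) :
    traceShape K (insertAtEdge t C (n + 1)) = traceShape K t := by
  ext B
  rw [mem_traceShape, mem_traceShape]
  refine and_congr_right fun hB => ?_
  rw [← Finset.card_pos, card_fibre_insertAtEdge ht hC hK hB, ← Finset.card_pos]
  split_ifs with h
  · have : 0 < (fibre K t B).card := Finset.card_pos.2 ⟨C, mem_fibre.2 ⟨hC, h⟩⟩
    simp [this]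
  · simp

lemma traceShape_insertAtVertex {n : ℕ} {t : Finset (Finset ℕ)} (ht : t ∈ trees n)
    {V K : Finset ℕ} (hK : K ⊆ Finset.Icc 1 n) :
    traceShape K (insertAtVertex t V (n + 1)) = traceShape K t := by
  ext B
  rw [mem_traceShape, mem_traceShape]
  refine and_congr_right fun hB => ?_
  rw [← Finset.card_pos, card_fibre_insertAtVertex ht hK hB, ← Finset.card_pos]

lemma traceShape_self {n : ℕ} {t : Finset (Finset ℕ)} (ht : t ∈ trees n) :
    traceShape (Finset.Icc 1 n) t = t := by
  ext B
  simp only [traceShape, Finset.mem_erase, Finset.mem_image]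
  constructor
  · rintro ⟨-, A, hA, rfl⟩
    rwa [Finset.inter_eq_left.2 (ht.1 A hA).2]
  · intro hB
    exact ⟨(ht.1 B hB).1.ne_empty, B, hB, Finset.inter_eq_left.2 (ht.1 B hB).2⟩

lemma fibre_self {n : ℕ} {t : Finset (Finset ℕ)} (ht : t ∈ trees n) {B : Finset ℕ} (hB : B ∈ t) :
    fibre (Finset.Icc 1 n) t B = {B} := by
  ext A
  rw [mem_fibre, Finset.mem_singleton]
  constructor
  · rintro ⟨hA, h⟩
    rwa [Finset.inter_eq_left.2 (ht.1 A hA).2] at h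
  · rintro rfl
    exact ⟨hB, Finset.inter_eq_left.2 (ht.1 A hB).2⟩

lemma attached_self {n : ℕ} {t : Finset (Finset ℕ)} (ht : t ∈ trees n) :
    attached (Finset.Icc 1 n) t = ∅ := by
  refine Finset.eq_empty_of_forall_notMem fun x hx => ?_
  obtain ⟨A, A', ⟨hA, hA', he, -⟩, h1, h2⟩ := mem_attached.1 hx
  rw [Finset.inter_eq_left.2 (ht.1 A hA).2, Finset.inter_eq_left.2 (ht.1 A' hA').2] at he
  exact h2 (he ▸ h1)

/-! ### The drift of the rising factorials -/

/-- The rising factorial `x (x + 1) ⋯ (x + p - 1)`. -/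
def rising (x : ℝ) (p : ℕ) : ℝ := ∏ i ∈ Finset.range p, (x + i)

lemma rising_zero (x : ℝ) : rising x 0 = 1 := by simp [rising]

lemma rising_one (x : ℝ) : rising x 1 = x := by simp [rising]

lemma rising_succ (x : ℝ) (p : ℕ) : rising x (p + 1) = rising x p * (x + p) :=
  Finset.prod_range_succ _ _

/-- This identity makes rising factorials eigenfunctions of urn dynamics: a step `x → x + 1` taken
at rate `x` multiplies the rising factorial by a deterministic factor in the mean. -/
lemma mul_rising_add_one (x : ℝ) (p : ℕ) : x * rising (x + 1) p = rising x p * (x + p) := by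
  rw [← rising_succ, rising, rising, Finset.prod_range_succ', mul_comm]
  simp only [Nat.cast_zero, add_zero, Nat.cast_add, Nat.cast_one]
  congr 1
  exact Finset.prod_congr rfl fun i _ => by ring

lemma rising_nonneg {x : ℝ} (hx : 0 ≤ x) (p : ℕ) : 0 ≤ rising x p :=
  Finset.prod_nonneg fun i _ => by positivity

lemma rising_add (x : ℝ) (p q : ℕ) : rising x (p + q) = rising x p * rising (x + p) q := by
  rw [rising, Finset.prod_range_add]
  congr 1
  exact Finset.prod_congr rfl fun i _ => by push_cast; ring

lemma rising_mono {x y : ℝ} (hx : 0 ≤ x) (hxy : x ≤ y) (p : ℕ) : rising x p ≤ rising y p :=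
  Finset.prod_le_prod (fun i _ => by positivity) fun i _ => by linarith

lemma rising_sq_le {x : ℝ} (hx : 0 ≤ x) (p : ℕ) : rising x p ^ 2 ≤ rising x (2 * p) := by
  rw [two_mul, rising_add, sq]
  exact mul_le_mul_of_nonneg_left (rising_mono hx (by simp) p) (rising_nonneg hx p)

/-- The product of rising factorials whose drift under the growth rules is a multiple of itself. -/
noncomputable def momentFunctional (α γ : ℝ) (K : Finset ℕ) (s : Finset (Finset ℕ)) (q : ℕ)
    (p : Finset ℕ → ℕ) (t : Finset (Finset ℕ)) : ℝ :=
  rising ((attached K t).card + ∑ B ∈ s, edgeWeight α γ B + γ * ∑ B ∈ s, (p B : ℝ)) q *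
    ∏ B ∈ s, rising ((fibre K t B).card - 1 + edgeWeight α γ B / γ) (p B)

lemma finite_trees (n : ℕ) : (trees n).Finite := by
  refine Set.Finite.subset (Finset.finite_toSet (Finset.Icc 1 n).powerset.powerset) fun t ht => ?_
  simp only [Finset.mem_coe, Finset.mem_powerset]
  exact fun A hA => Finset.mem_powerset.2 (ht.1 A hA).2

/-- Passes from a sum over the resulting trees to a sum over the places of insertion; different
places leading to the same tree need not be distinguished. -/
lemma sum_growthProb_mul (α γ : ℝ) {n : ℕ} {t : Finset (Finset ℕ)} (ht : t ∈ trees n)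
    (f : Finset (Finset ℕ) → ℝ) :
    ∑ t' ∈ (finite_trees (n + 1)).toFinset, growthProb α γ t (n + 1) t' * f t' =
      (∑ C ∈ t, edgeWeight α γ C * f (insertAtEdge t C (n + 1)) +
        ∑ V ∈ branchPoints t, vertexWeight α γ t V * f (insertAtVertex t V (n + 1))) /
          (n - α) := by
  simp only [growthProb, totalWeight_eq α γ ht, div_mul_eq_mul_div, ← Finset.sum_div, add_mul,
    Finset.sum_add_distrib]
  congr 2
  · rw [← Finset.sum_fiberwise_of_maps_to (g := fun C => insertAtEdge t C (n + 1))
      (t := (finite_trees (n + 1)).toFinset)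
      (fun C hC => (Set.Finite.mem_toFinset _).2 (insertAtEdge_mem_trees ht hC))]
    refine Finset.sum_congr rfl fun t' _ => ?_
    rw [Finset.sum_mul]
    refine Finset.sum_congr rfl fun C hC => ?_
    rw [(Finset.mem_filter.1 hC).2]
  · rw [← Finset.sum_fiberwise_of_maps_to (g := fun C => insertAtVertex t C (n + 1))
      (t := (finite_trees (n + 1)).toFinset)
      (fun C hC => (Set.Finite.mem_toFinset _).2 (insertAtVertex_mem_trees ht hC))]
    refine Finset.sum_congr rfl fun t' _ => ?_
    rw [Finset.sum_mul]
    refine Finset.sum_congr rfl fun C hC => ?_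
    rw [(Finset.mem_filter.1 hC).2]

lemma sum_fibres {K : Finset ℕ} {t : Finset (Finset ℕ)} {f : Finset ℕ → ℝ}
    (hf : ∀ C ∈ t, C ∩ K = ∅ → f C = 0) :
    ∑ C ∈ t, f C = ∑ B ∈ traceShape K t, ∑ C ∈ fibre K t B, f C := by
  have h0 : ∅ ∉ traceShape K t := fun h => by simpa using (mem_traceShape.1 h).1
  rw [← Finset.sum_fiberwise_of_maps_to (g := (· ∩ K)) (t := insert ∅ (traceShape K t)),
    Finset.sum_insert h0, Finset.sum_eq_zero, zero_add]
  · rfl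
  · exact fun C hC => hf C (Finset.mem_filter.1 hC).1 (Finset.mem_filter.1 hC).2
  · intro C hC
    rw [Finset.mem_insert]
    by_cases h : C ∩ K = ∅
    · exact Or.inl h
    · exact Or.inr (mem_traceShape.2 ⟨Finset.nonempty_iff_ne_empty.2 h, C, mem_fibre.2 ⟨hC, rfl⟩⟩)

lemma edgeHits_of_trace {K : Finset ℕ} {t : Finset (Finset ℕ)} {C : Finset ℕ} (hC : C ∈ t)
    (h : (C ∩ K).Nonempty) : EdgeHits K t C :=
  ⟨C, C, ⟨hC, hC, rfl, h⟩, subset_rfl, fun h => h.ne rfl⟩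

/-- The shift `γ ∑ p B` inside the first rising factorial is what closes the computation:
lengthening an edge also hits, so it changes both factors, and the resulting extra term `γ ∑ p B *
rising (w + 1) q` completes `M + θ` to the argument `w` of `mul_rising_add_one`. -/
lemma drift_momentFunctional {α γ : ℝ} (hγ₀ : 0 < γ)
    {n : ℕ} {t : Finset (Finset ℕ)}
    (ht : t ∈ trees n) {K : Finset ℕ} (hK : K ⊆ Finset.Icc 1 n) (q : ℕ) (p : Finset ℕ → ℕ) :
    ∑ t' ∈ (finite_trees (n + 1)).toFinset, growthProb α γ t (n + 1) t' *
        momentFunctional α γ K (traceShape K t) q p t' =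
      momentFunctional α γ K (traceShape K t) q p t *
        ((n - α + (γ * ∑ B ∈ traceShape K t, (p B : ℝ) + q)) / (n - α)) := by
  classical
  rw [sum_growthProb_mul α γ ht, ← mul_div_assoc]
  congr 1
  set s := traceShape K t with hs
  set θ := ∑ B ∈ s, edgeWeight α γ B with hθ
  set Pp := ∑ B ∈ s, (p B : ℝ) with hPp
  set M : ℝ := ((attached K t).card : ℝ) with hM
  set y : Finset ℕ → ℝ := fun B => (fibre K t B).card - 1 + edgeWeight α γ B / γ with hy
  set w := M + θ + γ * Pp with hw
  set Y := ∏ B ∈ s, rising (y B) (p B) with hY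
  have hG : momentFunctional α γ K s q p t = rising w q * Y := rfl
  have hne : ∀ B ∈ s, B.Nonempty := fun B hB => (mem_traceShape.1 hB).1
  have hE : ∀ C ∈ t, momentFunctional α γ K s q p (insertAtEdge t C (n + 1)) =
      (if EdgeHits K t C then rising (w + 1) q else rising w q) *
        ∏ B ∈ s, rising (y B + if C ∩ K = B then 1 else 0) (p B) := by
    intro C hC
    rw [momentFunctional, card_attached_insertAtEdge ht hC hK]
    congr 1
    · split_ifs
      · congr 1; rw [hw]; push_cast; ring
      · rw [add_zero]
    · refine Finset.prod_congr rfl fun B hB => ?_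
      rw [card_fibre_insertAtEdge ht hC hK (hne B hB)]
      congr 1
      simp only [hy]; push_cast; ring
  have hV : ∀ V, momentFunctional α γ K s q p (insertAtVertex t V (n + 1)) =
      (if VertexHits K t V then rising (w + 1) q else rising w q) * Y := by
    intro V
    rw [momentFunctional, card_attached_insertAtVertex ht hK]
    congr 1
    · split_ifs
      · congr 1; rw [hw]; push_cast; ring
      · rw [add_zero]
    · refine Finset.prod_congr rfl fun B hB => ?_
      rw [card_fibre_insertAtVertex ht hK (hne B hB)]
  -- The part of the drift due to longer edges. Grouping the edges by trace, `mul_rising_add_one`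
  -- turns the weight `γ y B` into `γ (y B + p B)`, and subtracting `Y` leaves `γ p B`. Edges with
  -- empty trace contribute nothing.
  have hE2 : ∑ C ∈ t, edgeWeight α γ C *
      ((if EdgeHits K t C then rising (w + 1) q else rising w q) *
        (∏ B ∈ s, rising (y B + if C ∩ K = B then 1 else 0) (p B) - Y)) =
      γ * Pp * rising (w + 1) q * Y := by
    rw [sum_fibres (K := K), ← hs, hPp, Finset.mul_sum, Finset.sum_mul, Finset.sum_mul]
    · refine Finset.sum_congr rfl fun B hB => ?_
      have h1 : ∀ C ∈ fibre K t B, edgeWeight α γ C *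
          ((if EdgeHits K t C then rising (w + 1) q else rising w q) *
          (∏ B ∈ s, rising (y B + if C ∩ K = B then 1 else 0) (p B) - Y)) =
          edgeWeight α γ C * (rising (w + 1) q *
            (∏ B' ∈ s, rising (y B' + if B = B' then 1 else 0) (p B') - Y)) := by
        intro C hC
        obtain ⟨h2, h3⟩ := mem_fibre.1 hC
        rw [if_pos (edgeHits_of_trace h2 (h3 ▸ hne B hB)), h3]
      rw [Finset.sum_congr rfl h1, ← Finset.sum_mul, sum_edgeWeight_fibre α γ ht hK hB]
      have h4 : γ * ((fibre K t B).card - 1) + edgeWeight α γ B = γ * y B := by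
        simp only [hy]; field_simp
      have h5 : y B * ∏ B' ∈ s, rising (y B' + if B = B' then 1 else 0) (p B') =
          (y B + p B) * Y := by
        rw [hY, ← Finset.mul_prod_erase _ _ hB, ← Finset.mul_prod_erase _ _ hB, if_pos rfl,
          ← mul_assoc, mul_rising_add_one, ← mul_assoc]
        rw [Finset.prod_congr rfl (g := fun B' => rising (y B') (p B'))]
        · ring
        · intro B' hB'
          rw [if_neg (Finset.ne_of_mem_erase hB').symm, add_zero]
      rw [h4]
      linear_combination γ * rising (w + 1) q * h5
    · intro C hC h
      rw [Finset.prod_congr rfl (g := fun B => rising (y B) (p B)), ← hY]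
      · ring
      · intro B hB
        rw [if_neg (fun h' => (hne B hB).ne_empty (h'.symm.trans h)), add_zero]
  have hits := sum_hits α γ ht hK
  rw [Finset.sum_filter, Finset.sum_filter] at hits
  have htot := totalWeight_eq α γ ht
  rw [totalWeight] at htot
  -- Separates the value without a hit, which is summed with the total weight, from the increment
  -- due to a hit, which is summed with the weight from `sum_hits`.
  have hite : ∀ (c : Prop) [Decidable c] (x : ℝ),
      x * ((if c then rising (w + 1) q else rising w q) * Y) =
      rising w q * Y * x + (rising (w + 1) q - rising w q) * Y * (if c then x else 0) := by
    intro c _ x; split_ifs <;> ring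
  have hE3 : ∑ C ∈ t, edgeWeight α γ C * momentFunctional α γ K s q p (insertAtEdge t C (n + 1)) =
      γ * Pp * rising (w + 1) q * Y + ∑ C ∈ t, edgeWeight α γ C *
        ((if EdgeHits K t C then rising (w + 1) q else rising w q) * Y) := by
    rw [← hE2, ← Finset.sum_add_distrib]
    refine Finset.sum_congr rfl fun C hC => ?_
    rw [hE C hC]; ring
  rw [hE3]
  simp only [hV, hite, Finset.sum_add_distrib, ← Finset.mul_sum]
  rw [hG]
  have hwq := mul_rising_add_one w q
  have hwM : w = M + θ + γ * Pp := rfl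
  linear_combination rising w q * Y * htot + (rising (w + 1) q - rising w q) * Y * hits + Y * hwq
    - (rising (w + 1) q - rising w q) * Y * hwM

/-! ### Small trees -/

lemma eq_of_mem_trees_one {t : Finset (Finset ℕ)} (ht : t ∈ trees 1) : t = {{1}} := by
  ext A
  rw [Finset.mem_singleton]
  constructor
  · intro hA
    have h := ht.1 A hA
    simp only [Finset.Icc_self, Finset.subset_singleton_iff] at h
    exact h.2.resolve_left h.1.ne_empty
  · rintro rfl
    simpa using ht.2.1

lemma eq_of_mem_trees_two {t : Finset (Finset ℕ)} (ht : t ∈ trees 2) :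
    t = {{1}, {2}, {1, 2}} := by
  have hI : Finset.Icc 1 2 = {1, 2} := by decide
  ext A
  simp only [Finset.mem_insert, Finset.mem_singleton]
  constructor
  · intro hA
    have h := ht.1 A hA
    rw [hI, ← Finset.mem_powerset] at h
    have h2 : A ∈ ({∅, {1}, {2}, {1, 2}} : Finset (Finset ℕ)) := by
      have : ({1, 2} : Finset ℕ).powerset = {∅, {1}, {2}, {1, 2}} := by decide
      rw [← this]; exact h.2
    simp only [Finset.mem_insert, Finset.mem_singleton] at h2
    exact h2.resolve_left h.1.ne_empty
  · rintro (rfl | rfl | rfl)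
    · exact ht.2.2.1 1 (by simp)
    · exact ht.2.2.1 2 (by simp)
    · have := ht.2.1; rwa [hI] at this

/-- The tree with one leaf has a single edge, which carries the total weight `1 - α`. So the weights
also describe the forced passage to two leaves, and the growth rule can be used from time 1 on. -/
lemma growthProb_one {α γ : ℝ} (hα₁ : α < 1) {t t' : Finset (Finset ℕ)} (ht : t ∈ trees 1)
    (ht' : t' ∈ trees 2) : growthProb α γ t 2 t' = 1 := by
  have h1 := totalWeight_eq α γ ht
  obtain rfl := eq_of_mem_trees_one ht
  have h2 : branchPoints {{1}} = ∅ := by decide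
  have h3 : insertAtEdge {{1}} {1} 2 = t' :=
    (eq_of_mem_trees_two (insertAtEdge_mem_trees ht (by simp))).trans
      (eq_of_mem_trees_two ht').symm
  rw [growthProb, h1, h2, Finset.filter_true_of_mem (fun C hC => by
    rw [Finset.mem_singleton.1 hC, h3])]
  have : (1 : ℝ) - α ≠ 0 := by linarith
  simp [edgeWeight, this]

lemma growthProb_eq_zero {α γ : ℝ} {n : ℕ} {t t' : Finset (Finset ℕ)} (ht : t ∈ trees n)
    {K : Finset ℕ} (hK : K ⊆ Finset.Icc 1 n) (h : traceShape K t' ≠ traceShape K t) :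
    growthProb α γ t (n + 1) t' = 0 := by
  rw [growthProb, Finset.filter_false_of_mem, Finset.filter_false_of_mem]
  · simp
  · rintro V hV rfl
    exact h (traceShape_insertAtVertex ht hK)
  · rintro C hC rfl
    exact h (traceShape_insertAtEdge ht hC hK)

/-! ### Distances in the tree -/

section Graph

variable {n : ℕ} {t : Finset (Finset ℕ)}

lemma finite_nodes (t : Finset (Finset ℕ)) : (nodes t).Finite := by
  have : nodes t = insert ⊤ ((fun A : Finset ℕ => (A : Node)) '' (t : Set (Finset ℕ))) := by
    ext v
    simp only [nodes, Set.mem_ofPred_eq, Set.mem_insert_iff, Set.mem_image, Finset.mem_coe, eq_comm]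
  rw [this]
  exact (t.finite_toSet.image _).insert _

lemma coe_mem_nodes {A : Finset ℕ} : (A : Node) ∈ nodes t ↔ A ∈ t := by
  simp [nodes]

lemma top_mem_nodes : (⊤ : Node) ∈ nodes t := Or.inl rfl

lemma nodes_chain (ht : t ∈ trees n) {v x y : Node} (hv : v ∈ nodes t) (hx : x ∈ nodes t)
    (hy : y ∈ nodes t) (hvx : v ≤ x) (hvy : v ≤ y) : x ≤ y ∨ y ≤ x := by
  rcases hx with rfl | ⟨A, hA, rfl⟩
  · exact Or.inr le_top
  rcases hy with rfl | ⟨C, hC, rfl⟩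
  · exact Or.inl le_top
  rcases hv with rfl | ⟨D, hD, rfl⟩
  · simp at hvx
  rw [WithTop.coe_le_coe] at hvx hvy
  obtain ⟨z, hz⟩ := (ht.1 D hD).1
  simpa only [WithTop.coe_le_coe] using subset_or_subset ht hA hC (hvx hz) (hvy hz)

lemma parent_unique (ht : t ∈ trees n) {V : Set Node} (hV : V ⊆ nodes t) {u u' v : Node}
    (h : IsParent V u v) (h' : IsParent V u' v) : u = u' := by
  rcases nodes_chain ht (hV h.2.1) (hV h.1) (hV h'.1) h.2.2.1.le h'.2.2.1.le with hl | hl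
  · by_contra hne
    exact h'.2.2.2 u h.1 ⟨h.2.2.1, lt_of_le_of_ne hl hne⟩
  · by_contra hne
    exact h.2.2.2 u' h'.1 ⟨h'.2.2.1, lt_of_le_of_ne hl (Ne.symm hne)⟩

lemma exists_isParent (ht : t ∈ trees n) {V : Set Node} (hV : V ⊆ nodes t) {u v : Node}
    (hu : u ∈ V) (hv : v ∈ V) (hvu : v < u) : ∃ u', IsParent V u' v ∧ u' ≤ u := by
  have hfin : ({x | x ∈ V ∧ v < x} : Set Node).Finite :=
    (finite_nodes t).subset fun x hx => hV hx.1
  obtain ⟨m, hm, hmin⟩ := hfin.exists_minimal ⟨u, hu, hvu⟩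
  refine ⟨m, ⟨hm.1, hv, hm.2, fun w hw hw' => hw'.2.not_ge (hmin ⟨hw, hw'.1⟩ hw'.2.le)⟩, ?_⟩
  rcases nodes_chain ht (hV hv) (hV hm.1) (hV hu) hm.2.le hvu.le with h | h
  · exact h
  · exact hmin ⟨hu, hvu⟩ h

/-- The number of vertices on the ancestral line of `v`. -/
noncomputable def depth (t : Finset (Finset ℕ)) (v : Node) : ℕ := {x | x ∈ nodes t ∧ v ≤ x}.ncard

lemma finite_ancestors (t : Finset (Finset ℕ)) (v : Node) : {x | x ∈ nodes t ∧ v ≤ x}.Finite :=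
  (finite_nodes t).subset fun _ h => h.1

lemma depth_parent (ht : t ∈ trees n) {u v : Node} (h : IsParent (nodes t) u v) :
    depth t v = depth t u + 1 := by
  have : {x | x ∈ nodes t ∧ v ≤ x} = insert v {x | x ∈ nodes t ∧ u ≤ x} := by
    ext x
    simp only [Set.mem_ofPred_eq, Set.mem_insert_iff]
    constructor
    · rintro ⟨hx, hvx⟩
      rcases hvx.eq_or_lt with rfl | hlt
      · exact Or.inl rfl
      · refine Or.inr ⟨hx, ?_⟩
        rcases nodes_chain ht h.2.1 hx h.1 hvx h.2.2.1.le with h1 | h1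
        · rcases h1.eq_or_lt with rfl | h2
          · exact le_rfl
          · exact absurd ⟨hlt, h2⟩ (h.2.2.2 x hx)
        · exact h1
    · rintro (rfl | ⟨hx, hux⟩)
      · exact ⟨h.2.1, le_rfl⟩
      · exact ⟨hx, h.2.2.1.le.trans hux⟩
  rw [depth, depth, this, Set.ncard_insert_of_notMem _ (finite_ancestors t u)]
  exact fun h' => h.2.2.1.not_ge h'.2

lemma depth_le_of_walk (ht : t ∈ trees n) {u v : Node} (p : (treeGraph t).Walk u v) :
    depth t u ≤ depth t v + p.length := by
  induction p with
  | nil => simp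
  | cons h p ih =>
    rw [SimpleGraph.Walk.length_cons]
    rcases h with h | h
    · have := depth_parent ht h; omega
    · have := depth_parent ht h; omega

lemma exists_walk (ht : t ∈ trees n) {u : Node} (hu : u ∈ nodes t) : ∀ (m : ℕ) (v : Node),
    v ∈ nodes t → v ≤ u → depth t v = m →
      ∃ p : (treeGraph t).Walk v u, p.length + depth t u = depth t v := by
  intro m
  induction m using Nat.strong_induction_on with
  | _ m ih =>
    intro v hv hvu hm
    rcases hvu.eq_or_lt with rfl | hlt
    · exact ⟨.nil, by simp⟩
    · obtain ⟨u', hu', hle⟩ := exists_isParent ht subset_rfl hu hv hlt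
      have hd := depth_parent ht hu'
      obtain ⟨p, hp⟩ := ih _ (by omega) u' hu'.1 hle rfl
      have hadj : (treeGraph t).Adj v u' := Or.inr hu'
      exact ⟨.cons hadj p, by rw [SimpleGraph.Walk.length_cons]; omega⟩

/-- Adjacent vertices differ by one in depth, which bounds every walk from below, and the walk
through successive parents attains the bound. -/
lemma dist_add_depth (ht : t ∈ trees n) {u v : Node} (hu : u ∈ nodes t) (hv : v ∈ nodes t)
    (hvu : v ≤ u) : (treeGraph t).dist u v + depth t u = depth t v := by
  obtain ⟨p, hp⟩ := exists_walk ht hu _ v hv hvu rfl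
  obtain ⟨q, hq⟩ := p.reachable.exists_walk_length_eq_dist
  have h1 := SimpleGraph.dist_le p
  have h2 := depth_le_of_walk ht q
  rw [SimpleGraph.dist_comm]
  omega

/-! ### The vertices of the reduced subtree -/

lemma labelsAt_coe (k : ℕ) (A : Finset ℕ) : labelsAt k (A : Node) = A ∩ Finset.Icc 1 k := by
  ext i
  simp [labelsAt, and_comm]

lemma mem_spanned_coe {k : ℕ} {A : Finset ℕ} : (A : Node) ∈ spanned t k ↔
    A ∈ t ∧ (A ∩ Finset.Icc 1 k).Nonempty := by
  simp only [spanned, Set.mem_ofPred_eq, coe_mem_nodes, WithTop.coe_le_coe,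
    Finset.singleton_subset_iff, Finset.Nonempty, Finset.mem_inter]
  exact and_congr_right fun _ => exists_congr fun _ => and_comm

lemma reducedNodes_subset (t : Finset (Finset ℕ)) (k : ℕ) : reducedNodes t k ⊆ nodes t :=
  fun _ h => h.1.1

lemma spanned_up {k : ℕ} {u v : Node} (hv : v ∈ spanned t k) (hu : u ∈ nodes t) (h : v ≤ u) :
    u ∈ spanned t k := by
  obtain ⟨-, i, hi, hle⟩ := hv
  exact ⟨hu, i, hi, hle.trans h⟩

lemma top_mem_reducedNodes (ht : t ∈ trees n) {k : ℕ} (hk : 1 ≤ k) :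
    (⊤ : Node) ∈ reducedNodes t k := by
  refine ⟨⟨top_mem_nodes, 1, by simp [hk], le_top⟩, fun h => ?_⟩
  have hI : ((Finset.Icc 1 n : Finset ℕ) : Node) ∈ nodes t := coe_mem_nodes.2 ht.2.1
  have key : ∀ u ∈ {u | u ∈ spanned t k ∧ (treeGraph t).Adj ⊤ u},
      u = ((Finset.Icc 1 n : Finset ℕ) : Node) := by
    rintro u ⟨-, h1 | h1⟩
    · rcases h1.2.1 with rfl | ⟨A, hA, rfl⟩
      · exact absurd h1.2.2.1 (lt_irrefl _)
      · by_contra hne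
        exact h1.2.2.2 _ hI ⟨lt_of_le_of_ne (WithTop.coe_le_coe.2 (ht.1 A hA).2) hne,
          WithTop.coe_lt_top _⟩
    · exact absurd h1.2.2.1 not_top_lt
  have h3 := Set.ncard_le_ncard (t := {((Finset.Icc 1 n : Finset ℕ) : Node)}) key
  rw [h, Set.ncard_singleton] at h3
  omega

lemma isParent_coe_of_maximal {A D : Finset ℕ} (hA : A ∈ t) (hD : D ∈ t) (hDA : D ⊂ A)
    (h : ∀ E ∈ t, D ⊂ E → ¬ E ⊂ A) : IsParent (nodes t) (A : Node) (D : Node) := by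
  refine ⟨coe_mem_nodes.2 hA, coe_mem_nodes.2 hD, WithTop.coe_lt_coe.2 hDA, ?_⟩
  rintro w (rfl | ⟨E, hE, rfl⟩) ⟨h1, h2⟩
  · exact not_top_lt h2
  · exact h E hE (WithTop.coe_lt_coe.1 h1) (WithTop.coe_lt_coe.1 h2)

lemma exists_child_coe {A : Finset ℕ} {v : Node} (h : IsParent (nodes t) (A : Node) v) :
    ∃ E ∈ t, v = (E : Node) ∧ E ⊂ A := by
  rcases h.2.1 with rfl | ⟨E, hE, rfl⟩
  · exact absurd h.2.2.1 not_top_lt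
  · exact ⟨E, hE, rfl, WithTop.coe_lt_coe.1 h.2.2.1⟩

/-- If the degree were 2, the neighbours would be the parent and one child `D`. Each label of `K` in
`A` lies in a maximal proper subvertex `E` of `A`, which is a spanned neighbour and hence equals
`D`; so `D` would have the same trace as `A`. -/
lemma mem_reducedNodes_of_minimal (ht : t ∈ trees n) {k : ℕ} (hkn : k ≤ n) {A : Finset ℕ}
    (hA : A ∈ t) (hne : (A ∩ Finset.Icc 1 k).Nonempty)
    (hmin : ∀ D ∈ t, D ⊂ A → D ∩ Finset.Icc 1 k ≠ A ∩ Finset.Icc 1 k) :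
    (A : Node) ∈ reducedNodes t k := by
  have hAs : (A : Node) ∈ spanned t k := mem_spanned_coe.2 ⟨hA, hne⟩
  refine ⟨hAs, fun h2 => ?_⟩
  obtain ⟨u, hu, -⟩ := exists_isParent ht subset_rfl top_mem_nodes (coe_mem_nodes.2 hA)
    (WithTop.coe_lt_top A)
  have huN : u ∈ {u | u ∈ spanned t k ∧ (treeGraph t).Adj (A : Node) u} :=
    ⟨spanned_up hAs hu.1 hu.2.2.1.le, Or.inr hu⟩
  obtain ⟨d, hd, hdu⟩ := Set.exists_ne_of_one_lt_ncard (h2.symm ▸ Nat.one_lt_two) u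
  have hN : {u | u ∈ spanned t k ∧ (treeGraph t).Adj (A : Node) u} = {u, d} := by
    refine (Set.eq_of_subset_of_ncard_le ?_ ?_ ?_).symm
    · rintro x (rfl | rfl)
      exacts [huN, hd]
    · rw [h2, Set.ncard_pair hdu.symm]
    · exact (finite_nodes t).subset fun x hx => hx.1.1
  rcases hd.2 with hd2 | hd2
  swap
  · exact hdu (parent_unique ht subset_rfl hd2 hu)
  obtain ⟨D, hD, rfl, hDA⟩ := exists_child_coe hd2
  refine hmin D hD hDA (Finset.Subset.antisymm (Finset.inter_subset_inter_right hDA.1) ?_)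
  intro i hi
  obtain ⟨hiA, hiK⟩ := Finset.mem_inter.1 hi
  refine Finset.mem_inter.2 ⟨?_, hiK⟩
  have hi1 : {i} ∈ t := ht.2.2.1 i (by rw [Finset.mem_Icc] at hiK ⊢; omega)
  have hiA' : {i} ⊂ A := by
    refine (Finset.singleton_subset_iff.2 hiA).ssubset_of_ne ?_
    rintro rfl
    rw [Finset.ssubset_singleton_iff] at hDA
    exact (ht.1 D hD).1.ne_empty hDA
  obtain ⟨E, hE, hmax⟩ := (t.filter fun E => {i} ⊆ E ∧ E ⊂ A).exists_max_image Finset.card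
    ⟨{i}, by simp [hi1, hiA']⟩
  simp only [Finset.mem_filter] at hE hmax
  have hEA : IsParent (nodes t) (A : Node) (E : Node) := by
    refine isParent_coe_of_maximal hA hE.1 hE.2.2 fun F hF h1 h3 => ?_
    exact (Finset.card_lt_card h1).not_ge (hmax F ⟨hF, hE.2.1.trans h1.1, h3⟩)
  have hiE : i ∈ E := Finset.singleton_subset_iff.1 hE.2.1
  have hEN : (E : Node) ∈ ({u, (D : Node)} : Set Node) := by
    rw [← hN]
    exact ⟨mem_spanned_coe.2 ⟨hE.1, i, Finset.mem_inter.2 ⟨hiE, hiK⟩⟩, Or.inl hEA⟩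
  rcases hEN with h | h
  · exact absurd (h ▸ hEA.2.2.1.trans hu.2.2.1) (lt_irrefl _)
  · rwa [← WithTop.coe_injective h]

/-- Take `E` maximal below `A` with the trace of `A`. Any other spanned child shares a label of `K`
with `E`, hence is comparable with it and coincides with it. So the neighbours are exactly the
parent and `E`. -/
lemma not_mem_reducedNodes (ht : t ∈ trees n) {k : ℕ} {A D : Finset ℕ}
    (hA : A ∈ t) (hne : (A ∩ Finset.Icc 1 k).Nonempty) (hD : D ∈ t) (hDA : D ⊂ A)
    (hDk : D ∩ Finset.Icc 1 k = A ∩ Finset.Icc 1 k) : (A : Node) ∉ reducedNodes t k := by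
  rintro ⟨hAs, h2⟩
  obtain ⟨E, hE, hmax⟩ := (t.filter fun E => E ⊂ A ∧
    E ∩ Finset.Icc 1 k = A ∩ Finset.Icc 1 k).exists_max_image Finset.card ⟨D, by simp [hD, hDA, hDk]⟩
  simp only [Finset.mem_filter] at hE hmax
  have hEA : IsParent (nodes t) (A : Node) (E : Node) := by
    refine isParent_coe_of_maximal hA hE.1 hE.2.1 fun F hF h1 h3 => ?_
    refine (Finset.card_lt_card h1).not_ge (hmax F ⟨hF, h3, ?_⟩)
    refine Finset.Subset.antisymm (Finset.inter_subset_inter_right h3.1) ?_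
    rw [← hE.2.2]
    exact Finset.inter_subset_inter_right h1.1
  obtain ⟨u, hu, -⟩ := exists_isParent ht subset_rfl top_mem_nodes (coe_mem_nodes.2 hA)
    (WithTop.coe_lt_top A)
  apply h2
  have huE : u ≠ (E : Node) := by
    rintro rfl
    exact lt_irrefl _ (hEA.2.2.1.trans hu.2.2.1)
  rw [← Set.ncard_pair huE]
  congr 1
  ext x
  simp only [Set.mem_ofPred_eq, Set.mem_insert_iff, Set.mem_singleton_iff]
  constructor
  · rintro ⟨hx, h | h⟩
    · right
      obtain ⟨F, hF, rfl, hFA⟩ := exists_child_coe h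
      obtain ⟨y, hy⟩ := (mem_spanned_coe.1 hx).2
      have hyE : y ∈ E ∩ Finset.Icc 1 k := by
        rw [hE.2.2]; exact Finset.inter_subset_inter_right hFA.1 hy
      rcases subset_or_subset ht hF hE.1 (Finset.mem_inter.1 hy).1 (Finset.mem_inter.1 hyE).1
        with h3 | h3
      · rcases h3.eq_or_ssubset with rfl | h3
        · rfl
        · exact absurd ⟨WithTop.coe_lt_coe.2 h3, hEA.2.2.1⟩ (h.2.2.2 _ hEA.2.1)
      · rcases h3.eq_or_ssubset with rfl | h3
        · rfl
        · exact absurd ⟨WithTop.coe_lt_coe.2 h3, h.2.2.1⟩ (hEA.2.2.2 _ h.2.1)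
    · exact Or.inl (parent_unique ht subset_rfl h hu)
  · rintro (rfl | rfl)
    · exact ⟨spanned_up hAs hu.1 hu.2.2.1.le, Or.inr hu⟩
    · exact ⟨mem_spanned_coe.2 ⟨hE.1, hE.2.2 ▸ hne⟩, Or.inl hEA⟩

/-! ### Shape and edge lengths of the reduced subtree -/

lemma reducedNodes_ne_top {k : ℕ} {v : Node} (hv : v ∈ reducedNodes t k) (hv' : v ≠ ⊤) :
    ∃ A ∈ t, v = (A : Node) ∧ labelsAt k v = A ∩ Finset.Icc 1 k ∧
      (A ∩ Finset.Icc 1 k).Nonempty := by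
  rcases hv.1.1 with rfl | ⟨A, hA, rfl⟩
  · exact absurd rfl hv'
  · exact ⟨A, hA, rfl, labelsAt_coe k A, (mem_spanned_coe.1 hv.1).2⟩

lemma fibre_min_mem_reducedNodes (ht : t ∈ trees n) {k : ℕ} (hkn : k ≤ n) {C m : Finset ℕ}
    (hC : C.Nonempty) (hm : m ∈ fibre (Finset.Icc 1 k) t C)
    (hmin : ∀ A ∈ fibre (Finset.Icc 1 k) t C, m ⊆ A) : (m : Node) ∈ reducedNodes t k := by
  obtain ⟨h1, h2⟩ := mem_fibre.1 hm
  refine mem_reducedNodes_of_minimal ht hkn h1 (h2 ▸ hC) fun D hD hDm h => ?_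
  exact hDm.2 (hmin D (mem_fibre.2 ⟨hD, h.trans h2⟩))

lemma reducedSubtree_shape (ht : t ∈ trees n) {k : ℕ} (hkn : k ≤ n) :
    (reducedSubtree t k).shape = traceShape (Finset.Icc 1 k) t := by
  ext C
  simp only [reducedSubtree, Finset.mem_filter, Finset.mem_powerset]
  constructor
  · rintro ⟨-, v, hv, hv', h⟩
    obtain ⟨A, hA, rfl, h1, h2⟩ := reducedNodes_ne_top hv hv'
    rw [h1] at h
    exact mem_traceShape.2 ⟨h ▸ h2, A, mem_fibre.2 ⟨hA, h⟩⟩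
  · intro hC
    obtain ⟨m, hm, hmin⟩ := exists_fibre_min ht hC
    obtain ⟨h1, h2⟩ := mem_fibre.1 hm
    exact ⟨h2 ▸ Finset.inter_subset_right, m,
      fibre_min_mem_reducedNodes ht hkn (mem_traceShape.1 hC).1 hm hmin, WithTop.coe_ne_top,
      (labelsAt_coe k m).trans h2⟩

/-- The lower end `m` is the minimum of the fibre. The ancestors of `m` split into those of `u` and
the fibre, so the difference in depth is the size of the fibre. -/
lemma dist_eq_card_fibre (ht : t ∈ trees n) {k : ℕ} (hkn : k ≤ n) {C : Finset ℕ} {u v : Node}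
    (h : IsParent (reducedNodes t k) u v) (hC : labelsAt k v = C) :
    (treeGraph t).dist u v = (fibre (Finset.Icc 1 k) t C).card := by
  have hv' : v ≠ ⊤ := (h.2.2.1.trans_le le_top).ne
  obtain ⟨m, hm, rfl, h1, h2⟩ := reducedNodes_ne_top h.2.1 hv'
  rw [h1] at hC
  rw [hC] at h2
  have hmF : m ∈ fibre (Finset.Icc 1 k) t C := mem_fibre.2 ⟨hm, hC⟩
  obtain ⟨y, hy⟩ := h2
  have hle : ∀ A ∈ fibre (Finset.Icc 1 k) t C, m ⊆ A := by
    intro A hA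
    obtain ⟨hA1, hA2⟩ := mem_fibre.1 hA
    rcases subset_or_subset ht hm hA1 (x := y) (Finset.mem_inter.1 (hC ▸ hy)).1
      (Finset.mem_inter.1 (hA2 ▸ hy)).1 with h3 | h3
    · exact h3
    · rcases h3.eq_or_ssubset with rfl | h3
      · exact subset_rfl
      · exact absurd h.2.1 (not_mem_reducedNodes ht hm (hC ▸ ⟨y, hy⟩) hA1 h3 (hA2.trans hC.symm))
  have hu := reducedNodes_subset t k h.1
  have hv := reducedNodes_subset t k h.2.1
  have hd := dist_add_depth ht hu hv h.2.2.1.le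
  have hset : {x | x ∈ nodes t ∧ (m : Node) ≤ x} = {x | x ∈ nodes t ∧ u ≤ x} ∪
      (fun A : Finset ℕ => (A : Node)) '' (fibre (Finset.Icc 1 k) t C : Set (Finset ℕ)) := by
    ext x
    simp only [Set.mem_ofPred_eq, Set.mem_union, Set.mem_image, Finset.mem_coe]
    constructor
    · rintro ⟨hx, hmx⟩
      by_cases hux : u ≤ x
      · exact Or.inl ⟨hx, hux⟩
      right
      have hxu : x < u := lt_of_le_not_ge
        ((nodes_chain ht hv hx hu hmx h.2.2.1.le).resolve_right hux) hux
      rcases hx with rfl | ⟨A, hA, rfl⟩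
      · exact absurd hxu not_top_lt
      refine ⟨A, ?_, rfl⟩
      have hmA : m ⊆ A := WithTop.coe_le_coe.1 hmx
      -- For `A` between `m` and `u`, the minimal vertex `m'` of the fibre of `A` belongs to the
      -- reduced tree. It cannot lie strictly between `m` and `u`, so it lies in `m` and `A` has
      -- trace `C`.
      have hCA : C ⊆ A ∩ Finset.Icc 1 k := hC ▸ Finset.inter_subset_inter_right hmA
      have hAs : A ∩ Finset.Icc 1 k ∈ traceShape (Finset.Icc 1 k) t :=
        mem_traceShape.2 ⟨⟨y, hCA hy⟩, A, mem_fibre.2 ⟨hA, rfl⟩⟩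
      obtain ⟨m', hm', hmin'⟩ := exists_fibre_min ht hAs
      have hm'r := fibre_min_mem_reducedNodes ht hkn ⟨y, hCA hy⟩ hm' hmin'
      have hm'A : m' ⊆ A := hmin' A (mem_fibre.2 ⟨hA, rfl⟩)
      obtain ⟨hm't, hm'C⟩ := mem_fibre.1 hm'
      rcases subset_or_subset ht hm hm't (x := y) (Finset.mem_inter.1 (hC ▸ hy)).1
        (Finset.mem_inter.1 (hm'C ▸ hCA hy)).1 with h3 | h3
      · rcases h3.eq_or_ssubset with rfl | h3
        · exact mem_fibre.2 ⟨hA, hm'C.symm.trans hC⟩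
        · exact absurd ⟨WithTop.coe_lt_coe.2 h3, (WithTop.coe_le_coe.2 hm'A).trans_lt hxu⟩
            (h.2.2.2 _ hm'r)
      · refine mem_fibre.2 ⟨hA, Finset.Subset.antisymm ?_ hCA⟩
        rw [← hm'C, ← hC]
        exact Finset.inter_subset_inter_right h3
    · rintro (⟨hx, hux⟩ | ⟨A, hA, rfl⟩)
      · exact ⟨hx, h.2.2.1.le.trans hux⟩
      · exact ⟨coe_mem_nodes.2 (mem_fibre.1 hA).1, WithTop.coe_le_coe.2 (hle A hA)⟩
  -- A vertex `U` above `m` and inside a member of the fibre would have trace `C` as well and thus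
  -- be a removed vertex of degree 2.
  have hdisj : Disjoint {x | x ∈ nodes t ∧ u ≤ x}
      ((fun A : Finset ℕ => (A : Node)) '' (fibre (Finset.Icc 1 k) t C : Set (Finset ℕ))) := by
    rw [Set.disjoint_left]
    rintro _ ⟨hx, hux⟩ ⟨A, hA, rfl⟩
    obtain ⟨hA1, hA2⟩ := mem_fibre.1 hA
    rcases hu with rfl | ⟨U, hU, rfl⟩
    · exact absurd (top_le_iff.1 hux) WithTop.coe_ne_top
    · have hmU : m ⊂ U := WithTop.coe_lt_coe.1 h.2.2.1
      have hUA : U ⊆ A := WithTop.coe_le_coe.1 hux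
      have hUC : C ⊆ U ∩ Finset.Icc 1 k := hC ▸ Finset.inter_subset_inter_right hmU.1
      refine not_mem_reducedNodes ht hU ⟨y, hUC hy⟩ hm hmU ?_ h.1
      rw [hC]
      refine Finset.Subset.antisymm hUC ?_
      rw [← hA2]
      exact Finset.inter_subset_inter_right hUA
  have hcard : depth t (m : Node) = depth t u + (fibre (Finset.Icc 1 k) t C).card := by
    rw [depth, depth, hset, Set.ncard_union_eq hdisj (finite_ancestors t u)
      ((Finset.finite_toSet _).image _), Set.ncard_image_of_injective _ WithTop.coe_injective,
      Set.ncard_coe_finset]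
  omega

lemma reducedSubtree_len (ht : t ∈ trees n) {k : ℕ} (hk : 1 ≤ k) (hkn : k ≤ n) {C : Finset ℕ}
    (hC : C ∈ traceShape (Finset.Icc 1 k) t) :
    (reducedSubtree t k).len C = (fibre (Finset.Icc 1 k) t C).card := by
  obtain ⟨m, hm, hmin⟩ := exists_fibre_min ht hC
  have hmr := fibre_min_mem_reducedNodes ht hkn (mem_traceShape.1 hC).1 hm hmin
  obtain ⟨u, hu, -⟩ := exists_isParent ht (reducedNodes_subset t k) (top_mem_reducedNodes ht hk) hmr
    (WithTop.coe_lt_top m)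
  have hex : ∃ p : Node × Node, IsParent (reducedNodes t k) p.1 p.2 ∧ labelsAt k p.2 = C :=
    ⟨(u, m), hu, (labelsAt_coe k m).trans (mem_fibre.1 hm).2⟩
  rw [reducedSubtree]
  simp only [dif_pos hex]
  -- The value is the same for every admissible pair, so it does not matter which one `choose`
  -- picks.
  exact_mod_cast dist_eq_card_fibre ht hkn hex.choose_spec.1 hex.choose_spec.2

end Graph

/-! ### The growth as a Markov chain -/

/-- The trees `T 1, …, T n`. -/
def history {Ω : Type*} (T : ℕ → Ω → Finset (Finset ℕ)) (n : ℕ) (ω : Ω) : Fin n → Finset (Finset ℕ) :=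
  fun j => T (j + 1) ω

/-- Sequences of trees with given first `n` terms. -/
def extendHistory {n : ℕ} (σ : Fin n → Finset (Finset ℕ)) (m : ℕ) : Finset (Finset ℕ) :=
  if h : m - 1 < n then σ ⟨m - 1, h⟩ else ∅

lemma history_eq_iff {Ω : Type*} {T : ℕ → Ω → Finset (Finset ℕ)} {n : ℕ} {σ : Fin n → Finset (Finset ℕ)} {ω : Ω} :
    history T n ω = σ ↔ ∀ m, 1 ≤ m → m ≤ n → T m ω = extendHistory σ m := by
  constructor
  · rintro rfl m hm hmn
    have h : m - 1 < n := by omega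
    simp only [extendHistory, h, dif_pos, history]
    congr 1; omega
  · intro h
    funext j
    have := h (j + 1) (by omega) (by omega)
    rw [history, this, extendHistory, dif_pos (by simp)]
    rfl

section Chain

variable {Ω : Type*} [mΩ : MeasurableSpace Ω] {P : Measure Ω} {α γ : ℝ}
  {T : ℕ → Ω → Finset (Finset ℕ)}

lemma IsAlphaGammaSequence.growth_of_one_le (hα₁ : α < 1)
    (hT : IsAlphaGammaSequence P α γ T) {n : ℕ} (hn : 1 ≤ n) (s : ℕ → Finset (Finset ℕ))
    {t' : Finset (Finset ℕ)} (ht' : t' ∈ trees (n + 1)) :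
    P.real {ω | (∀ m, 1 ≤ m → m ≤ n → T m ω = s m) ∧ T (n + 1) ω = t'} =
      P.real {ω | ∀ m, 1 ≤ m → m ≤ n → T m ω = s m} * growthProb α γ (s n) (n + 1) t' := by
  rcases hn.eq_or_lt with rfl | hn
  · have h2 : ∀ ω, T (1 + 1) ω = t' := fun ω =>
      (eq_of_mem_trees_two (hT.mem_trees 2 one_le_two ω)).trans (eq_of_mem_trees_two ht').symm
    simp only [h2, and_true]
    by_cases hs : s 1 ∈ trees 1
    · rw [growthProb_one hα₁ hs ht', mul_one]
    · have : {ω | ∀ m, 1 ≤ m → m ≤ 1 → T m ω = s m} = ∅ := by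
        refine Set.eq_empty_of_forall_notMem fun ω h => hs ?_
        rw [← h 1 le_rfl le_rfl]
        exact hT.mem_trees 1 le_rfl ω
      rw [this]; simp
  · exact hT.growth n hn s t'

lemma IsAlphaGammaSequence.measurable_comp (hT : IsAlphaGammaSequence P α γ T) {n : ℕ}
    (hn : 1 ≤ n) {β : Type*} [MeasurableSpace β] (f : Finset (Finset ℕ) → β) :
    Measurable fun ω => f (T n ω) := by
  intro S _
  have : (fun ω => f (T n ω)) ⁻¹' S = ⋃ t ∈ f ⁻¹' S, {ω | T n ω = t} := by
    ext ω; simp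
  rw [this]
  exact MeasurableSet.biUnion (Set.to_countable _) fun t _ => hT.measurableSet_eq n hn t

lemma IsAlphaGammaSequence.measurableSet_history (hT : IsAlphaGammaSequence P α γ T) (n : ℕ)
    (B : Set (Fin n → Finset (Finset ℕ))) : MeasurableSet (history T n ⁻¹' B) := by
  have : history T n ⁻¹' B = ⋃ σ ∈ B, ⋂ j : Fin n, {ω | T (j + 1) ω = σ j} := by
    ext ω
    simp only [Set.mem_preimage, Set.mem_iUnion, Set.mem_iInter, Set.mem_ofPred_eq, exists_prop]
    constructor
    · exact fun h => ⟨_, h, fun j => rfl⟩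
    · rintro ⟨σ, hσ, h⟩
      rwa [show history T n ω = σ from funext h]
  rw [this]
  exact MeasurableSet.biUnion (Set.to_countable _) fun σ _ =>
    MeasurableSet.iInter fun j => hT.measurableSet_eq _ (by omega) _

/-- The filtration of the histories, started at time `k`. -/
def historyFiltration (hT : IsAlphaGammaSequence P α γ T) (k : ℕ) : Filtration ℕ mΩ where
  seq i := MeasurableSpace.comap (history T (k + i)) ⊤
  mono' := by
    intro i j hij
    have hij' : k + i ≤ k + j := by omega
    have : history T (k + i) =
        (fun (σ : Fin (k + j) → Finset (Finset ℕ)) (l : Fin (k + i)) => σ (Fin.castLE hij' l)) ∘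
          history T (k + j) := rfl
    change MeasurableSpace.comap _ ⊤ ≤ _
    rw [this, ← MeasurableSpace.comap_comp]
    exact MeasurableSpace.comap_mono le_top
  le' := by
    rintro i _ ⟨B, -, rfl⟩
    exact hT.measurableSet_history _ B

/-- Each transition that alters the trace has probability zero, and there are only countably many
pairs of a history and a next tree. -/
lemma IsAlphaGammaSequence.ae_traceShape_succ [IsProbabilityMeasure P] (hα₁ : α < 1)
    (hT : IsAlphaGammaSequence P α γ T) {n k : ℕ} (hn : 1 ≤ n) (hk : k ≤ n) :
    ∀ᵐ ω ∂P, traceShape (Finset.Icc 1 k) (T (n + 1) ω) = traceShape (Finset.Icc 1 k) (T n ω) := by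
  have hK : Finset.Icc 1 k ⊆ Finset.Icc 1 n := Finset.Icc_subset_Icc_right hk
  have key : ∀ (σ : Fin n → Finset (Finset ℕ)) (t' : Finset (Finset ℕ)), ∀ᵐ ω ∂P,
      history T n ω = σ → T (n + 1) ω = t' →
        traceShape (Finset.Icc 1 k) t' = traceShape (Finset.Icc 1 k) (T n ω) := by
    intro σ t'
    by_cases hgood : extendHistory σ n ∈ trees n ∧ t' ∈ trees (n + 1) ∧
      traceShape (Finset.Icc 1 k) t' ≠ traceShape (Finset.Icc 1 k) (extendHistory σ n)
    · have h0 := hT.growth_of_one_le hα₁ hn (extendHistory σ) hgood.2.1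
      rw [growthProb_eq_zero hgood.1 hK hgood.2.2, mul_zero, measureReal_eq_zero_iff] at h0
      filter_upwards [compl_mem_ae_iff.2 h0] with ω hω h1 h2
      exact absurd ⟨history_eq_iff.1 h1, h2⟩ hω
    · refine Eventually.of_forall fun ω h1 h2 => ?_
      have h3 := history_eq_iff.1 h1 n hn le_rfl
      by_contra hne
      refine hgood ⟨h3 ▸ hT.mem_trees n hn ω, h2 ▸ hT.mem_trees _ (by omega) ω, h3 ▸ hne⟩
  have key' := ae_all_iff.2 fun σ => ae_all_iff.2 fun t' => key σ t'
  filter_upwards [key'] with ω hω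
  exact hω _ _ rfl rfl

lemma IsAlphaGammaSequence.ae_traceShape [IsProbabilityMeasure P] (hα₁ : α < 1)
    (hT : IsAlphaGammaSequence P α γ T) {k : ℕ} (hk : 1 ≤ k) :
    ∀ᵐ ω ∂P, ∀ i, traceShape (Finset.Icc 1 k) (T (k + i) ω) = T k ω := by
  have h := ae_all_iff.2 fun i : ℕ =>
    hT.ae_traceShape_succ hα₁ (n := k + i) (k := k) (by omega) (by omega)
  filter_upwards [h] with ω hω i
  induction i with
  | zero => exact traceShape_self (hT.mem_trees k hk ω)
  | succ i ih => rw [← ih, ← hω i]; rfl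

variable {k : ℕ} {t : Finset (Finset ℕ)}

/-- For `k ≤ n` the event `T k = t` either contains a given history or is disjoint from it, so
conditioning only rescales the growth rule. -/
lemma cond_growth [IsProbabilityMeasure P] (hα₁ : α < 1) (hT : IsAlphaGammaSequence P α γ T)
    (hk : 1 ≤ k) {n : ℕ} (hkn : k ≤ n) (σ : Fin n → Finset (Finset ℕ)) {t' : Finset (Finset ℕ)}
    (ht' : t' ∈ trees (n + 1)) :
    (P[|{ω | T k ω = t}]).real (history T n ⁻¹' {σ} ∩ {ω | T (n + 1) ω = t'}) =
      (P[|{ω | T k ω = t}]).real (history T n ⁻¹' {σ}) *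
        growthProb α γ (extendHistory σ n) (n + 1) t' := by
  have hg := hT.growth_of_one_le hα₁ (hk.trans hkn) (extendHistory σ) ht'
  have hA : {ω | ∀ m, 1 ≤ m → m ≤ n → T m ω = extendHistory σ m} = history T n ⁻¹' {σ} := by
    ext ω; exact history_eq_iff.symm
  have hA' : {ω | (∀ m, 1 ≤ m → m ≤ n → T m ω = extendHistory σ m) ∧ T (n + 1) ω = t'} =
      history T n ⁻¹' {σ} ∩ {ω | T (n + 1) ω = t'} := by rw [← hA]; rfl
  rw [hA, hA'] at hg
  rw [measureReal_def, measureReal_def, cond_apply (hT.measurableSet_eq k hk t),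
    cond_apply (hT.measurableSet_eq k hk t), ENNReal.toReal_mul, ENNReal.toReal_mul, mul_assoc]
  congr 1
  by_cases h : extendHistory σ k = t
  · have hsub : history T n ⁻¹' {σ} ⊆ {ω | T k ω = t} := fun ω hω =>
      (history_eq_iff.1 hω k hk hkn).trans h
    rw [Set.inter_eq_right.2 hsub, Set.inter_eq_right.2 (Set.inter_subset_left.trans hsub)]
    exact hg
  · have hd : {ω | T k ω = t} ∩ history T n ⁻¹' {σ} = ∅ :=
      Set.eq_empty_of_forall_notMem fun ω hω =>
        h ((history_eq_iff.1 hω.2 k hk hkn).symm.trans hω.1)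
    rw [← Set.inter_assoc, hd]
    simp

lemma comp_tree_eq_sum (hT : IsAlphaGammaSequence P α γ T) {n : ℕ} (hn : 1 ≤ n)
    (f : Finset (Finset ℕ) → ℝ) : (fun ω => f (T n ω)) = fun ω =>
      ∑ t' ∈ (finite_trees n).toFinset, {ω | T n ω = t'}.indicator (fun _ => f t') ω := by
  funext ω
  rw [Finset.sum_eq_single (T n ω)]
  · rw [Set.indicator_of_mem]; rfl
  · intro b _ hb
    rw [Set.indicator_of_notMem]; exact fun h => hb h.symm
  · intro h
    exact absurd ((finite_trees n).mem_toFinset.2 (hT.mem_trees n hn ω)) h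

lemma integrable_comp_tree (hT : IsAlphaGammaSequence P α γ T) (Q : Measure Ω) [IsFiniteMeasure Q]
    {n : ℕ} (hn : 1 ≤ n) (f : Finset (Finset ℕ) → ℝ) : Integrable (fun ω => f (T n ω)) Q := by
  rw [comp_tree_eq_sum hT hn f]
  exact integrable_finsetSum _ fun t' _ =>
    (integrable_const _).indicator (hT.measurableSet_eq n hn t')

lemma setIntegral_comp_tree (hT : IsAlphaGammaSequence P α γ T) (Q : Measure Ω)
    [IsFiniteMeasure Q] {n : ℕ} (hn : 1 ≤ n) (f : Finset (Finset ℕ) → ℝ) (A : Set Ω) :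
    ∫ ω in A, f (T n ω) ∂Q =
      ∑ t' ∈ (finite_trees n).toFinset, Q.real (A ∩ {ω | T n ω = t'}) * f t' := by
  rw [comp_tree_eq_sum hT hn f, integral_finsetSum _ fun t' _ =>
    (integrable_const _).indicator (hT.measurableSet_eq n hn t')]
  refine Finset.sum_congr rfl fun t' _ => ?_
  rw [setIntegral_indicator (hT.measurableSet_eq n hn t'), setIntegral_const, smul_eq_mul]

lemma cond_ae_traceShape [IsProbabilityMeasure P] (hα₁ : α < 1)
    (hT : IsAlphaGammaSequence P α γ T) (hk : 1 ≤ k) :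
    ∀ᵐ ω ∂P[|{ω | T k ω = t}], T k ω = t ∧ ∀ i, traceShape (Finset.Icc 1 k) (T (k + i) ω) = t := by
  filter_upwards [cond_absolutelyContinuous.ae_le (hT.ae_traceShape hα₁ hk),
    ae_cond_mem (hT.measurableSet_eq k hk t)] with ω h1 h2
  exact ⟨h2, fun i => (h1 i).trans h2⟩

/-- Events of the filtration are countable disjoint unions of single histories, on each of which the
conditional mean is a finite sum over the next tree. The drift condition is needed only for trees
with trace `t`, since the others are null under the conditional measure. -/
lemma martingale_of_drift [IsProbabilityMeasure P] (hα₁ : α < 1)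
    (hT : IsAlphaGammaSequence P α γ T) (hk : 1 ≤ k) (f : ℕ → Finset (Finset ℕ) → ℝ)
    (hf : ∀ i, ∀ u ∈ trees (k + i), traceShape (Finset.Icc 1 k) u = t →
      ∑ t' ∈ (finite_trees (k + i + 1)).toFinset, growthProb α γ u (k + i + 1) t' * f (i + 1) t' =
        f i u) :
    Martingale (fun i ω => f i (T (k + i) ω)) (historyFiltration hT k) (P[|{ω | T k ω = t}]) := by
  set Q := P[|{ω | T k ω = t}] with hQ
  have hadapt : ∀ i, StronglyMeasurable[historyFiltration hT k i] fun ω => f i (T (k + i) ω) := by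
    intro i
    have h1 : (fun ω => f i (T (k + i) ω)) =
        (fun σ : Fin (k + i) → Finset (Finset ℕ) => f i (extendHistory σ (k + i))) ∘
          history T (k + i) := by
      funext ω
      simp only [Function.comp]
      rw [← (history_eq_iff (T := T) (ω := ω)).1 rfl (k + i) (by omega) le_rfl]
    refine Measurable.stronglyMeasurable ?_
    rw [h1]
    intro S _
    exact ⟨(fun σ : Fin (k + i) → Finset (Finset ℕ) => f i (extendHistory σ (k + i))) ⁻¹' S,
      trivial, rfl⟩
  have hint : ∀ i, Integrable (fun ω => f i (T (k + i) ω)) Q := fun i =>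
    integrable_comp_tree hT Q (by omega) (f i)
  refine martingale_nat hadapt hint fun i => ?_
  refine ae_eq_condExp_of_forall_setIntegral_eq ((historyFiltration hT k).le i) (hint (i + 1))
    (fun s _ _ => (hint i).integrableOn) ?_ (hadapt i).aestronglyMeasurable
  rintro _ ⟨B, -, rfl⟩ -
  have hB : history T (k + i) ⁻¹' B = ⋃ σ : B, history T (k + i) ⁻¹' {σ.1} := by
    ext ω; simp
  have hdis : Pairwise (Function.onFun Disjoint fun σ : B => history T (k + i) ⁻¹' {σ.1}) := by
    intro σ σ' hne
    refine Set.disjoint_left.2 fun ω h h' => hne (Subtype.ext ?_)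
    exact Eq.trans (Eq.symm h) h'
  rw [hB, integral_iUnion (fun σ => hT.measurableSet_history _ _) hdis (hint i).integrableOn,
    integral_iUnion (fun σ => hT.measurableSet_history _ _) hdis (hint (i + 1)).integrableOn]
  refine tsum_congr fun σ => ?_
  have hlast : ∀ ω ∈ history T (k + i) ⁻¹' {σ.1}, T (k + i) ω = extendHistory σ.1 (k + i) :=
    fun ω hω => (history_eq_iff.1 hω) (k + i) (by omega) le_rfl
  rw [setIntegral_congr_fun (hT.measurableSet_history _ _)
    (g := fun _ => f i (extendHistory σ.1 (k + i))) (fun ω hω => by simp only [hlast ω hω]),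
    setIntegral_const, smul_eq_mul]
  change _ = ∫ ω in _, f (i + 1) (T (k + i + 1) ω) ∂Q
  rw [setIntegral_comp_tree hT Q (by omega)]
  have hstep : ∀ t' ∈ (finite_trees (k + i + 1)).toFinset,
      Q.real (history T (k + i) ⁻¹' {σ.1} ∩ {ω | T (k + i + 1) ω = t'}) * f (i + 1) t' =
      Q.real (history T (k + i) ⁻¹' {σ.1}) *
        (growthProb α γ (extendHistory σ.1 (k + i)) (k + i + 1) t' * f (i + 1) t') := by
    intro t' ht'
    rw [cond_growth hα₁ hT hk (by omega) σ.1 ((Set.Finite.mem_toFinset _).1 ht'), mul_assoc]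
  rw [Finset.sum_congr rfl hstep, ← Finset.mul_sum]
  -- A history of probability zero contributes nothing; any other one contains an outcome at which
  -- the trace is `t`, so the drift condition applies to its last tree.
  by_cases h0 : Q.real (history T (k + i) ⁻¹' {σ.1}) = 0
  · rw [h0, zero_mul, zero_mul]
  · have hne : Q (history T (k + i) ⁻¹' {σ.1}) ≠ 0 := fun h => h0 (by simp [measureReal_def, h])
    have hex : ∃ ω ∈ history T (k + i) ⁻¹' {σ.1},
        traceShape (Finset.Icc 1 k) (T (k + i) ω) = t := by
      by_contra hcon
      push Not at hcon
      refine hne (measure_mono_null (fun ω hω => ?_)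
        (ae_iff.1 (cond_ae_traceShape (t := t) hα₁ hT hk)))
      exact fun h => hcon ω hω (h.2 i)
    obtain ⟨ω, hω, hω2⟩ := hex
    rw [hlast ω hω] at hω2
    rw [hf i _ (hlast ω hω ▸ hT.mem_trees _ (by omega) ω) hω2]

end Chain

/-! ### Limits of normalized rising factorials -/

/-- The quotient of the Gauss products for `Γ(x)` and `Γ(x + r)`. The sequence is shifted by one
because the `n`-th Gauss product has `n + 1` factors; the base `k + i` instead of `n` changes the
power only by a factor tending to 1. -/
lemma tendsto_prod_ratio {x r : ℝ} (hx : 0 < x) (hr : 0 ≤ r) (k : ℕ) :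
    Tendsto (fun i : ℕ => (∏ j ∈ Finset.range i, (x + j + r) / (x + j)) * ((k : ℝ) + i) ^ (-r))
      atTop (𝓝 (Real.Gamma x / Real.Gamma (x + r))) := by
  have hxr : 0 < x + r := by linarith
  have h1 := (Real.GammaSeq_tendsto_Gamma x).div (Real.GammaSeq_tendsto_Gamma (x + r))
    (Real.Gamma_pos_of_pos hxr).ne'
  have h2 : Tendsto (fun n : ℕ => ((n : ℝ) / (n + (k + 1))) ^ r) atTop (𝓝 1) := by
    have := (tendsto_natCast_div_add_atTop ((k : ℝ) + 1)).rpow_const (p := r)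
      (Or.inl one_ne_zero)
    simpa using this
  have h3 := h1.mul h2
  rw [mul_one] at h3
  rw [← tendsto_add_atTop_iff_nat 1]
  refine h3.congr' ?_
  filter_upwards [eventually_ge_atTop 1] with n hn
  have hn0 : (0 : ℝ) < n := by exact_mod_cast hn
  have hprod : ∀ y : ℝ, 0 < y → 0 < ∏ j ∈ Finset.range (n + 1), (y + j) := fun y hy =>
    Finset.prod_pos fun j _ => by positivity
  have e1 : ∏ j ∈ Finset.range (n + 1), (x + j + r) / (x + j) =
      (∏ j ∈ Finset.range (n + 1), (x + r + j)) / ∏ j ∈ Finset.range (n + 1), (x + j) := by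
    rw [← Finset.prod_div_distrib]
    exact Finset.prod_congr rfl fun j _ => by ring_nf
  have hf : (0 : ℝ) < n.factorial := by exact_mod_cast n.factorial_pos
  have e2 : (k : ℝ) + ((n + 1 : ℕ) : ℝ) = n + (k + 1) := by push_cast; ring
  simp only [Pi.div_apply]
  rw [e1, e2, Real.GammaSeq, Real.GammaSeq, Real.rpow_add hn0, Real.rpow_neg (by positivity),
    Real.div_rpow hn0.le (by positivity)]
  have p1 := hprod x hx
  have p2 := hprod (x + r) hxr
  have p3 : (0 : ℝ) < (n : ℝ) ^ x := Real.rpow_pos_of_pos hn0 _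
  have p4 : (0 : ℝ) < (n : ℝ) ^ r := Real.rpow_pos_of_pos hn0 _
  have p5 : (0 : ℝ) < ((n : ℝ) + (k + 1)) ^ r := Real.rpow_pos_of_pos (by positivity) _
  field_simp

lemma tendsto_rising_mul_pow {u v : ℕ → ℝ} {l c : ℝ} (huv : Tendsto (fun i => u i * v i) atTop (𝓝 l))
    (hv : Tendsto v atTop (𝓝 0)) (p : ℕ) :
    Tendsto (fun i => rising (u i + c) p * v i ^ p) atTop (𝓝 (l ^ p)) := by
  induction p with
  | zero => simp [rising_zero]
  | succ p ih =>
    have h := ih.mul (huv.add (hv.const_mul (c + p)))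
    rw [mul_zero, add_zero, ← pow_succ] at h
    refine h.congr fun i => ?_
    rw [rising_succ]; ring

/-- Convergence of the means of a sequence that is bounded in `L²`. -/
lemma tendsto_integral_of_sq_le {Ω : Type*} [MeasurableSpace Ω] {Q : Measure Ω} [IsFiniteMeasure Q]
    {f : ℕ → Ω → ℝ} {g : Ω → ℝ} {C : ℝ} (hf : ∀ i, AEStronglyMeasurable (f i) Q)
    (hsq : ∀ i, Integrable (fun ω => f i ω ^ 2) Q) (hC : ∀ i, ∫ ω, f i ω ^ 2 ∂Q ≤ C)
    (hlim : ∀ᵐ ω ∂Q, Tendsto (fun i => f i ω) atTop (𝓝 (g ω))) :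
    Integrable g Q ∧ Tendsto (fun i => ∫ ω, f i ω ∂Q) atTop (𝓝 (∫ ω, g ω ∂Q)) := by
  have hC0 : 0 ≤ C := (integral_nonneg fun ω => sq_nonneg _).trans (hC 0)
  have hUI : UniformIntegrable f 1 Q := by
    refine uniformIntegrable_of le_rfl ENNReal.one_ne_top hf fun ε hε => ?_
    -- Where `|f| ≥ c` one has `|f| ≤ f ^ 2 / c`, and `c = C / ε + 1` makes `C / c ≤ ε`. The summand
    -- 1 keeps `c` positive when `C = 0`.
    refine ⟨⟨C / ε + 1, by positivity⟩, fun i => ?_⟩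
    have hA : (0 : ℝ) < C / ε + 1 := by positivity
    rw [eLpNorm_one_eq_lintegral_enorm]
    calc ∫⁻ ω, ‖({ω | (⟨C / ε + 1, by positivity⟩ : NNReal) ≤ ‖f i ω‖₊}.indicator (f i)) ω‖ₑ ∂Q
        ≤ ∫⁻ ω, ENNReal.ofReal (f i ω ^ 2 / (C / ε + 1)) ∂Q := by
          refine lintegral_mono fun ω => ?_
          by_cases h : ω ∈ {ω | (⟨C / ε + 1, by positivity⟩ : NNReal) ≤ ‖f i ω‖₊}
          · rw [Set.indicator_of_mem h, ← ofReal_norm]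
            refine ENNReal.ofReal_le_ofReal ?_
            have h' : C / ε + 1 ≤ ‖f i ω‖ := h
            rw [le_div_iff₀ hA, ← sq_abs, ← Real.norm_eq_abs, sq]
            exact mul_le_mul_of_nonneg_left h' (norm_nonneg _)
          · rw [Set.indicator_of_notMem h]; simp
      _ = ENNReal.ofReal (∫ ω, f i ω ^ 2 / (C / ε + 1) ∂Q) := by
          rw [ofReal_integral_eq_lintegral_ofReal ((hsq i).div_const _)
            (Eventually.of_forall fun ω => by positivity)]
      _ ≤ ENNReal.ofReal ε := by
          refine ENNReal.ofReal_le_ofReal ?_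
          rw [integral_div, div_le_iff₀ hA]
          have : ε * (C / ε + 1) = C + ε := by field_simp
          linarith [hC i]
  have hg := hUI.integrable_of_ae_tendsto hlim
  refine ⟨hg, ?_⟩
  refine tendsto_integral_of_L1' g hg.aestronglyMeasurable
    (Eventually.of_forall fun i => memLp_one_iff_integrable.1 (hUI.memLp i)) ?_
  exact tendsto_Lp_finite_of_tendsto_ae le_rfl ENNReal.one_ne_top hf
    (memLp_one_iff_integrable.2 hg) hUI.2.1 hlim

/-! ### Almost sure limits and their moments -/

lemma edgeWeight_pos {α γ : ℝ} (hα₁ : α < 1) (hγ₀ : 0 < γ) (B : Finset ℕ) :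
    0 < edgeWeight α γ B := by
  unfold edgeWeight; split_ifs <;> linarith

lemma rpow_neg_add_eq_prod {N γ : ℝ} (hN : 0 < N) (t : Finset (Finset ℕ)) (q : ℕ)
    (p : Finset ℕ → ℕ) : N ^ (-(γ * ∑ B ∈ t, (p B : ℝ) + q)) =
      N⁻¹ ^ q * ∏ B ∈ t, (N ^ γ)⁻¹ ^ p B := by
  rw [Finset.prod_pow_eq_pow_sum, Real.rpow_neg hN.le, Real.rpow_add hN, Real.rpow_mul hN.le,
    Real.rpow_natCast, ← Nat.cast_sum, Real.rpow_natCast, mul_inv, inv_pow, inv_pow, mul_comm]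

section Limits

variable {Ω : Type*} [mΩ : MeasurableSpace Ω] {P : Measure Ω} [IsProbabilityMeasure P] {α γ : ℝ}
  {T : ℕ → Ω → Finset (Finset ℕ)} {k : ℕ} {t : Finset (Finset ℕ)}

lemma fibre_arg_nonneg (hα₁ : α < 1) (hγ₀ : 0 < γ) {K : Finset ℕ} {u : Finset (Finset ℕ)}
    {B : Finset ℕ} (hB : B ∈ traceShape K u) :
    0 ≤ ((fibre K u B).card : ℝ) - 1 + edgeWeight α γ B / γ := by
  have h1 : 0 < (fibre K u B).card := Finset.card_pos.2 (mem_traceShape.1 hB).2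
  have h2 : (1 : ℝ) ≤ (fibre K u B).card := by exact_mod_cast h1
  have h3 := div_pos (edgeWeight_pos hα₁ hγ₀ B) hγ₀
  linarith

lemma attached_arg_nonneg (hα₁ : α < 1) (hγ₀ : 0 < γ) (K : Finset ℕ) (u s : Finset (Finset ℕ))
    (p : Finset ℕ → ℕ) :
    0 ≤ ((attached K u).card : ℝ) + ∑ B ∈ s, edgeWeight α γ B + γ * ∑ B ∈ s, (p B : ℝ) := by
  have := Finset.sum_nonneg fun B (_ : B ∈ s) => (edgeWeight_pos hα₁ hγ₀ B).le
  positivity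

lemma momentFunctional_nonneg (hα₁ : α < 1) (hγ₀ : 0 < γ) {K : Finset ℕ}
    (u : Finset (Finset ℕ)) (q : ℕ) (p : Finset ℕ → ℕ) :
    0 ≤ momentFunctional α γ K (traceShape K u) q p u :=
  mul_nonneg (rising_nonneg (attached_arg_nonneg hα₁ hγ₀ K u _ p) q)
    (Finset.prod_nonneg fun _ hB => rising_nonneg (fibre_arg_nonneg hα₁ hγ₀ hB) _)

/-- Supplies `L²` bounds without any further computation: the squares are controlled by functionals
of the same family, whose means are known. Doubling `p` only enlarges the shift in the first factor.
-/
lemma momentFunctional_sq_le (hα₁ : α < 1) (hγ₀ : 0 < γ) {K : Finset ℕ}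
    (u : Finset (Finset ℕ)) (q : ℕ) (p : Finset ℕ → ℕ) :
    momentFunctional α γ K (traceShape K u) q p u ^ 2 ≤
      momentFunctional α γ K (traceShape K u) (2 * q) (fun B => 2 * p B) u := by
  have h0 := attached_arg_nonneg hα₁ hγ₀ K u (traceShape K u) p
  have hs : 0 ≤ γ * ∑ B ∈ traceShape K u, (p B : ℝ) := by positivity
  rw [momentFunctional, mul_pow, ← Finset.prod_pow]
  refine mul_le_mul ?_ ?_ (Finset.prod_nonneg fun _ _ => sq_nonneg _)
    (rising_nonneg (attached_arg_nonneg hα₁ hγ₀ K u _ _) _)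
  · refine (rising_sq_le h0 q).trans (rising_mono h0 ?_ _)
    push_cast
    rw [← Finset.mul_sum]
    linarith
  · exact Finset.prod_le_prod (fun _ _ => sq_nonneg _)
      fun B hB => rising_sq_le (fibre_arg_nonneg hα₁ hγ₀ hB) _

/-- The constants that turn the moment functionals into martingales. -/
noncomputable def martingaleConst (x r : ℝ) (i : ℕ) : ℝ :=
  ∏ j ∈ Finset.range i, (x + j) / (x + j + r)

lemma martingaleConst_pos {x r : ℝ} (hx : 0 < x) (hr : 0 ≤ r) (i : ℕ) :
    0 < martingaleConst x r i := Finset.prod_pos fun j _ => by positivity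

lemma martingaleConst_inv (x r : ℝ) (i : ℕ) :
    (martingaleConst x r i)⁻¹ = ∏ j ∈ Finset.range i, (x + j + r) / (x + j) := by
  rw [martingaleConst, ← Finset.prod_inv_distrib]
  exact Finset.prod_congr rfl fun j _ => inv_div _ _

lemma martingale_momentFunctional (hα₁ : α < 1) (hγ₀ : 0 < γ)
    (hT : IsAlphaGammaSequence P α γ T) (hk : 1 ≤ k) (q : ℕ) (p : Finset ℕ → ℕ) :
    Martingale (fun i ω => momentFunctional α γ (Finset.Icc 1 k) t q p (T (k + i) ω) *
        martingaleConst (k - α) (γ * ∑ B ∈ t, (p B : ℝ) + q) i)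
      (historyFiltration hT k) (P[|{ω | T k ω = t}]) := by
  refine martingale_of_drift hα₁ hT hk (fun i u => momentFunctional α γ (Finset.Icc 1 k) t q p u *
        martingaleConst (k - α) (γ * ∑ B ∈ t, (p B : ℝ) + q) i) ?_
  rintro i u hu rfl
  have hd := drift_momentFunctional (α := α) hγ₀ hu (K := Finset.Icc 1 k)
    (Finset.Icc_subset_Icc_right (by omega)) q p
  simp only [← mul_assoc, ← Finset.sum_mul, hd]
  rw [mul_assoc]
  congr 1
  rw [martingaleConst, Finset.prod_range_succ, ← martingaleConst]
  have hk' : (1 : ℝ) ≤ k := by exact_mod_cast hk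
  have h1 : (0 : ℝ) < k - α + i := by
    have : (0 : ℝ) ≤ i := Nat.cast_nonneg i
    linarith
  have h2 : 0 ≤ γ * ∑ B ∈ traceShape (Finset.Icc 1 k) u, (p B : ℝ) + q := by positivity
  have h3 : ((k + i : ℕ) : ℝ) - α = k - α + i := by push_cast; ring
  rw [h3]
  field_simp

lemma integral_momentFunctional (hα₁ : α < 1) (hγ₀ : 0 < γ)
    (hT : IsAlphaGammaSequence P α γ T) (hk : 1 ≤ k) (ht : P {ω | T k ω = t} ≠ 0)
    (q : ℕ) (p : Finset ℕ → ℕ) (i : ℕ) :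
    ∫ ω, momentFunctional α γ (Finset.Icc 1 k) t q p (T (k + i) ω) ∂P[|{ω | T k ω = t}] =
      momentFunctional α γ (Finset.Icc 1 k) t q p t *
        ∏ j ∈ Finset.range i, ((k : ℝ) - α + j + (γ * ∑ B ∈ t, (p B : ℝ) + q)) / (k - α + j) := by
  have := cond_isProbabilityMeasure ht
  have hm := (martingale_momentFunctional (t := t) hα₁ hγ₀ hT hk q p).setIntegral_eq
    (Nat.zero_le i) MeasurableSet.univ
  have hk' : (1 : ℝ) ≤ k := by exact_mod_cast hk
  have hx : (0 : ℝ) < k - α := by linarith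
  have hr : 0 ≤ γ * ∑ B ∈ t, (p B : ℝ) + q := by positivity
  simp only [Measure.restrict_univ, integral_mul_const] at hm
  rw [← martingaleConst_inv, ← div_eq_mul_inv, eq_div_iff (martingaleConst_pos hx hr i).ne', ← hm]
  rw [integral_congr_ae (g := fun _ => momentFunctional α γ (Finset.Icc 1 k) t q p t)]
  · simp [martingaleConst]
  · filter_upwards [ae_cond_mem (hT.measurableSet_eq k hk t)] with ω hω
    rw [add_zero, show T k ω = t from hω]

/-- A nonnegative martingale is bounded in `L¹` and hence converges. The normalizing products may be
replaced by powers because their quotient converges. -/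
lemma exists_tendsto_momentFunctional (hα₁ : α < 1) (hγ₀ : 0 < γ)
    (hT : IsAlphaGammaSequence P α γ T) (hk : 1 ≤ k) (ht : P {ω | T k ω = t} ≠ 0)
    (q : ℕ) (p : Finset ℕ → ℕ) : ∀ᵐ ω ∂P[|{ω | T k ω = t}], ∃ l,
      Tendsto (fun i : ℕ => momentFunctional α γ (Finset.Icc 1 k) t q p (T (k + i) ω) *
        ((k : ℝ) + i) ^ (-(γ * ∑ B ∈ t, (p B : ℝ) + q))) atTop (𝓝 l) := by
  have := cond_isProbabilityMeasure ht
  set Q := P[|{ω | T k ω = t}] with hQ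
  have hk' : (1 : ℝ) ≤ k := by exact_mod_cast hk
  have hx : (0 : ℝ) < k - α := by linarith
  have hr : 0 ≤ γ * ∑ B ∈ t, (p B : ℝ) + q := by positivity
  set r := γ * ∑ B ∈ t, (p B : ℝ) + q with hrdef
  have hm := martingale_momentFunctional (t := t) hα₁ hγ₀ hT hk q p
  have hbdd : ∀ i, eLpNorm (fun ω => momentFunctional α γ (Finset.Icc 1 k) t q p (T (k + i) ω) *
      martingaleConst (k - α) r i) 1 Q ≤
        (momentFunctional α γ (Finset.Icc 1 k) t q p t).toNNReal := by
    intro i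
    rw [eLpNorm_one_eq_lintegral_enorm]
    have h1 : ∀ᵐ ω ∂Q, 0 ≤ momentFunctional α γ (Finset.Icc 1 k) t q p (T (k + i) ω) *
        martingaleConst (k - α) r i := by
      filter_upwards [cond_ae_traceShape (t := t) hα₁ hT hk] with ω hω
      have := momentFunctional_nonneg hα₁ hγ₀ (K := Finset.Icc 1 k) (T (k + i) ω) q p
      rw [hω.2 i] at this
      exact mul_nonneg this (martingaleConst_pos hx hr i).le
    rw [lintegral_congr_ae (g := fun ω => ENNReal.ofReal
      (momentFunctional α γ (Finset.Icc 1 k) t q p (T (k + i) ω) * martingaleConst (k - α) r i))]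
    · rw [← ofReal_integral_eq_lintegral_ofReal (hm.integrable i) h1, integral_mul_const,
        integral_momentFunctional hα₁ hγ₀ hT hk ht, ← martingaleConst_inv, ← hrdef, mul_assoc,
        inv_mul_cancel₀ (martingaleConst_pos hx hr i).ne', mul_one]
      exact le_rfl
    · filter_upwards [h1] with ω hω
      rw [← ofReal_norm, Real.norm_of_nonneg hω]
  filter_upwards [hm.submartingale.exists_ae_tendsto_of_bdd hbdd] with ω ⟨l, hl⟩
  refine ⟨_, (hl.mul (tendsto_prod_ratio hx hr k)).congr fun i => ?_⟩
  rw [← martingaleConst_inv]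
  have := (martingaleConst_pos hx hr i).ne'
  field_simp
  rw [hrdef]

lemma tendsto_shift_inv (k : ℕ) : Tendsto (fun i : ℕ => ((k : ℝ) + i)⁻¹) atTop (𝓝 0) :=
  tendsto_inv_atTop_zero.comp (tendsto_atTop_add_const_left _ _ tendsto_natCast_atTop_atTop)

lemma tendsto_shift_rpow_inv (hγ₀ : 0 < γ) (k : ℕ) :
    Tendsto (fun i : ℕ => (((k : ℝ) + i) ^ γ)⁻¹) atTop (𝓝 0) :=
  tendsto_inv_atTop_zero.comp ((tendsto_rpow_atTop hγ₀).comp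
    (tendsto_atTop_add_const_left _ _ tendsto_natCast_atTop_atTop))

lemma exists_tendsto_attached (hα₁ : α < 1) (hγ₀ : 0 < γ)
    (hT : IsAlphaGammaSequence P α γ T) (hk : 1 ≤ k) (ht : P {ω | T k ω = t} ≠ 0) :
    ∀ᵐ ω ∂P[|{ω | T k ω = t}], ∃ l,
      Tendsto (fun i : ℕ => ((attached (Finset.Icc 1 k) (T (k + i) ω)).card : ℝ) * ((k : ℝ) + i)⁻¹)
        atTop (𝓝 l) := by
  -- For `q = 1`, `p = 0` the functional is `M + θ`, and `θ` disappears in the limit.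
  filter_upwards [exists_tendsto_momentFunctional hα₁ hγ₀ hT hk ht 1 0] with ω ⟨l, hl⟩
  refine ⟨_, (hl.sub ((tendsto_shift_inv k).const_mul (∑ B ∈ t, edgeWeight α γ B))).congr
    fun i => ?_⟩
  simp only [momentFunctional, rising_one, rising_zero, Pi.zero_apply, Nat.cast_zero,
    Finset.sum_const_zero, mul_zero, add_zero, Finset.prod_const_one, mul_one, zero_add,
    Nat.cast_one, Real.rpow_neg_one]
  ring

lemma exists_tendsto_fibre (hα₁ : α < 1) (hγ₀ : 0 < γ)
    (hT : IsAlphaGammaSequence P α γ T) (hk : 1 ≤ k) (ht : P {ω | T k ω = t} ≠ 0)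
    {B : Finset ℕ} (hB : B ∈ t) :
    ∀ᵐ ω ∂P[|{ω | T k ω = t}], ∃ l,
      Tendsto (fun i : ℕ => ((fibre (Finset.Icc 1 k) (T (k + i) ω) B).card : ℝ) *
        (((k : ℝ) + i) ^ γ)⁻¹) atTop (𝓝 l) := by
  -- For `q = 0` and `p` the indicator of `B` the functional is `N_B - 1 + w_B / γ`.
  filter_upwards [exists_tendsto_momentFunctional hα₁ hγ₀ hT hk ht 0 (Pi.single B 1)] with ω ⟨l, hl⟩
  refine ⟨_, (hl.sub ((tendsto_shift_rpow_inv hγ₀ k).const_mul (edgeWeight α γ B / γ - 1))).congr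
    fun i => ?_⟩
  have hkp : (0 : ℝ) < (k : ℝ) + i := by
    have : (1 : ℝ) ≤ k := by exact_mod_cast hk
    positivity
  have h1 : ∑ B' ∈ t, ((Pi.single B 1 : Finset ℕ → ℕ) B' : ℝ) = 1 := by
    rw [Finset.sum_eq_single B] <;> simp +contextual [hB]
  have h2 : ∏ B' ∈ t, rising (((fibre (Finset.Icc 1 k) (T (k + i) ω) B').card : ℝ) - 1 +
      edgeWeight α γ B' / γ) ((Pi.single B 1 : Finset ℕ → ℕ) B') =
      ((fibre (Finset.Icc 1 k) (T (k + i) ω) B).card : ℝ) - 1 + edgeWeight α γ B / γ := by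
    rw [Finset.prod_eq_single B]
    · simp [rising_one]
    · intro B' _ hne; simp [hne, rising_zero]
    · exact fun h => absurd hB h
  rw [momentFunctional, h1, h2, rising_zero, mul_one, Nat.cast_zero, add_zero,
    Real.rpow_neg hkp.le]
  ring

/-- The normalized functionals converge almost surely to the monomial in `W` and `X B`, because
additive constants inside rising factorials are negligible. Boundedness in `L²` carries the known
means to the limit. -/
lemma joint_moments (hα₁ : α < 1) (hγ₀ : 0 < γ)
    (hT : IsAlphaGammaSequence P α γ T) (hk : 1 ≤ k) (ht : P {ω | T k ω = t} ≠ 0)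
    {W : Ω → ℝ} {X : Finset ℕ → Ω → ℝ}
    (hW : ∀ᵐ ω ∂P[|{ω | T k ω = t}], Tendsto (fun i : ℕ =>
      ((attached (Finset.Icc 1 k) (T (k + i) ω)).card : ℝ) * ((k : ℝ) + i)⁻¹) atTop (𝓝 (W ω)))
    (hX : ∀ B ∈ t, ∀ᵐ ω ∂P[|{ω | T k ω = t}], Tendsto (fun i : ℕ =>
      ((fibre (Finset.Icc 1 k) (T (k + i) ω) B).card : ℝ) * (((k : ℝ) + i) ^ γ)⁻¹)
        atTop (𝓝 (X B ω)))
    (q : ℕ) (p : Finset ℕ → ℕ) :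
    Integrable (fun ω => W ω ^ q * ∏ B ∈ t, X B ω ^ p B) (P[|{ω | T k ω = t}]) ∧
    ∫ ω, W ω ^ q * ∏ B ∈ t, X B ω ^ p B ∂P[|{ω | T k ω = t}] =
      rising (∑ B ∈ t, edgeWeight α γ B + γ * ∑ B ∈ t, (p B : ℝ)) q *
        (∏ B ∈ t, rising (edgeWeight α γ B / γ) (p B)) *
        (Real.Gamma (k - α) / Real.Gamma (k - α + (γ * ∑ B ∈ t, (p B : ℝ) + q))) := by
  have := cond_isProbabilityMeasure ht
  set Q := P[|{ω | T k ω = t}] with hQ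
  have hk' : (1 : ℝ) ≤ k := by exact_mod_cast hk
  have hx : (0 : ℝ) < k - α := by linarith
  have hr : 0 ≤ γ * ∑ B ∈ t, (p B : ℝ) + q := by positivity
  set r := γ * ∑ B ∈ t, (p B : ℝ) + q with hrdef
  have hN : ∀ i : ℕ, (0 : ℝ) < (k : ℝ) + i := fun i => by positivity
  have htt : t ∈ trees k := by
    by_contra h
    refine ht ?_
    convert measure_empty (μ := P)
    refine Set.eq_empty_of_forall_notMem fun ω hω => h ?_
    rw [← show T k ω = t from hω]
    exact hT.mem_trees k hk ω
  set f : ℕ → Ω → ℝ := fun i ω =>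
    momentFunctional α γ (Finset.Icc 1 k) t q p (T (k + i) ω) * ((k : ℝ) + i) ^ (-r) with hf
  have hmean : ∀ (q : ℕ) (p : Finset ℕ → ℕ), Tendsto (fun i : ℕ => ∫ ω,
      momentFunctional α γ (Finset.Icc 1 k) t q p (T (k + i) ω) *
        ((k : ℝ) + i) ^ (-(γ * ∑ B ∈ t, (p B : ℝ) + q)) ∂Q) atTop
        (𝓝 (momentFunctional α γ (Finset.Icc 1 k) t q p t *
        (Real.Gamma (k - α) / Real.Gamma (k - α + (γ * ∑ B ∈ t, (p B : ℝ) + q))))) := by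
    intro q p
    refine ((tendsto_prod_ratio hx (by positivity) k).const_mul _).congr fun i => ?_
    rw [integral_mul_const, integral_momentFunctional hα₁ hγ₀ hT hk ht]
    ring
  have hlim : ∀ᵐ ω ∂Q, Tendsto (fun i => f i ω) atTop (𝓝 (W ω ^ q * ∏ B ∈ t, X B ω ^ p B)) := by
    have hX' : ∀ᵐ ω ∂Q, ∀ B ∈ t, Tendsto (fun i : ℕ =>
      ((fibre (Finset.Icc 1 k) (T (k + i) ω) B).card : ℝ) * (((k : ℝ) + i) ^ γ)⁻¹)
        atTop (𝓝 (X B ω)) := (ae_ball_iff t.countable_toSet).2 hX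
    filter_upwards [hW, hX'] with ω h1 h2
    have h3 := (tendsto_rising_mul_pow (c := ∑ B ∈ t, edgeWeight α γ B + γ * ∑ B ∈ t, (p B : ℝ))
      h1 (tendsto_shift_inv k) q).mul (tendsto_finsetProd t fun B hB =>
        tendsto_rising_mul_pow (c := - 1 + edgeWeight α γ B / γ) (h2 B hB)
          (tendsto_shift_rpow_inv hγ₀ k) (p B))
    refine h3.congr fun i => ?_
    simp only [hf]
    rw [hrdef, rpow_neg_add_eq_prod (hN i), momentFunctional, Finset.prod_mul_distrib]
    simp only [← add_assoc, ← sub_eq_add_neg]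
    ring
  have hint : ∀ i, Integrable (f i) Q := fun i =>
    (integrable_comp_tree hT Q (by omega) _).mul_const _
  -- The second moments are dominated by the means for doubled exponents, which converge and so are
  -- bounded.
  obtain ⟨C, hC⟩ := (hmean (2 * q) (fun B => 2 * p B)).bddAbove_range
  have hsqint : ∀ i, Integrable (fun ω => f i ω ^ 2) Q := fun i =>
    integrable_comp_tree hT Q (n := k + i) (by omega) (fun u =>
      (momentFunctional α γ (Finset.Icc 1 k) t q p u * ((k : ℝ) + i) ^ (-r)) ^ 2)
  have key := tendsto_integral_of_sq_le (Q := Q) (f := f)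
    (g := fun ω => W ω ^ q * ∏ B ∈ t, X B ω ^ p B) (C := C)
    (fun i => (hint i).aestronglyMeasurable) hsqint
    (fun i => by
      refine le_trans ?_ (hC ⟨i, rfl⟩)
      refine integral_mono_ae (hsqint i)
        ((integrable_comp_tree hT Q (n := k + i) (by omega) _).mul_const _) ?_
      filter_upwards [cond_ae_traceShape (t := t) hα₁ hT hk] with ω hω
      have h1 := momentFunctional_sq_le hα₁ hγ₀ (K := Finset.Icc 1 k) (T (k + i) ω) q p
      rw [hω.2 i] at h1
      have h2 : (((k : ℝ) + i) ^ (-r)) ^ 2 =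
          ((k : ℝ) + i) ^ (-(γ * ∑ B ∈ t, ((2 * p B : ℕ) : ℝ) + ((2 * q : ℕ) : ℝ))) := by
        rw [← Real.rpow_natCast, ← Real.rpow_mul (hN i).le]
        congr 1
        push_cast
        rw [← Finset.mul_sum, hrdef]; ring
      simp only [hf]
      rw [mul_pow, h2]
      exact mul_le_mul_of_nonneg_right h1 (Real.rpow_nonneg (hN i).le _))
    hlim
  refine ⟨key.1, ?_⟩
  -- At time `k` no label is attached and every fibre is a single vertex, which gives the constants
  -- of the initial value.
  rw [tendsto_nhds_unique key.2 (hmean q p), momentFunctional, attached_self htt]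
  congr 2
  · simp
  · refine Finset.prod_congr rfl fun B hB => ?_
    rw [fibre_self htt hB]; simp

end Limits

/-! ### Measures determined by their moments -/

/-- Integrating the exponential series term by term, the factorials cancel and a geometric series of
ratio `ε * b` remains. -/
lemma integrable_exp_of_moments_le {Ω : Type*} [MeasurableSpace Ω] {μ : Measure Ω}
    {f : Ω → ℝ} (hf : AEMeasurable f μ) (hf0 : ∀ᵐ ω ∂μ, 0 ≤ f ω)
    (hint : ∀ p : ℕ, Integrable (fun ω => f ω ^ p) μ) {C b : ℝ}
    (hle : ∀ p : ℕ, ∫ ω, f ω ^ p ∂μ ≤ C * b ^ p * p.factorial) {ε : ℝ} (hε : 0 ≤ ε)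
    (hb : 0 ≤ b) (hεb : ε * b < 1) : Integrable (fun ω => Real.exp (ε * f ω)) μ := by
  refine ⟨(hf.const_mul ε).exp.aestronglyMeasurable, ?_⟩
  rw [hasFiniteIntegral_iff_ofReal (Eventually.of_forall fun ω => (Real.exp_pos _).le)]
  have h1 : ∀ᵐ ω ∂μ, ENNReal.ofReal (Real.exp (ε * f ω)) =
      ∑' p : ℕ, ENNReal.ofReal ((ε * f ω) ^ p / p.factorial) := by
    filter_upwards [hf0] with ω hω
    rw [Real.exp_eq_exp_ℝ, NormedSpace.exp_eq_tsum_div, ENNReal.ofReal_tsum_of_nonneg]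
    · intro p; positivity
    · exact NormedSpace.expSeries_div_summable (ε * f ω)
  rw [lintegral_congr_ae h1, lintegral_tsum fun p =>
    (((hf.const_mul ε).pow_const p).div_const _).ennreal_ofReal]
  have h2 : ∀ p : ℕ, ∫⁻ ω, ENNReal.ofReal ((ε * f ω) ^ p / p.factorial) ∂μ ≤
      ENNReal.ofReal (C * (ε * b) ^ p) := by
    intro p
    rw [← ofReal_integral_eq_lintegral_ofReal]
    · refine ENNReal.ofReal_le_ofReal ?_
      simp only [mul_pow, integral_div, integral_const_mul]
      have hp : (0 : ℝ) < p.factorial := by exact_mod_cast p.factorial_pos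
      rw [div_le_iff₀ hp]
      calc ε ^ p * ∫ ω, f ω ^ p ∂μ ≤ ε ^ p * (C * b ^ p * p.factorial) :=
            mul_le_mul_of_nonneg_left (hle p) (by positivity)
        _ = _ := by ring
    · simp only [mul_pow]
      exact ((hint p).const_mul _).div_const _
    · filter_upwards [hf0] with ω hω
      positivity
  have hC : 0 ≤ C := by
    have := hle 0
    have h0 : 0 ≤ ∫ ω, f ω ^ 0 ∂μ := integral_nonneg fun ω => by simp
    simp only [pow_zero, mul_one, Nat.factorial_zero, Nat.cast_one] at this h0
    linarith
  refine (ENNReal.tsum_le_tsum h2).trans_lt ?_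
  rw [← ENNReal.ofReal_tsum_of_nonneg]
  · exact ENNReal.ofReal_lt_top
  · intro p; positivity
  · exact (summable_geometric_of_lt_one (by positivity) hεb).mul_left C

/-- The complex moment generating functions are analytic on a vertical strip around 0 and the
moments are their derivatives at 0. By the identity theorem they agree on the strip, which contains
the imaginary axis, where they are the characteristic functions. -/
lemma ext_of_moments_real {μ ν : Measure ℝ} [IsProbabilityMeasure μ] [IsProbabilityMeasure ν]
    (hμ : 0 ∈ interior (integrableExpSet id μ)) (hν : 0 ∈ interior (integrableExpSet id ν))
    (h : ∀ p : ℕ, ∫ x, x ^ p ∂μ = ∫ x, x ^ p ∂ν) : μ = ν := by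
  set I := interior (integrableExpSet id μ) ∩ interior (integrableExpSet id ν) with hI
  have hIc : Convex ℝ I := convex_integrableExpSet.interior.inter convex_integrableExpSet.interior
  set S : Set ℂ := Complex.re ⁻¹' I with hS
  have hSc : Convex ℝ S := hIc.linear_preimage Complex.reLm
  have h0 : (0 : ℂ) ∈ S := ⟨by simpa using hμ, by simpa using hν⟩
  have a1 : AnalyticOnNhd ℂ (complexMGF id μ) S := fun z hz => analyticAt_complexMGF hz.1
  have a2 : AnalyticOnNhd ℂ (complexMGF id ν) S := fun z hz => analyticAt_complexMGF hz.2
  have hder : ∀ n, iteratedDeriv n (complexMGF id μ) 0 = iteratedDeriv n (complexMGF id ν) 0 := by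
    intro n
    rw [iteratedDeriv_complexMGF (by simpa using hμ), iteratedDeriv_complexMGF (by simpa using hν)]
    have := congrArg (fun x : ℝ => (x : ℂ)) (h n)
    simp only [← integral_complex_ofReal] at this
    simpa using this
  have heq : complexMGF id μ =ᶠ[𝓝 0] complexMGF id ν := by
    have s1 := (a1 0 h0).hasFPowerSeriesAt.eventually_hasSum
    have s2 := (a2 0 h0).hasFPowerSeriesAt.eventually_hasSum
    simp only [zero_add] at s1 s2
    filter_upwards [s1, s2] with y h1 h2
    simp only [hder] at h1
    exact h1.unique h2
  have hEq := a1.eqOn_of_preconnected_of_eventuallyEq a2 hSc.isPreconnected h0 heq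
  refine Measure.ext_of_charFun (funext fun t => ?_)
  rw [← complexMGF_id_mul_I, ← complexMGF_id_mul_I]
  exact hEq ⟨by simpa using hμ, by simpa using hν⟩

lemma zero_mem_interior_integrableExpSet {Ω : Type*} [MeasurableSpace Ω] {μ : Measure Ω}
    {f : Ω → ℝ} (hf : AEMeasurable f μ) {ε : ℝ} (hε : 0 < ε)
    (h : Integrable (fun ω => Real.exp (ε * |f ω|)) μ) :
    0 ∈ interior (integrableExpSet f μ) := by
  rw [mem_interior]
  refine ⟨Set.Ioo (-ε) ε, fun s hs => ?_, isOpen_Ioo, by simp [hε]⟩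
  refine h.mono' (hf.const_mul s).exp.aestronglyMeasurable (Eventually.of_forall fun ω => ?_)
  rw [Real.norm_of_nonneg (Real.exp_pos _).le, Real.exp_le_exp]
  calc s * f ω ≤ |s * f ω| := le_abs_self _
    _ = |s| * |f ω| := abs_mul _ _
    _ ≤ ε * |f ω| := mul_le_mul_of_nonneg_right (abs_lt.2 hs).le (abs_nonneg _)

/-- Two distributions of nonnegative random vectors agree if their mixed moments agree, and the
moments of the coordinates do not grow too fast. -/
theorem ext_of_moments {ι : Type*} [Fintype ι] {μ ν : Measure (ι → ℝ)} [IsProbabilityMeasure μ]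
    [IsProbabilityMeasure ν] (hμ0 : ∀ᵐ z ∂μ, ∀ i, 0 ≤ z i) (hν0 : ∀ᵐ z ∂ν, ∀ i, 0 ≤ z i)
    (hμ : ∀ n : ι → ℕ, Integrable (fun z => ∏ i, z i ^ n i) μ)
    (hν : ∀ n : ι → ℕ, Integrable (fun z => ∏ i, z i ^ n i) ν)
    (h : ∀ n : ι → ℕ, ∫ z, ∏ i, z i ^ n i ∂μ = ∫ z, ∏ i, z i ^ n i ∂ν)
    {C b : ℝ} (hb : 0 ≤ b) (hle : ∀ i, ∀ p : ℕ, ∫ z, z i ^ p ∂μ ≤ C * b ^ p * p.factorial) :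
    μ = ν := by
  classical
  have hsingle : ∀ (i : ι) (p : ℕ) (z : ι → ℝ), ∏ j, z j ^ (Pi.single i p : ι → ℕ) j = z i ^ p := by
    intro i p z
    rw [Finset.prod_eq_single i]
    · simp
    · intro j _ hj; simp [hj]
    · simp
  have hexp : ∀ {ρ : Measure (ι → ℝ)}, (∀ᵐ z ∂ρ, ∀ i, 0 ≤ z i) →
      (∀ n : ι → ℕ, Integrable (fun z => ∏ i, z i ^ n i) ρ) →
      (∀ i, ∀ p : ℕ, ∫ z, z i ^ p ∂ρ ≤ C * b ^ p * p.factorial) →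
      ∀ i, Integrable (fun z => Real.exp ((b + 1)⁻¹ * |z i|)) ρ := by
    intro ρ h0 h1 h2 i
    have := integrable_exp_of_moments_le (μ := ρ) (f := fun z => z i)
      (measurable_pi_apply i).aemeasurable (h0.mono fun z hz => hz i)
      (fun p => by simpa only [hsingle] using h1 (Pi.single i p)) (h2 i) (ε := (b + 1)⁻¹)
      (by positivity) hb (by rw [inv_mul_lt_iff₀ (by positivity)]; linarith)
    refine this.congr ?_
    filter_upwards [h0] with z hz
    rw [abs_of_nonneg (hz i)]
  have hle' : ∀ i, ∀ p : ℕ, ∫ z, z i ^ p ∂ν ≤ C * b ^ p * p.factorial := by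
    intro i p
    have := h (Pi.single i p)
    simp only [hsingle] at this
    rw [← this]
    exact hle i p
  have eμ := hexp hμ0 hμ hle
  have eν := hexp hν0 hν hle'
  -- By the Cramér–Wold device it suffices to compare the laws of the linear functionals `L`; their
  -- moments are combinations of mixed moments.
  refine Measure.ext_of_charFunDual (funext fun L => ?_)
  rw [charFunDual_eq_charFun_map_one, charFunDual_eq_charFun_map_one]
  congr 1
  set c : ι → ℝ := fun i => L (Pi.single i 1) with hc
  have hL : ∀ z, L z = ∑ i, c i * z i := by
    intro z
    conv_lhs => rw [← Finset.univ_sum_single z]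
    rw [map_sum]
    refine Finset.sum_congr rfl fun i _ => ?_
    rw [hc, mul_comm, ← smul_eq_mul, ← map_smul, ← Pi.single_smul, smul_eq_mul, mul_one]
  -- Any positive `A` with `|L z| ≤ A * max |z i|` serves; the exponential of a maximum is bounded
  -- by the sum of the exponentials.
  set A : ℝ := (∑ i, |c i|) * Fintype.card ι + 1 with hA
  have hA0 : 0 < A := by positivity
  have hLint : ∀ {ρ : Measure (ι → ℝ)} [IsProbabilityMeasure ρ],
      (∀ i, Integrable (fun z => Real.exp ((b + 1)⁻¹ * |z i|)) ρ) →
      0 ∈ interior (integrableExpSet id (ρ.map L)) := by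
    intro ρ _ hρ
    refine zero_mem_interior_integrableExpSet aemeasurable_id (ε := (b + 1)⁻¹ * A⁻¹)
      (by positivity) ?_
    rw [integrable_map_measure (by fun_prop) (by fun_prop)]
    refine ((integrable_finsetSum Finset.univ fun i _ => hρ i).add (integrable_const 1)).mono'
      (Measurable.aestronglyMeasurable (by fun_prop)) (Eventually.of_forall fun z => ?_)
    simp only [Function.comp, id, Pi.add_apply]
    rw [Real.norm_of_nonneg (Real.exp_pos _).le]
    rcases isEmpty_or_nonempty ι with hι | hι
    · simp [hL]
    obtain ⟨i₀, -, hi₀⟩ := Finset.exists_max_image Finset.univ (fun i => |z i|)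
      Finset.univ_nonempty
    have h1 : |L z| ≤ A * |z i₀| := by
      rw [hL]
      calc |∑ i, c i * z i| ≤ ∑ i, |c i * z i| := Finset.abs_sum_le_sum_abs _ _
        _ ≤ ∑ i, |c i| * |z i₀| := Finset.sum_le_sum fun i hi => by
            rw [abs_mul]; exact mul_le_mul_of_nonneg_left (hi₀ i hi) (abs_nonneg _)
        _ = (∑ i, |c i|) * 1 * |z i₀| := by rw [mul_one, Finset.sum_mul]
        _ ≤ A * |z i₀| := by
            refine mul_le_mul_of_nonneg_right ?_ (abs_nonneg _)
            have h2 : (1 : ℝ) ≤ Fintype.card ι := by exact_mod_cast Fintype.card_pos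
            have h3 : 0 ≤ ∑ i, |c i| := Finset.sum_nonneg fun i _ => abs_nonneg _
            nlinarith
    have h4 : (b + 1)⁻¹ * A⁻¹ * |L z| ≤ (b + 1)⁻¹ * |z i₀| := by
      rw [mul_assoc]
      refine mul_le_mul_of_nonneg_left ?_ (by positivity)
      rw [inv_mul_le_iff₀ hA0]; exact h1
    calc Real.exp ((b + 1)⁻¹ * A⁻¹ * |L z|) ≤ Real.exp ((b + 1)⁻¹ * |z i₀|) :=
          Real.exp_le_exp.2 h4
      _ ≤ ∑ i, Real.exp ((b + 1)⁻¹ * |z i|) := Finset.single_le_sum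
          (f := fun i => Real.exp ((b + 1)⁻¹ * |z i|)) (fun i _ => (Real.exp_pos _).le)
          (Finset.mem_univ i₀)
      _ ≤ _ := by simp
  have hpow : ∀ (p : ℕ) (z : ι → ℝ), L z ^ p = ∑ f : Fin p → ι, (∏ j, c (f j)) *
      ∏ i, z i ^ (Finset.univ.filter fun j => f j = i).card := by
    intro p z
    rw [hL, ← Fin.prod_const, Finset.prod_univ_sum, Fintype.piFinset_univ]
    refine Finset.sum_congr rfl fun f _ => ?_
    rw [Finset.prod_mul_distrib]
    congr 1
    rw [← Finset.prod_fiberwise Finset.univ f]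
    refine Finset.prod_congr rfl fun i _ => ?_
    rw [Finset.prod_congr rfl (g := fun _ => z i), Finset.prod_const]
    intro j hj
    rw [(Finset.mem_filter.1 hj).2]
  have : IsProbabilityMeasure (μ.map L) := Measure.isProbabilityMeasure_map (by fun_prop)
  have : IsProbabilityMeasure (ν.map L) := Measure.isProbabilityMeasure_map (by fun_prop)
  refine ext_of_moments_real (hLint eμ) (hLint eν) fun p => ?_
  rw [integral_map (by fun_prop) (by fun_prop), integral_map (by fun_prop) (by fun_prop)]
  simp only [hpow]
  rw [integral_finsetSum _ fun f _ => (hμ _).const_mul _,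
    integral_finsetSum _ fun f _ => (hν _).const_mul _]
  refine Finset.sum_congr rfl fun f _ => ?_
  rw [integral_const_mul, integral_const_mul, h]

/-- Two distributions on `[0, ∞)` agree if their moments agree and do not grow too fast. -/
lemma ext_of_moments_nonneg {μ ν : Measure ℝ} [IsProbabilityMeasure μ] [IsProbabilityMeasure ν]
    (hμ0 : ∀ᵐ x ∂μ, 0 ≤ x) (hν0 : ∀ᵐ x ∂ν, 0 ≤ x)
    (hμ : ∀ p : ℕ, Integrable (fun x => x ^ p) μ) (hν : ∀ p : ℕ, Integrable (fun x => x ^ p) ν)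
    (h : ∀ p : ℕ, ∫ x, x ^ p ∂μ = ∫ x, x ^ p ∂ν)
    {C b : ℝ} (hb : 0 ≤ b) (hle : ∀ p : ℕ, ∫ x, x ^ p ∂μ ≤ C * b ^ p * p.factorial) : μ = ν := by
  have hle' : ∀ p : ℕ, ∫ x, x ^ p ∂ν ≤ C * b ^ p * p.factorial := fun p => h p ▸ hle p
  have key : ∀ {ρ : Measure ℝ}, (∀ᵐ x ∂ρ, 0 ≤ x) → (∀ p : ℕ, Integrable (fun x => x ^ p) ρ) →
      (∀ p : ℕ, ∫ x, x ^ p ∂ρ ≤ C * b ^ p * p.factorial) →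
      0 ∈ interior (integrableExpSet id ρ) := by
    intro ρ h0 h1 h2
    refine zero_mem_interior_integrableExpSet aemeasurable_id (ε := (b + 1)⁻¹) (by positivity) ?_
    refine (integrable_exp_of_moments_le aemeasurable_id h0 h1 h2 (ε := (b + 1)⁻¹)
      (by positivity) hb (by rw [inv_mul_lt_iff₀ (by positivity)]; linarith)).congr ?_
    filter_upwards [h0] with x hx
    simp [abs_of_nonneg hx]
  exact ext_of_moments_real (key hμ0 hμ hle) (key hν0 hν hle') h

lemma rising_le {x : ℝ} (hx : 0 ≤ x) (p : ℕ) : rising x p ≤ (x + 1) ^ p * p.factorial := by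
  induction p with
  | zero => simp [rising_zero]
  | succ p ih =>
    rw [rising_succ, Nat.factorial_succ, pow_succ]
    push_cast
    calc rising x p * (x + p) ≤ ((x + 1) ^ p * p.factorial) * ((x + 1) * (p + 1)) := by
          refine mul_le_mul ih ?_ (by positivity) (by positivity)
          have : (0 : ℝ) ≤ p := Nat.cast_nonneg p
          nlinarith
      _ = _ := by ring

lemma gamma_add_nat {x : ℝ} (hx : 0 < x) (p : ℕ) :
    Real.Gamma (x + p) = rising x p * Real.Gamma x := by
  induction p with
  | zero => simp [rising_zero]
  | succ p ih =>
    rw [rising_succ, Nat.cast_succ, ← add_assoc, Real.Gamma_add_one (by positivity), ih]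
    ring

/-- A crude constant, enough to bound moments with a Gamma function in the denominator: `Γ ≥ 1` on
`[2, ∞)`, and for `x ≤ 2` one has `Γ(x + 2) = x (x + 1) Γ(x)` with `x (x + 1) ≤ 6`. -/
lemma gamma_lower_bound {x : ℝ} (hx : 0 < x) : 1 / 6 ≤ Real.Gamma x := by
  have hmono : ∀ y : ℝ, 2 ≤ y → 1 ≤ Real.Gamma y := by
    intro y hy
    have := Real.Gamma_strictMonoOn_Ici.monotoneOn (Set.mem_Ici.2 le_rfl) (Set.mem_Ici.2 hy) hy
    rwa [Real.Gamma_two] at this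
  rcases le_total 2 x with h | h
  · linarith [hmono x h]
  · have h1 := hmono (x + 2) (by linarith)
    have h2 := gamma_add_nat hx 2
    simp only [rising, Finset.prod_range_succ, Finset.prod_range_zero] at h2
    push_cast at h2
    rw [h2] at h1
    have h3 := Real.Gamma_pos_of_pos hx
    have h4 : 1 * (x + 0) * (x + 1) ≤ 6 := by nlinarith
    nlinarith

/-! ### Moments of gamma, beta and Dirichlet distributions -/

lemma lintegral_fin_prod_eq_prod {d : ℕ} (f : Fin d → ℝ → ℝ≥0∞) (hf : ∀ i, Measurable (f i)) :
    ∫⁻ x : Fin d → ℝ, ∏ i, f i (x i) = ∏ i, ∫⁻ u, f i u := by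
  induction d with
  | zero => simp [volume_pi, Measure.pi_of_empty (fun _ : Fin 0 => (volume : Measure ℝ))]
  | succ d ih =>
    rw [← ((volume_preserving_piFinSuccAbove (fun _ : Fin (d + 1) => ℝ) 0).symm).lintegral_comp_emb
      (MeasurableEquiv.measurableEmbedding _)]
    simp_rw [MeasurableEquiv.piFinSuccAbove_symm_apply, Fin.insertNthEquiv,
      Fin.prod_univ_succ, Fin.insertNth_zero, Equiv.coe_fn_mk, Fin.cons_succ, Fin.cons_zero]
    rw [← ih (fun i : Fin d => f i.succ) fun i : Fin d => hf i.succ]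
    exact lintegral_prod_mul (hf 0).aemeasurable (Finset.measurable_prod _ fun (i : Fin d) _ =>
      (hf i.succ).comp (measurable_pi_apply i)).aemeasurable

/-- The density `u ^ (a - 1)` on `(0, ∞)`. -/
noncomputable def powerWeight (a u : ℝ) : ℝ≥0∞ :=
  if 0 < u then ENNReal.ofReal (u ^ (a - 1)) else 0

@[fun_prop]
lemma measurable_powerWeight (a : ℝ) : Measurable (powerWeight a) :=
  Measurable.ite measurableSet_Ioi (by fun_prop) measurable_const

lemma powerWeight_mul (a : ℝ) {s : ℝ} (hs : 0 < s) (u : ℝ) :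
    powerWeight a (s * u) = ENNReal.ofReal (s ^ (a - 1)) * powerWeight a u := by
  simp only [powerWeight, mul_pos_iff_of_pos_left hs]
  split_ifs with h
  · rw [Real.mul_rpow hs.le h.le, ENNReal.ofReal_mul (by positivity)]
  · simp

lemma lintegral_exp_neg_mul_powerWeight {a : ℝ} (ha : 0 < a) :
    ∫⁻ u, ENNReal.ofReal (Real.exp (-u)) * powerWeight a u = ENNReal.ofReal (Real.Gamma a) := by
  have hG := Real.Gamma_pos_of_pos ha
  have h1 := lintegral_gammaPDF_eq_one ha one_pos
  have h2 : ∀ᵐ u : ℝ, ENNReal.ofReal (Real.exp (-u)) * powerWeight a u =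
      ENNReal.ofReal (Real.Gamma a) * gammaPDF a 1 u := by
    filter_upwards [compl_mem_ae_iff.2 (measure_singleton (0 : ℝ))] with u hu
    rcases lt_or_gt_of_ne (show u ≠ 0 from hu) with h | h
    · rw [gammaPDF_of_neg h, powerWeight, if_neg h.not_gt]; simp
    · rw [gammaPDF_of_nonneg h.le, powerWeight, if_pos h, ← ENNReal.ofReal_mul (by positivity),
        ← ENNReal.ofReal_mul hG.le]
      congr 1
      rw [Real.one_rpow, one_mul]
      field_simp
  rw [lintegral_congr_ae h2, lintegral_const_mul' _ _ ENNReal.ofReal_ne_top, h1, mul_one]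

lemma lintegral_rpow_gammaMeasure {a r : ℝ} (ha : 0 < a) (har : 0 < a + r) :
    ∫⁻ u, ENNReal.ofReal (u ^ r) ∂gammaMeasure a 1 =
      ENNReal.ofReal (Real.Gamma (a + r) / Real.Gamma a) := by
  have hG := Real.Gamma_pos_of_pos ha
  have hG' := Real.Gamma_pos_of_pos har
  have hm : Measurable (gammaPDF a 1) := (measurable_gammaPDFReal a 1).ennreal_ofReal
  rw [gammaMeasure, lintegral_withDensity_eq_lintegral_mul _ hm (by fun_prop),
    ← mul_one (ENNReal.ofReal _), ← lintegral_gammaPDF_eq_one har one_pos,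
    ← lintegral_const_mul' _ _ ENNReal.ofReal_ne_top]
  refine lintegral_congr_ae ?_
  filter_upwards [compl_mem_ae_iff.2 (measure_singleton (0 : ℝ))] with u hu
  rw [Pi.mul_apply]
  rcases lt_or_gt_of_ne (show u ≠ 0 from hu) with h | h
  · rw [gammaPDF_of_neg h, gammaPDF_of_neg h]; simp
  · rw [gammaPDF_of_nonneg h.le, gammaPDF_of_nonneg h.le, ← ENNReal.ofReal_mul (by positivity),
      ← ENNReal.ofReal_mul (by positivity)]
    congr 1
    rw [Real.one_rpow, Real.one_rpow, show a + r - 1 = (a - 1) + r by ring, Real.rpow_add h]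
    field_simp

lemma ae_pos_gammaMeasure (a : ℝ) : ∀ᵐ u ∂gammaMeasure a 1, 0 < u := by
  have hm : Measurable (gammaPDF a 1) := (measurable_gammaPDFReal a 1).ennreal_ofReal
  rw [gammaMeasure, ae_withDensity_iff hm]
  filter_upwards [compl_mem_ae_iff.2 (measure_singleton (0 : ℝ))] with u hu h
  by_contra hneg
  exact h (gammaPDF_of_neg (lt_of_le_of_ne (not_lt.1 hneg) hu))

lemma measurable_betaPDF (a b : ℝ) : Measurable (betaPDF a b) :=
  (measurable_betaPDFReal a b).ennreal_ofReal

/-- Weighting the beta density by `w ^ r` gives a multiple of the density with first parameter `a +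
r`. The unit mass for `b = 0` fits the same formula. -/
lemma lintegral_rpow_betaLaw {a b r : ℝ} (ha : 0 < a) (hb : 0 ≤ b) (hr : 0 ≤ r) :
    ∫⁻ w, ENNReal.ofReal (w ^ r) ∂betaLaw a b = ENNReal.ofReal
      (Real.Gamma (a + r) * Real.Gamma (a + b) / (Real.Gamma a * Real.Gamma (a + b + r))) := by
  have har : 0 < a + r := by linarith
  have h1 := Real.Gamma_pos_of_pos ha
  have h2 := Real.Gamma_pos_of_pos har
  rcases hb.eq_or_lt with rfl | hb
  · rw [betaLaw, if_pos rfl, lintegral_dirac, add_zero, Real.one_rpow]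
    congr 1
    field_simp
  have h3 := Real.Gamma_pos_of_pos hb
  have h4 := Real.Gamma_pos_of_pos (add_pos ha hb)
  have h5 := Real.Gamma_pos_of_pos (add_pos har hb)
  rw [betaLaw, if_neg hb.ne', betaMeasure, lintegral_withDensity_eq_lintegral_mul _
    (measurable_betaPDF a b) (by fun_prop), ← mul_one (ENNReal.ofReal _),
    ← lintegral_betaPDF_eq_one har hb, ← lintegral_const_mul' _ _ ENNReal.ofReal_ne_top]
  refine lintegral_congr fun w => ?_
  rw [Pi.mul_apply]
  by_cases h : 0 < w ∧ w < 1
  · have hw := h.1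
    have hw' : 0 < 1 - w := by linarith [h.2]
    rw [betaPDF_of_pos_lt_one h.1 h.2, betaPDF_of_pos_lt_one h.1 h.2]
    have hB1 := beta_pos ha hb
    have hB2 := beta_pos har hb
    rw [← ENNReal.ofReal_mul (by positivity), ← ENNReal.ofReal_mul (by positivity)]
    congr 1
    rw [show a + r - 1 = (a - 1) + r by ring, Real.rpow_add hw, beta, beta,
      show a + b + r = a + r + b by ring]
    field_simp
  · rw [betaPDF, betaPDF, betaPDFReal, betaPDFReal, if_neg h, if_neg h]; simp

lemma isProbabilityMeasure_betaLaw {a b : ℝ} (ha : 0 < a) (hb : 0 ≤ b) :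
    IsProbabilityMeasure (betaLaw a b) := by
  rcases hb.eq_or_lt with rfl | hb
  · rw [betaLaw, if_pos rfl]; infer_instance
  · rw [betaLaw, if_neg hb.ne']; exact isProbabilityMeasureBeta ha hb

lemma ae_pos_betaLaw (a b : ℝ) : ∀ᵐ w ∂betaLaw a b, 0 < w := by
  rw [betaLaw]
  split_ifs with h
  · rw [ae_dirac_iff measurableSet_Ioi]; exact one_pos
  · rw [betaMeasure, ae_withDensity_iff (measurable_betaPDF a b)]
    refine Eventually.of_forall fun u hu => ?_
    by_contra hneg
    exact hu (betaPDF_eq_zero_of_nonpos (not_lt.1 hneg))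

/-! ### Dirichlet integrals on the simplex -/

section Dirichlet

variable {d : ℕ}

lemma simplexPoint_castSucc (x : Fin d → ℝ) (j : Fin d) :
    simplexPoint (m := d + 1) x j.castSucc = x j := by
  have h : ((j.castSucc : Fin (d + 1)) : ℕ) < d + 1 - 1 := j.2
  rw [simplexPoint, dif_pos h]
  rfl

lemma simplexPoint_last (x : Fin d → ℝ) :
    simplexPoint (m := d + 1) x (Fin.last d) = 1 - ∑ j, x j := by
  have h : ¬ ((Fin.last d : Fin (d + 1)) : ℕ) < d + 1 - 1 := by simp
  rw [simplexPoint, dif_neg h]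
  rfl

lemma sum_simplexPoint (x : Fin d → ℝ) : ∑ i, simplexPoint (m := d + 1) x i = 1 := by
  rw [Fin.sum_univ_castSucc, simplexPoint_last]
  simp only [simplexPoint_castSucc]
  ring

lemma measurable_simplexPoint : Measurable (simplexPoint (m := d + 1)) := by
  refine measurable_pi_iff.2 fun i => ?_
  refine Fin.lastCases ?_ (fun j => ?_) i
  · change Measurable fun x : Fin d → ℝ => simplexPoint (m := d + 1) x (Fin.last d)
    simp only [simplexPoint_last]
    fun_prop
  · change Measurable fun x : Fin d → ℝ => simplexPoint (m := d + 1) x j.castSucc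
    simp only [simplexPoint_castSucc]
    fun_prop

/-- The integrand of the multivariate beta integral on the simplex of size `s`. -/
noncomputable def simplexWeight (a : Fin (d + 1) → ℝ) (s : ℝ) (x : Fin d → ℝ) : ℝ≥0∞ :=
  (∏ j, powerWeight (a (Fin.castSucc j)) (x j)) * powerWeight (a (Fin.last d)) (s - ∑ j, x j)

@[fun_prop]
lemma measurable_simplexWeight (a : Fin (d + 1) → ℝ) :
    Measurable (Function.uncurry (simplexWeight a)) := by
  unfold simplexWeight Function.uncurry
  fun_prop

lemma dirichletWeight_eq (a : Fin (d + 1) → ℝ) :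
    dirichletWeight a = (volume : Measure (Fin d → ℝ)).withDensity (simplexWeight a 1) := by
  unfold dirichletWeight
  congr 1
  funext x
  rw [simplexWeight, ← simplexPoint_last]
  simp only [← simplexPoint_castSucc (d := d) x]
  rw [← Fin.prod_univ_castSucc (f := fun i => powerWeight (a i) (simplexPoint (m := d + 1) x i))]
  split_ifs with h
  · rw [ENNReal.ofReal_prod_of_nonneg fun i _ => Real.rpow_nonneg (h i).le _]
    refine Finset.prod_congr rfl fun i _ => ?_
    rw [powerWeight, if_pos (h i)]
  · push Not at h
    obtain ⟨i, hi⟩ := h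
    refine (Finset.prod_eq_zero (Finset.mem_univ i) ?_).symm
    rw [powerWeight, if_neg hi.not_gt]

lemma simplexWeight_smul (a : Fin (d + 1) → ℝ) {s : ℝ} (hs : 0 < s) (x : Fin d → ℝ) :
    simplexWeight a s (s • x) = ENNReal.ofReal (s ^ (∑ i, a i - (d + 1))) * simplexWeight a 1 x := by
  have h1 : s - ∑ j, (s • x) j = s * (1 - ∑ j, x j) := by
    simp only [Pi.smul_apply, smul_eq_mul, ← Finset.mul_sum]; ring
  rw [simplexWeight, simplexWeight, h1, powerWeight_mul _ hs]
  simp only [Pi.smul_apply, smul_eq_mul, powerWeight_mul _ hs, Finset.prod_mul_distrib]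
  have h2 : (∏ j : Fin d, ENNReal.ofReal (s ^ (a j.castSucc - 1))) *
      ENNReal.ofReal (s ^ (a (Fin.last d) - 1)) = ENNReal.ofReal (s ^ (∑ i, a i - (d + 1))) := by
    rw [← Fin.prod_univ_castSucc (f := fun i => ENNReal.ofReal (s ^ (a i - 1))),
      ← ENNReal.ofReal_prod_of_nonneg fun i _ => Real.rpow_nonneg hs.le _,
      ← Real.rpow_sum_of_pos hs]
    congr 2
    simp
  rw [← h2]
  ring

/-- Scaling by `s` maps the unit simplex to the simplex of size `s`. For `s ≤ 0` some factor of the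
integrand vanishes at every point. -/
lemma lintegral_simplexWeight (a : Fin (d + 1) → ℝ) (s : ℝ) :
    ∫⁻ x, simplexWeight a s x = powerWeight (∑ i, a i) s * ∫⁻ x, simplexWeight a 1 x := by
  rcases le_or_gt s 0 with hs | hs
  · rw [powerWeight, if_neg hs.not_gt, zero_mul, lintegral_eq_zero_iff (by fun_prop)]
    refine Eventually.of_forall fun x => ?_
    by_cases hx : ∀ j, 0 < x j
    · have h : ¬ 0 < s - ∑ j, x j := by
        have := Finset.sum_nonneg fun j (_ : j ∈ Finset.univ) => (hx j).le
        linarith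
      rw [simplexWeight, powerWeight, if_neg h]; simp
    · push Not at hx
      obtain ⟨j, hj⟩ := hx
      rw [simplexWeight, Finset.prod_eq_zero (Finset.mem_univ j)]
      · simp
      · rw [powerWeight, if_neg hj.not_gt]
  · have hms : Measurable (simplexWeight a s) := by fun_prop
    have h1 := lintegral_map (μ := (volume : Measure (Fin d → ℝ))) hms
      (measurable_const_smul (α := Fin d → ℝ) s)
    rw [Measure.map_addHaar_smul _ hs.ne', lintegral_smul_measure, Module.finrank_fin_fun] at h1
    simp only [simplexWeight_smul a hs] at h1
    rw [lintegral_const_mul' _ _ ENNReal.ofReal_ne_top, smul_eq_mul] at h1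
    have hd : (0 : ℝ) < s ^ d := by positivity
    have h2 := congrArg (ENNReal.ofReal (s ^ d) * ·) h1
    simp only [← mul_assoc] at h2
    rw [← ENNReal.ofReal_mul hd.le, abs_of_pos (inv_pos.2 hd), mul_inv_cancel₀ hd.ne',
      ENNReal.ofReal_one, one_mul, ← ENNReal.ofReal_mul hd.le, ← Real.rpow_natCast,
      ← Real.rpow_add hs] at h2
    rw [h2, powerWeight, if_pos hs]
    congr 3
    ring

/-- The integrand is the unnormalized density of independent gamma variables in terms of their sum
`s`. Exchanging the integrals and translating `s` makes it a product; together with the scaling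
relation this yields the Dirichlet normalization. -/
lemma lintegral_exp_mul_simplexWeight {a : Fin (d + 1) → ℝ} (ha : ∀ i, 0 < a i) :
    ∫⁻ s, ENNReal.ofReal (Real.exp (-s)) * ∫⁻ x, simplexWeight a s x =
      ENNReal.ofReal (∏ i, Real.Gamma (a i)) := by
  have h0 : ∀ s, ENNReal.ofReal (Real.exp (-s)) * ∫⁻ x, simplexWeight a s x =
      ∫⁻ x, ENNReal.ofReal (Real.exp (-s)) * simplexWeight a s x := fun s =>
    (lintegral_const_mul' _ _ ENNReal.ofReal_ne_top).symm
  simp only [h0]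
  rw [lintegral_lintegral_swap]
  · have h1 : ∀ x : Fin d → ℝ, ∫⁻ s, ENNReal.ofReal (Real.exp (-s)) * simplexWeight a s x =
        (∏ j, ENNReal.ofReal (Real.exp (-x j)) * powerWeight (a (Fin.castSucc j)) (x j)) *
          ENNReal.ofReal (Real.Gamma (a (Fin.last d))) := by
      intro x
      rw [← lintegral_exp_neg_mul_powerWeight (ha _), ← lintegral_sub_right_eq_self
        (fun u => ENNReal.ofReal (Real.exp (-u)) * powerWeight (a (Fin.last d)) u) (∑ j, x j),
        ← lintegral_const_mul _ (by fun_prop)]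
      refine lintegral_congr fun s => ?_
      rw [Finset.prod_mul_distrib, ← ENNReal.ofReal_prod_of_nonneg fun i _ => (Real.exp_pos _).le,
        ← Real.exp_sum, simplexWeight]
      have h2 : Real.exp (-s) = Real.exp (∑ j, -x j) * Real.exp (-(s - ∑ j, x j)) := by
        rw [← Real.exp_add, Finset.sum_neg_distrib]; congr 1; ring
      rw [h2, ENNReal.ofReal_mul (Real.exp_pos _).le]
      ring
    simp only [h1]
    rw [lintegral_mul_const' _ _ ENNReal.ofReal_ne_top, lintegral_fin_prod_eq_prod
      (fun j u => ENNReal.ofReal (Real.exp (-u)) * powerWeight (a (Fin.castSucc j)) u)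
      (fun j => by fun_prop), Fin.prod_univ_castSucc, ENNReal.ofReal_mul,
      ENNReal.ofReal_prod_of_nonneg]
    · congr 1
      exact Finset.prod_congr rfl fun j _ => lintegral_exp_neg_mul_powerWeight (ha _)
    · exact fun j _ => (Real.Gamma_pos_of_pos (ha _)).le
    · exact Finset.prod_nonneg fun j _ => (Real.Gamma_pos_of_pos (ha _)).le
  · have := measurable_simplexWeight a
    exact (Measurable.mul (by fun_prop) this).aemeasurable

lemma dirichletWeight_univ {a : Fin (d + 1) → ℝ} (ha : ∀ i, 0 < a i) :
    dirichletWeight a Set.univ =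
      ENNReal.ofReal ((∏ i, Real.Gamma (a i)) / Real.Gamma (∑ i, a i)) := by
  have hA : 0 < ∑ i, a i := Finset.sum_pos (fun i _ => ha i) Finset.univ_nonempty
  have hG := Real.Gamma_pos_of_pos hA
  have h1 := lintegral_exp_mul_simplexWeight ha
  rw [lintegral_congr fun s => by rw [lintegral_simplexWeight a s, ← mul_assoc]] at h1
  rw [lintegral_mul_const _ (by fun_prop), lintegral_exp_neg_mul_powerWeight hA] at h1
  rw [dirichletWeight_eq, withDensity_apply _ MeasurableSet.univ, Measure.restrict_univ,
    ENNReal.ofReal_div_of_pos hG, ← h1, mul_comm, ENNReal.mul_div_cancel_right]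
  · simpa using hG
  · exact ENNReal.ofReal_ne_top

lemma isProbabilityMeasure_dirichletLaw {a : Fin (d + 1) → ℝ} (ha : ∀ i, 0 < a i) :
    IsProbabilityMeasure (dirichletLaw a) := by
  have hA : 0 < ∑ i, a i := Finset.sum_pos (fun i _ => ha i) Finset.univ_nonempty
  have hp : 0 < (∏ i, Real.Gamma (a i)) / Real.Gamma (∑ i, a i) :=
    div_pos (Finset.prod_pos fun i _ => Real.Gamma_pos_of_pos (ha i)) (Real.Gamma_pos_of_pos hA)
  have h := dirichletWeight_univ ha
  have : IsProbabilityMeasure ((dirichletWeight a Set.univ)⁻¹ • dirichletWeight a) := by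
    constructor
    rw [Measure.smul_apply, smul_eq_mul, ENNReal.inv_mul_cancel]
    · rw [h]; simpa using hp
    · rw [h]; exact ENNReal.ofReal_ne_top
  exact Measure.isProbabilityMeasure_map measurable_simplexPoint.aemeasurable

lemma simplexWeight_ne_zero {a : Fin (d + 1) → ℝ} {x : Fin d → ℝ} (h : simplexWeight a 1 x ≠ 0)
    (i : Fin (d + 1)) : 0 < simplexPoint (m := d + 1) x i := by
  by_contra hi
  apply h
  rw [simplexWeight, ← simplexPoint_last]
  simp only [← simplexPoint_castSucc (d := d) x]
  rw [← Fin.prod_univ_castSucc (f := fun i => powerWeight (a i) (simplexPoint (m := d + 1) x i))]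
  exact Finset.prod_eq_zero (Finset.mem_univ i) (by rw [powerWeight, if_neg hi])

lemma ae_dirichletLaw (a : Fin (d + 1) → ℝ) :
    ∀ᵐ z ∂dirichletLaw a, (∀ i, 0 < z i) ∧ ∑ i, z i = 1 := by
  have hS : MeasurableSet {z : Fin (d + 1) → ℝ | (∀ i, 0 < z i) ∧ ∑ i, z i = 1} := by
    refine MeasurableSet.inter ?_ ?_
    · have : {z : Fin (d + 1) → ℝ | ∀ i, 0 < z i} = ⋂ i, {z | 0 < z i} := by ext; simp
      change MeasurableSet {z : Fin (d + 1) → ℝ | ∀ i, 0 < z i}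
      rw [this]
      exact MeasurableSet.iInter fun i => measurableSet_lt measurable_const (measurable_pi_apply i)
    · exact measurableSet_eq_fun (by fun_prop) measurable_const
  rw [dirichletLaw, ae_map_iff measurable_simplexPoint.aemeasurable hS]
  refine Measure.ae_smul_measure ?_ _
  rw [dirichletWeight_eq, ae_withDensity_iff (by fun_prop)]
  exact Eventually.of_forall fun x hx => ⟨simplexWeight_ne_zero hx, sum_simplexPoint x⟩

lemma lintegral_prod_pow_dirichletLaw {a : Fin (d + 1) → ℝ} (ha : ∀ i, 0 < a i)
    (p : Fin (d + 1) → ℕ) : ∫⁻ z, ENNReal.ofReal (∏ i, z i ^ p i) ∂dirichletLaw a =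
      ENNReal.ofReal ((∏ i, rising (a i) (p i)) *
        (Real.Gamma (∑ i, a i) / Real.Gamma (∑ i, a i + ∑ i, (p i : ℝ)))) := by
  have hA : 0 < ∑ i, a i := Finset.sum_pos (fun i _ => ha i) Finset.univ_nonempty
  have hap : ∀ i, 0 < a i + p i := fun i => by have := ha i; positivity
  have hp : 0 < (∏ i, Real.Gamma (a i)) / Real.Gamma (∑ i, a i) :=
    div_pos (Finset.prod_pos fun i _ => Real.Gamma_pos_of_pos (ha i)) (Real.Gamma_pos_of_pos hA)
  rw [dirichletLaw, lintegral_map (by fun_prop) measurable_simplexPoint, lintegral_smul_measure]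
  -- Multiplying by a monomial raises the parameters, so the moment is a quotient of two
  -- normalizations.
  have h1 : ∫⁻ x, ENNReal.ofReal (∏ i, simplexPoint (m := d + 1) x i ^ p i) ∂dirichletWeight a =
      dirichletWeight (fun i => a i + p i) Set.univ := by
    rw [dirichletWeight_eq, dirichletWeight_eq, withDensity_apply _ MeasurableSet.univ,
      Measure.restrict_univ, lintegral_withDensity_eq_lintegral_mul _ (by fun_prop)
      (by have := measurable_simplexPoint (d := d); fun_prop)]
    refine lintegral_congr fun x => ?_
    rw [Pi.mul_apply]
    by_cases hx : ∀ i, 0 < simplexPoint (m := d + 1) x i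
    · rw [simplexWeight, simplexWeight, ← simplexPoint_last]
      simp only [← simplexPoint_castSucc (d := d) x]
      rw [← Fin.prod_univ_castSucc
        (f := fun i => powerWeight (a i) (simplexPoint (m := d + 1) x i)),
        ← Fin.prod_univ_castSucc
        (f := fun i => powerWeight (a i + p i) (simplexPoint (m := d + 1) x i)),
        ENNReal.ofReal_prod_of_nonneg fun i _ => pow_nonneg (hx i).le _, ← Finset.prod_mul_distrib]
      refine Finset.prod_congr rfl fun i _ => ?_
      rw [powerWeight, powerWeight, if_pos (hx i), if_pos (hx i),
        ← ENNReal.ofReal_mul (Real.rpow_nonneg (hx i).le _), ← Real.rpow_natCast,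
        ← Real.rpow_add (hx i)]
      congr 2
      ring
    · have h2 : ∀ b : Fin (d + 1) → ℝ, simplexWeight b 1 x = 0 := fun b => by
        by_contra h; exact hx (simplexWeight_ne_zero h)
      rw [h2, h2, zero_mul]
  rw [h1, dirichletWeight_univ ha, dirichletWeight_univ hap, smul_eq_mul,
    ← ENNReal.ofReal_inv_of_pos hp, ← ENNReal.ofReal_mul (inv_nonneg.2 hp.le)]
  congr 1
  simp only [gamma_add_nat (ha _), Finset.prod_mul_distrib, Finset.sum_add_distrib]
  have h3 : ∏ i, Real.Gamma (a i) ≠ 0 :=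
    (Finset.prod_pos fun i _ => Real.Gamma_pos_of_pos (ha i)).ne'
  field_simp

end Dirichlet

/-! ### The Mittag-Leffler distribution -/

lemma integrable_and_integral_eq_of_lintegral {E : Type*} [MeasurableSpace E] {μ : Measure E}
    {f : E → ℝ} (hf : AEStronglyMeasurable f μ) (h0 : 0 ≤ᵐ[μ] f) {c : ℝ} (hc : 0 ≤ c)
    (h : ∫⁻ x, ENNReal.ofReal (f x) ∂μ = ENNReal.ofReal c) : Integrable f μ ∧ ∫ x, f x ∂μ = c := by
  refine ⟨(lintegral_ofReal_ne_top_iff_integrable hf h0).1 (h ▸ ENNReal.ofReal_ne_top), ?_⟩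
  rw [integral_eq_lintegral_of_nonneg_ae h0 hf, h, ENNReal.toReal_ofReal hc]

lemma ext_of_lintegral_pow {μ ν : Measure ℝ} [IsProbabilityMeasure μ] [IsProbabilityMeasure ν]
    (hμ0 : ∀ᵐ x ∂μ, 0 ≤ x) (hν0 : ∀ᵐ x ∂ν, 0 ≤ x) {c : ℕ → ℝ} (hc : ∀ p, 0 ≤ c p)
    (hμ : ∀ p : ℕ, ∫⁻ x, ENNReal.ofReal (x ^ p) ∂μ = ENNReal.ofReal (c p))
    (hν : ∀ p : ℕ, ∫⁻ x, ENNReal.ofReal (x ^ p) ∂ν = ENNReal.ofReal (c p))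
    {C b : ℝ} (hb : 0 ≤ b) (hle : ∀ p : ℕ, c p ≤ C * b ^ p * p.factorial) : μ = ν := by
  have h1 := fun p => integrable_and_integral_eq_of_lintegral (μ := μ) (f := fun x => x ^ p)
    (by fun_prop) (by filter_upwards [hμ0] with x hx using pow_nonneg hx p) (hc p) (hμ p)
  have h2 := fun p => integrable_and_integral_eq_of_lintegral (μ := ν) (f := fun x => x ^ p)
    (by fun_prop) (by filter_upwards [hν0] with x hx using pow_nonneg hx p) (hc p) (hν p)
  exact ext_of_moments_nonneg hμ0 hν0 (fun p => (h1 p).1) (fun p => (h2 p).1)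
    (fun p => (h1 p).2.trans (h2 p).2.symm) hb (fun p => (h1 p).2.trans_le (hle p))

lemma lintegral_rpow_mul_rpow {ν ρ : Measure ℝ} [SFinite ν] [SFinite ρ] (hν : ∀ᵐ x ∂ν, 0 ≤ x)
    (hρ : ∀ᵐ x ∂ρ, 0 < x) (c r : ℝ) :
    ∫⁻ z, ENNReal.ofReal (z ^ r) ∂(ν.prod ρ).map (fun z => z.1 * z.2 ^ c) =
      (∫⁻ x, ENNReal.ofReal (x ^ r) ∂ν) * ∫⁻ u, ENNReal.ofReal (u ^ (c * r)) ∂ρ := by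
  rw [lintegral_map (by fun_prop) (by fun_prop), ← lintegral_prod_mul (by fun_prop) (by fun_prop)]
  refine lintegral_congr_ae ?_
  filter_upwards [Measure.quasiMeasurePreserving_fst.ae hν,
    Measure.quasiMeasurePreserving_snd.ae hρ] with z h1 h2
  rw [Real.mul_rpow h1 (by positivity), ← Real.rpow_mul h2.le, ENNReal.ofReal_mul (by positivity)]

lemma map_mul_rpow_eq {ν ρ τ : Measure ℝ} [IsProbabilityMeasure ν] [IsProbabilityMeasure ρ]
    [IsProbabilityMeasure τ] (hν : ∀ᵐ x ∂ν, 0 ≤ x) (hρ : ∀ᵐ x ∂ρ, 0 < x) (hτ : ∀ᵐ x ∂τ, 0 ≤ x)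
    (c : ℝ) {m : ℕ → ℝ} (hm : ∀ p, 0 ≤ m p)
    (h : ∀ p : ℕ, (∫⁻ x, ENNReal.ofReal (x ^ (p : ℝ)) ∂ν) *
      ∫⁻ u, ENNReal.ofReal (u ^ (c * p)) ∂ρ = ENNReal.ofReal (m p))
    (h' : ∀ p : ℕ, ∫⁻ x, ENNReal.ofReal (x ^ (p : ℝ)) ∂τ = ENNReal.ofReal (m p))
    {C b : ℝ} (hb : 0 ≤ b) (hle : ∀ p : ℕ, m p ≤ C * b ^ p * p.factorial) :
    (ν.prod ρ).map (fun z => z.1 * z.2 ^ c) = τ := by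
  have hf : Measurable fun z : ℝ × ℝ => z.1 * z.2 ^ c := by fun_prop
  have := Measure.isProbabilityMeasure_map (μ := ν.prod ρ) hf.aemeasurable
  refine ext_of_lintegral_pow ?_ hτ hm (fun p => ?_) (fun p => ?_) hb hle
  · rw [ae_map_iff hf.aemeasurable measurableSet_Ici]
    filter_upwards [Measure.quasiMeasurePreserving_fst.ae hν,
      Measure.quasiMeasurePreserving_snd.ae hρ] with z h1 h2
    positivity
  · simp only [← Real.rpow_natCast]
    rw [lintegral_rpow_mul_rpow hν hρ, h p]
  · simp only [← Real.rpow_natCast, h' p]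

lemma lintegral_rpow_withDensity {ν : Measure ℝ} (hν : ∀ᵐ x ∂ν, 0 < x) {c : ℝ} (hc : 0 ≤ c)
    (a r : ℝ) : ∫⁻ x, ENNReal.ofReal (x ^ r) ∂ν.withDensity
      (fun x => ENNReal.ofReal (c * x ^ a)) =
      ENNReal.ofReal c * ∫⁻ x, ENNReal.ofReal (x ^ (a + r)) ∂ν := by
  rw [lintegral_withDensity_eq_lintegral_mul _ (by fun_prop) (by fun_prop),
    ← lintegral_const_mul' _ _ ENNReal.ofReal_ne_top]
  refine lintegral_congr_ae ?_
  filter_upwards [hν] with x hx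
  rw [Pi.mul_apply, ← ENNReal.ofReal_mul (by positivity), ← ENNReal.ofReal_mul hc, mul_assoc,
    Real.rpow_add hx]

lemma isProbabilityMeasure_of_lintegral_rpow_zero {ν : Measure ℝ}
    (h : ∫⁻ x, ENNReal.ofReal (x ^ (0 : ℝ)) ∂ν = 1) : IsProbabilityMeasure ν := by
  constructor
  simpa using h

/-- The Mittag-Leffler distribution, characterized by its moments. -/
structure IsMittagLefflerLaw (γ : ℝ) (ν : Measure ℝ) : Prop where
  isProbabilityMeasure : IsProbabilityMeasure ν
  ae_pos : ∀ᵐ x ∂ν, 0 < x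
  lintegral_rpow : ∀ r : ℝ, -1 < r → ∫⁻ x, ENNReal.ofReal (x ^ r) ∂ν =
    ENNReal.ofReal (Real.Gamma (1 + r) / Real.Gamma (1 + γ * r))

lemma gamma_add_nat_div {a : ℝ} (ha : 0 < a) (p : ℕ) :
    Real.Gamma (a + p) / Real.Gamma a = rising a p := by
  rw [gamma_add_nat ha, mul_div_cancel_right₀ _ (Real.Gamma_pos_of_pos ha).ne']

/-- A probability measure whose moments are those of a polynomially tilted Mittag-Leffler
distribution is the tilt of a Mittag-Leffler distribution. -/
lemma exists_isMittagLefflerLaw {γ a : ℝ} (hγ₀ : 0 < γ) (hγ₁ : γ < 1) (ha : 0 < a) {ν : Measure ℝ}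
    [IsProbabilityMeasure ν] (hν : ∀ᵐ x ∂ν, 0 ≤ x)
    (h : ∀ p : ℕ, ∫⁻ x, ENNReal.ofReal (x ^ p) ∂ν =
      ENNReal.ofReal (rising a p * (Real.Gamma (γ * a) / Real.Gamma (γ * a + γ * p)))) :
    ∃ ν₀, IsMittagLefflerLaw γ ν₀ := by
  have hγa : 0 < γ * a := by positivity
  have ha1 : 0 < a + 1 := by linarith
  have hγa1 : 0 < γ * a + 1 := by linarith
  have hG1 := Real.Gamma_pos_of_pos ha1
  have hG2 := Real.Gamma_pos_of_pos hγa1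
  have := isProbabilityMeasure_gammaMeasure hγa1 one_pos
  have := isProbabilityMeasure_gammaMeasure ha1 one_pos
  -- An independent gamma factor raised to the power `γ` cancels the Gamma functions in the moments
  -- and leaves a gamma law. The shift by 1 in the parameters matters: it gives moments of all real
  -- orders above `-(a + 1)`, hence also after the factor `x ^ (-a)` is introduced below.
  have hlaw : (ν.prod (gammaMeasure (γ * a + 1) 1)).map (fun z => z.1 * z.2 ^ γ) =
      gammaMeasure (a + 1) 1 := by
    refine map_mul_rpow_eq (m := fun p => rising (a + 1) p) (C := 1) (b := a + 1 + 1) hν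
      (ae_pos_gammaMeasure _)
      ((ae_pos_gammaMeasure _).mono fun x hx => hx.le) γ (fun p => rising_nonneg ha1.le p)
      (fun p => ?_) (fun p => ?_) (by linarith) fun p => by
        simpa using rising_le ha1.le p
    · simp only [Real.rpow_natCast, h]
      have h3 : 0 < γ * a + γ * p := by positivity
      have hG3 := Real.Gamma_pos_of_pos h3
      rw [lintegral_rpow_gammaMeasure hγa1 (by positivity), ← ENNReal.ofReal_mul]
      · congr 1
        rw [show γ * a + 1 + γ * p = γ * a + γ * p + 1 by ring, Real.Gamma_add_one h3.ne',
          Real.Gamma_add_one hγa.ne']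
        have h4 := mul_rising_add_one a p
        have hG4 := Real.Gamma_pos_of_pos hγa
        field_simp
        linarith
      · have := rising_nonneg ha.le p
        have hG4 := Real.Gamma_pos_of_pos hγa
        positivity
    · rw [lintegral_rpow_gammaMeasure ha1 (by positivity), gamma_add_nat_div ha1]
  have hpos : ∀ᵐ x ∂ν, 0 < x := by
    have h1 := ae_pos_gammaMeasure (a + 1)
    rw [← hlaw, ae_map_iff (by fun_prop) measurableSet_Ioi] at h1
    have h2 : ∀ᵐ z ∂ν.prod (gammaMeasure (γ * a + 1) 1), 0 < z.1 := by
      filter_upwards [h1, Measure.quasiMeasurePreserving_snd.ae (ae_pos_gammaMeasure (γ * a + 1))]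
        with z h1 h2
      exact pos_of_mul_pos_left h1 (by positivity)
    filter_upwards [Measure.ae_ae_of_ae_prod h2] with x hx
    exact hx.exists.choose_spec
  have hmom : ∀ r : ℝ, -(a + 1) < r → ∫⁻ x, ENNReal.ofReal (x ^ r) ∂ν =
      ENNReal.ofReal (Real.Gamma (a + 1 + r) * Real.Gamma (γ * a + 1) /
        (Real.Gamma (a + 1) * Real.Gamma (γ * a + 1 + γ * r))) := by
    intro r hr
    have h1 := lintegral_rpow_mul_rpow hν (ae_pos_gammaMeasure (γ * a + 1)) γ r
    have h2 : 0 < γ * a + 1 + γ * r := by nlinarith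
    have hG3 := Real.Gamma_pos_of_pos h2
    rw [hlaw, lintegral_rpow_gammaMeasure ha1 (by linarith), lintegral_rpow_gammaMeasure hγa1 h2]
      at h1
    have h3 : 0 < Real.Gamma (γ * a + 1 + γ * r) / Real.Gamma (γ * a + 1) := by positivity
    rw [← ENNReal.mul_div_cancel_right (a := ∫⁻ x, ENNReal.ofReal (x ^ r) ∂ν)
      (b := ENNReal.ofReal (Real.Gamma (γ * a + 1 + γ * r) / Real.Gamma (γ * a + 1)))
      (by simpa using h3) ENNReal.ofReal_ne_top, ← h1, ← ENNReal.ofReal_div_of_pos h3]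
    congr 1
    field_simp
  -- Weighting by `x ^ (-a)` undoes the tilt; the case `r = 0` shows that the constant is the right
  -- normalization.
  have hmom0 : ∀ r : ℝ, -1 < r → ∫⁻ x, ENNReal.ofReal (x ^ r) ∂(ν.withDensity
      (fun x => ENNReal.ofReal (Real.Gamma (a + 1) / Real.Gamma (γ * a + 1) * x ^ (-a)))) =
      ENNReal.ofReal (Real.Gamma (1 + r) / Real.Gamma (1 + γ * r)) := by
    intro r hr
    have h2 : 0 < 1 + γ * r := by nlinarith
    have hG3 := Real.Gamma_pos_of_pos h2
    rw [lintegral_rpow_withDensity hpos (by positivity), hmom _ (by linarith),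
      ← ENNReal.ofReal_mul (by positivity), show a + 1 + (-a + r) = 1 + r by ring,
      show γ * a + 1 + γ * (-a + r) = 1 + γ * r by ring]
    congr 1
    field_simp
  exact ⟨_, isProbabilityMeasure_of_lintegral_rpow_zero (by simpa using hmom0 0 (by norm_num)),
    withDensity_absolutelyContinuous _ _ |>.ae_le hpos, hmom0⟩

namespace IsMittagLefflerLaw

variable {γ : ℝ} {ν : Measure ℝ}

/-- An identity in law that serves to prove absolute continuity: it exhibits the distribution as
that of a product with a power of an independent variable that has a density. -/
lemma map_mul_rpow_betaMeasure (h : IsMittagLefflerLaw γ ν) (hγ₀ : 0 < γ) (hγ₁ : γ < 1) :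
    ((ν.withDensity fun x => ENNReal.ofReal (Real.Gamma (1 + γ) * x ^ (1 : ℝ))).prod
      (betaMeasure γ (1 - γ))).map (fun z => z.1 * z.2 ^ γ) = ν := by
  have := h.isProbabilityMeasure
  have hγ₁' : 0 < 1 - γ := by linarith
  have hG := Real.Gamma_pos_of_pos (show 0 < 1 + γ by linarith)
  have hG' := Real.Gamma_pos_of_pos hγ₀
  have h1 : ∀ r : ℝ, -1 < r → ∫⁻ x, ENNReal.ofReal (x ^ r) ∂(ν.withDensity
      fun x => ENNReal.ofReal (Real.Gamma (1 + γ) * x ^ (1 : ℝ))) = ENNReal.ofReal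
        (Real.Gamma (1 + γ) * (Real.Gamma (1 + (1 + r)) / Real.Gamma (1 + γ * (1 + r)))) := by
    intro r hr
    rw [lintegral_rpow_withDensity h.ae_pos hG.le, h.lintegral_rpow _ (by linarith),
      ← ENNReal.ofReal_mul hG.le]
  have := isProbabilityMeasure_of_lintegral_rpow_zero ((h1 0 (by norm_num)).trans (by
    simp [one_add_one_eq_two, hG.ne']))
  have := isProbabilityMeasureBeta hγ₀ hγ₁'
  have hbeta : betaMeasure γ (1 - γ) = betaLaw γ (1 - γ) := by rw [betaLaw, if_neg hγ₁'.ne']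
  have hm : ∀ p : ℕ, Real.Gamma (1 + p) / Real.Gamma (1 + γ * p) ≤ 6 * 1 ^ p * p.factorial := by
    intro p
    have h2 : 0 < 1 + γ * p := by positivity
    rw [add_comm, Real.Gamma_nat_eq_factorial, div_le_iff₀ (Real.Gamma_pos_of_pos h2), one_pow]
    have h3 := gamma_lower_bound h2
    have h4 : (0 : ℝ) < p.factorial := by positivity
    nlinarith
  refine map_mul_rpow_eq (m := fun p => Real.Gamma (1 + p) / Real.Gamma (1 + γ * p))
    (withDensity_absolutelyContinuous _ _ |>.ae_le (h.ae_pos.mono fun x hx => hx.le))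
    (hbeta ▸ ae_pos_betaLaw γ (1 - γ)) (h.ae_pos.mono fun x hx => hx.le) γ (fun p => ?_)
    (fun p => ?_) (fun p => h.lintegral_rpow p (neg_one_lt_zero.trans_le p.cast_nonneg)) zero_le_one
    hm
  · exact div_nonneg (Real.Gamma_nonneg_of_nonneg (by positivity))
      (Real.Gamma_nonneg_of_nonneg (by positivity))
  · have hp : (0 : ℝ) < 1 + p := by positivity
    have h2 : 0 < γ * (1 + p) := by positivity
    have h3 : 0 < 1 + γ * p := by positivity
    have hG2 := Real.Gamma_pos_of_pos hp
    have hG3 := Real.Gamma_pos_of_pos h2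
    have hG4 := Real.Gamma_pos_of_pos h3
    rw [h1 _ (neg_one_lt_zero.trans_le p.cast_nonneg), hbeta,
      lintegral_rpow_betaLaw hγ₀ hγ₁'.le (by positivity), add_sub_cancel, Real.Gamma_one,
      add_comm (1 : ℝ) γ, add_comm 1 (1 + (p : ℝ)), add_comm 1 (γ * (1 + (p : ℝ))),
      Real.Gamma_add_one hγ₀.ne', Real.Gamma_add_one hp.ne', Real.Gamma_add_one h2.ne',
      ← ENNReal.ofReal_mul (by positivity), show γ + γ * p = γ * (1 + p) by ring]
    congr 1
    field_simp

/-- For fixed `y > 0` the preimage of a null set under `u ↦ y * u ^ γ` on `(0, ∞)` is the image of a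
null set under the differentiable inverse, hence null, also for the beta law. Fubini then gives the
claim for the product. -/
lemma absolutelyContinuous (h : IsMittagLefflerLaw γ ν) (hγ₀ : 0 < γ) (hγ₁ : γ < 1) :
    ν ≪ volume := by
  have := h.isProbabilityMeasure
  refine Measure.AbsolutelyContinuous.mk fun N hN hN0 => ?_
  have := isProbabilityMeasureBeta hγ₀ (sub_pos.2 hγ₁)
  rw [← h.map_mul_rpow_betaMeasure hγ₀ hγ₁, Measure.map_apply (by fun_prop) hN,
    Measure.measure_prod_null (hN.preimage (by fun_prop))]
  refine withDensity_absolutelyContinuous _ _ |>.ae_le ?_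
  filter_upwards [h.ae_pos] with y hy
  have h1 : (volume : Measure ℝ) ((fun n => (n / y) ^ γ⁻¹) '' (N ∩ Set.Ioi 0)) = 0 := by
    refine addHaar_image_eq_zero_of_differentiableOn_of_addHaar_eq_zero _ ?_
      (measure_mono_null Set.inter_subset_left hN0)
    intro n hn
    have : n / y ≠ 0 := (div_pos hn.2 hy).ne'
    exact (DifferentiableAt.rpow_const (differentiableAt_id.div_const y) (Or.inl this)).differentiableWithinAt
  have h2 : betaMeasure γ (1 - γ) ((fun n => (n / y) ^ γ⁻¹) '' (N ∩ Set.Ioi 0)) = 0 :=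
    withDensity_absolutelyContinuous _ _ h1
  have hpos := ae_pos_betaLaw γ (1 - γ)
  rw [betaLaw, if_neg (sub_pos.2 hγ₁).ne'] at hpos
  refine measure_mono_null ?_ (measure_union_null h2 hpos)
  intro u hu
  rcases le_or_gt u 0 with hu0 | hu0
  · exact Or.inr hu0.not_gt
  · refine Or.inl ⟨y * u ^ γ, ⟨hu, mul_pos hy (Real.rpow_pos_of_pos hu0 γ)⟩, ?_⟩
    simp only
    rw [mul_div_cancel_left₀ _ hy.ne', Real.rpow_rpow_inv hu0.le hγ₀.ne']

lemma map_mul_rpow_gammaMeasure (h : IsMittagLefflerLaw γ ν) (hγ₀ : 0 < γ) :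
    (ν.prod (gammaMeasure 1 1)).map (fun z => z.1 * z.2 ^ γ) = gammaMeasure 1 1 := by
  have := h.isProbabilityMeasure
  have := isProbabilityMeasure_gammaMeasure one_pos one_pos
  refine map_mul_rpow_eq (m := fun p => (p.factorial : ℝ)) (C := 1) (b := 1)
    (h.ae_pos.mono fun x hx => hx.le)
    (ae_pos_gammaMeasure _) ((ae_pos_gammaMeasure _).mono fun x hx => hx.le) γ
    (fun p => by positivity) (fun p => ?_) (fun p => ?_) zero_le_one (fun p => by simp)
  · have h3 : 0 < 1 + γ * p := by positivity
    have hG3 := Real.Gamma_pos_of_pos h3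
    rw [h.lintegral_rpow _ (neg_one_lt_zero.trans_le p.cast_nonneg),
      lintegral_rpow_gammaMeasure one_pos h3, Real.Gamma_one, div_one, add_comm,
      Real.Gamma_nat_eq_factorial, ← ENNReal.ofReal_mul (by positivity),
      div_mul_cancel₀ _ hG3.ne']
  · rw [lintegral_rpow_gammaMeasure one_pos (by positivity), Real.Gamma_one, div_one, add_comm,
      Real.Gamma_nat_eq_factorial]

lemma gammaMeasure_one_Ioi {c : ℝ} (hc : 0 ≤ c) :
    gammaMeasure 1 1 (Set.Ioi c) = ENNReal.ofReal (Real.exp (-c)) := by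
  have h1 : gammaMeasure 1 1 (Set.Ioi c) = ∫⁻ x in Set.Ioi c, ENNReal.ofReal (Real.exp (-x)) := by
    rw [gammaMeasure, withDensity_apply _ measurableSet_Ioi]
    refine setLIntegral_congr_fun measurableSet_Ioi fun x hx => ?_
    rw [gammaPDF_of_nonneg (hc.trans (le_of_lt hx))]
    simp
  rw [h1, ← ofReal_integral_eq_lintegral_ofReal (integrableOn_exp_neg_Ioi c)
    (Eventually.of_forall fun x => (Real.exp_pos _).le), integral_exp_neg_Ioi]

/-- With an independent standard exponential `E`, the integrand is the probability that `E > x y ^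
(-1/γ)`, which says `y E ^ γ > x ^ γ`. By `map_mul_rpow_gammaMeasure` the product is again standard
exponential. -/
lemma integral_exp_neg (h : IsMittagLefflerLaw γ ν) (hγ₀ : 0 < γ) {x : ℝ} (hx : 0 ≤ x) :
    ∫ y, Real.exp (-(x * y ^ (-γ⁻¹))) ∂ν = Real.exp (-(x ^ γ)) := by
  have := h.isProbabilityMeasure
  have := isProbabilityMeasure_gammaMeasure one_pos one_pos
  have h1 : ∫⁻ y, ENNReal.ofReal (Real.exp (-(x * y ^ (-γ⁻¹)))) ∂ν =
      ENNReal.ofReal (Real.exp (-(x ^ γ))) := by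
    rw [← gammaMeasure_one_Ioi (by positivity), ← h.map_mul_rpow_gammaMeasure hγ₀,
      Measure.map_apply (by fun_prop) measurableSet_Ioi,
      Measure.prod_apply (measurableSet_Ioi.preimage (by fun_prop))]
    refine lintegral_congr_ae ?_
    filter_upwards [h.ae_pos] with y hy
    rw [← gammaMeasure_one_Ioi (by positivity)]
    refine measure_congr ?_
    filter_upwards [ae_pos_gammaMeasure 1] with u hu
    refine propext ?_
    change x * y ^ (-γ⁻¹) < u ↔ x ^ γ < y * u ^ γ
    have h2 : x ^ γ = y * (x * y ^ (-γ⁻¹)) ^ γ := by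
      rw [Real.mul_rpow hx (by positivity), ← Real.rpow_mul hy.le, neg_mul,
        inv_mul_cancel₀ hγ₀.ne', Real.rpow_neg_one]
      field_simp
    rw [h2, mul_lt_mul_iff_right₀ hy, Real.rpow_lt_rpow_iff (by positivity) hu.le hγ₀]
  exact (integrable_and_integral_eq_of_lintegral (by fun_prop)
    (Eventually.of_forall fun y => (Real.exp_pos _).le) (Real.exp_pos _).le h1).2

lemma isStableLaw (h : IsMittagLefflerLaw γ ν) (hγ₀ : 0 < γ) :
    IsStableLaw γ (ν.map fun y => y ^ (-γ⁻¹)) := by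
  have := h.isProbabilityMeasure
  refine ⟨Measure.isProbabilityMeasure_map (by fun_prop), ?_, fun x hx => ?_⟩
  · rw [Measure.map_apply (by fun_prop) measurableSet_Iio]
    refine measure_mono_null (fun y hy => ?_) h.ae_pos
    intro hy'
    exact absurd hy (not_lt.2 (Real.rpow_nonneg (le_of_lt hy') _))
  · rw [integral_map (by fun_prop) (by fun_prop), h.integral_exp_neg hγ₀ hx]

/-- The density of a Mittag-Leffler distribution. -/
lemma exists_density (h : IsMittagLefflerLaw γ ν) (hγ₀ : 0 < γ) (hγ₁ : γ < 1) :
    ∃ g, IsMittagLefflerDensity γ g ∧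
      volume.withDensity (fun s => ENNReal.ofReal (g s)) = ν := by
  have := h.isProbabilityMeasure
  have h1 : volume.withDensity (fun s => ENNReal.ofReal (ν.rnDeriv volume s).toReal) = ν := by
    conv_rhs => rw [← Measure.withDensity_rnDeriv_eq _ _ (h.absolutelyContinuous hγ₀ hγ₁)]
    refine withDensity_congr_ae ?_
    filter_upwards [Measure.rnDeriv_lt_top ν volume] with s hs
    exact ENNReal.ofReal_toReal hs.ne
  refine ⟨fun s => (ν.rnDeriv volume s).toReal, ⟨by fun_prop, fun s => ENNReal.toReal_nonneg, _,
    h.isStableLaw hγ₀, ?_⟩, h1⟩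
  rw [h1, Measure.map_map (by fun_prop) (by fun_prop)]
  conv_rhs => rw [← Measure.map_id (μ := ν)]
  refine Measure.map_congr ?_
  filter_upwards [h.ae_pos] with y hy
  simp only [Function.comp, id]
  rw [← Real.rpow_mul hy.le, neg_mul_neg, inv_mul_cancel₀ hγ₀.ne', Real.rpow_one]

end IsMittagLefflerLaw

/-! ### Moments of the tilted Mittag-Leffler law -/

section Tilted

variable {α γ : ℝ} {g : ℝ → ℝ}

lemma tiltedLaw_eq_withDensity (hg : Measurable g) (hg0 : ∀ s, 0 ≤ g s) (k ℓ : ℕ) :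
    tiltedLaw α γ g k ℓ = (volume.withDensity fun s => ENNReal.ofReal (g s)).withDensity
      fun s => ENNReal.ofReal (Real.Gamma (1 + k * (1 - α) + ℓ * γ) /
        Real.Gamma (1 + ℓ + k * (1 - α) / γ) * s ^ ((ℓ : ℝ) + k * (1 - α) / γ)) := by
  rw [← withDensity_mul _ (by fun_prop) (by fun_prop), tiltedLaw]
  congr 1
  funext s
  rw [Pi.mul_apply, ENNReal.ofReal_mul' (hg0 s), mul_comm]

lemma ae_pos_tiltedLaw (hg : Measurable g) (hg0 : ∀ s, 0 ≤ g s)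
    (h : IsMittagLefflerLaw γ (volume.withDensity fun s => ENNReal.ofReal (g s))) (k ℓ : ℕ) :
    ∀ᵐ s ∂tiltedLaw α γ g k ℓ, 0 < s := by
  rw [tiltedLaw_eq_withDensity hg hg0]
  exact withDensity_absolutelyContinuous _ _ |>.ae_le h.ae_pos

lemma lintegral_rpow_tiltedLaw (hα₁ : α < 1) (hγ₀ : 0 < γ) (hg : Measurable g)
    (hg0 : ∀ s, 0 ≤ g s)
    (h : IsMittagLefflerLaw γ (volume.withDensity fun s => ENNReal.ofReal (g s))) (k ℓ : ℕ)
    {θ r : ℝ} (hθ : θ = k * (1 - α) + ℓ * γ) (hr : 0 ≤ r) :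
    ∫⁻ s, ENNReal.ofReal (s ^ r) ∂tiltedLaw α γ g k ℓ =
      ENNReal.ofReal (Real.Gamma (θ / γ + 1 + r) * Real.Gamma (θ + 1) /
        (Real.Gamma (θ / γ + 1) * Real.Gamma (θ + 1 + γ * r))) := by
  have hα : 0 < 1 - α := by linarith
  have hθ0 : 0 ≤ θ := by rw [hθ]; positivity
  have h1 : (ℓ : ℝ) + k * (1 - α) / γ = θ / γ := by rw [hθ]; field_simp; ring
  have h2 : 1 + (k : ℝ) * (1 - α) + ℓ * γ = θ + 1 := by rw [hθ]; ring
  have hG1 := Real.Gamma_pos_of_pos (show 0 < θ / γ + 1 by positivity)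
  have hG2 := Real.Gamma_pos_of_pos (show 0 < θ + 1 by positivity)
  rw [tiltedLaw_eq_withDensity hg hg0, add_assoc (1 : ℝ) ℓ, h1, h2, add_comm 1 (θ / γ),
    lintegral_rpow_withDensity h.ae_pos (by positivity), h.lintegral_rpow _
    (by have : 0 ≤ θ / γ := by positivity
        linarith), ← ENNReal.ofReal_mul (by positivity)]
  rw [show 1 + (θ / γ + r) = θ / γ + 1 + r by ring,
    show 1 + γ * (θ / γ + r) = θ + 1 + γ * r by field_simp; ring]
  congr 1
  field_simp

lemma isProbabilityMeasure_tiltedLaw (hα₁ : α < 1) (hγ₀ : 0 < γ) (hg : Measurable g)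
    (hg0 : ∀ s, 0 ≤ g s)
    (h : IsMittagLefflerLaw γ (volume.withDensity fun s => ENNReal.ofReal (g s))) (k ℓ : ℕ) :
    IsProbabilityMeasure (tiltedLaw α γ g k ℓ) := by
  refine isProbabilityMeasure_of_lintegral_rpow_zero ?_
  rw [lintegral_rpow_tiltedLaw hα₁ hγ₀ hg hg0 h k ℓ rfl le_rfl]
  have hα : 0 < 1 - α := by linarith
  have hG1 := Real.Gamma_pos_of_pos
    (show 0 < ((k : ℝ) * (1 - α) + ℓ * γ) / γ + 1 by positivity)
  have hG2 := Real.Gamma_pos_of_pos (show 0 < (k : ℝ) * (1 - α) + ℓ * γ + 1 by positivity)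
  rw [mul_zero, add_zero, add_zero, div_self (by positivity), ENNReal.ofReal_one]

end Tilted

/-! ### Numbers of edges -/

section Counting

variable {α γ : ℝ} {k : ℕ} {t : Finset (Finset ℕ)}

lemma exists_child_mem (ht : t ∈ trees k) {V : Finset ℕ} (hV : V ∈ branchPoints t) {i : ℕ}
    (hi : i ∈ V) : ∃ D ∈ children t V, i ∈ D := by
  obtain ⟨hVt, hcard⟩ := Finset.mem_filter.1 hV
  have hne : (t.filter fun D => i ∈ D ∧ D ⊂ V).Nonempty := by
    refine ⟨{i}, Finset.mem_filter.2 ⟨ht.2.2.1 i ((ht.1 V hVt).2 hi), by simp, ?_⟩⟩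
    refine Finset.ssubset_iff_subset_ne.2 ⟨by simpa using hi, ?_⟩
    rintro rfl
    simp at hcard
  obtain ⟨D, hD, hmax⟩ := Finset.exists_max_image _ Finset.card hne
  simp only [Finset.mem_filter] at hD hmax
  refine ⟨D, Finset.mem_filter.2 ⟨hD.1, hD.2.2, fun E hE h => ?_⟩, hD.2.1⟩
  exact (Finset.card_lt_card h.1).not_ge (hmax E ⟨hE, h.1.1 hD.2.1, h.2⟩)

lemma two_le_card_children (ht : t ∈ trees k) {V : Finset ℕ} (hV : V ∈ branchPoints t) :
    2 ≤ (children t V).card := by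
  have hVne := (ht.1 V (Finset.mem_filter.1 hV).1).1
  obtain ⟨i, hi⟩ := hVne
  obtain ⟨D, hD, hiD⟩ := exists_child_mem ht hV hi
  obtain ⟨j, hj, hjD⟩ := Finset.exists_of_ssubset (Finset.mem_filter.1 hD).2.1
  obtain ⟨E, hE, hjE⟩ := exists_child_mem ht hV hj
  exact Finset.one_lt_card.2 ⟨D, hD, E, hE, fun h => hjD (h ▸ hjE)⟩

lemma card_leaves (ht : t ∈ trees k) : (t.filter fun D => D.card = 1).card = k := by
  have h := card_singletons ht ht.2.1
  rw [Nat.card_Icc, Nat.add_sub_cancel] at h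
  conv_rhs => rw [← h]
  congr 1
  refine Finset.filter_congr fun D hD => ?_
  simp [(ht.1 D hD).2]

lemma card_branchPoints_add (ht : t ∈ trees k) : (branchPoints t).card + k = t.card := by
  rw [← card_leaves ht, branchPoints, add_comm,
    ← Finset.card_filter_add_card_filter_not (s := t) (p := fun D => D.card = 1)]
  congr 2
  refine Finset.filter_congr fun D hD => ?_
  have := (ht.1 D hD).1.card_pos
  omega

/-- Each branch point has at least two children, and all vertices but the lowest one are children.
-/
lemma card_lt_two_mul (ht : t ∈ trees k) : t.card < 2 * k := by
  have h1 := sum_card_children ht ht.2.1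
  have h2 : (branchPoints t).filter (· ⊆ Finset.Icc 1 k) = branchPoints t :=
    Finset.filter_true_of_mem fun V hV => (ht.1 V (Finset.mem_filter.1 hV).1).2
  have h3 : t.filter (· ⊆ Finset.Icc 1 k) = t :=
    Finset.filter_true_of_mem fun V hV => (ht.1 V hV).2
  have h4 := Finset.card_nsmul_le_sum _ _ _ fun V (hV : V ∈ branchPoints t) =>
    two_le_card_children ht hV
  have h5 := card_branchPoints_add ht
  rw [h2, h3] at h1
  simp only [smul_eq_mul] at h4
  omega

lemma sum_edgeWeight_eq (ht : t ∈ trees k) {ℓ : ℕ} (hℓ : t.card = k + ℓ) :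
    ∑ B ∈ t, edgeWeight α γ B = k * (1 - α) + ℓ * γ := by
  have h1 := card_leaves ht
  have h2 := Finset.card_filter_add_card_filter_not (s := t) (p := fun D => D.card = 1)
  simp only [edgeWeight, Finset.sum_ite, Finset.sum_const, nsmul_eq_mul]
  rw [h1, show (t.filter fun D => ¬ D.card = 1).card = ℓ by omega]

/-- The tree has at most `k - 1` inner edges, and `γ ≤ α`. -/
lemma betaParam_nonneg (hα₀ : 0 < α) (hγα : γ ≤ α) (ht : t ∈ trees k) {ℓ : ℕ}
    (hℓ : t.card = k + ℓ) : 0 ≤ ((k : ℝ) - 1) * α - ℓ * γ := by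
  have h1 := card_lt_two_mul ht
  have h2 : (ℓ : ℝ) + 1 ≤ k := by exact_mod_cast (by omega : ℓ + 1 ≤ k)
  have h3 : (ℓ : ℝ) * γ ≤ ℓ * α := by gcongr
  nlinarith

end Counting

/-! ### Identification of the joint law -/

lemma Dirichlet.isProbabilityMeasure {m : ℕ} [NeZero m] {a : Fin m → ℝ} (ha : ∀ i, 0 < a i) :
    IsProbabilityMeasure (dirichletLaw a) := by
  obtain ⟨d, rfl⟩ := Nat.exists_eq_succ_of_ne_zero (NeZero.ne m)
  exact isProbabilityMeasure_dirichletLaw ha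

lemma Dirichlet.ae {m : ℕ} [NeZero m] (a : Fin m → ℝ) :
    ∀ᵐ z ∂dirichletLaw a, (∀ i, 0 < z i) ∧ ∑ i, z i = 1 := by
  obtain ⟨d, rfl⟩ := Nat.exists_eq_succ_of_ne_zero (NeZero.ne m)
  exact ae_dirichletLaw a

lemma Dirichlet.lintegral_prod_pow {m : ℕ} [NeZero m] {a : Fin m → ℝ} (ha : ∀ i, 0 < a i)
    (p : Fin m → ℕ) : ∫⁻ z, ENNReal.ofReal (∏ i, z i ^ p i) ∂dirichletLaw a =
      ENNReal.ofReal ((∏ i, rising (a i) (p i)) *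
        (Real.Gamma (∑ i, a i) / Real.Gamma (∑ i, a i + ∑ i, (p i : ℝ)))) := by
  obtain ⟨d, rfl⟩ := Nat.exists_eq_succ_of_ne_zero (NeZero.ne m)
  exact lintegral_prod_pow_dirichletLaw ha p

/-- The mass coordinate `w` and the edge lengths `l * w ^ γ * d j`. -/
noncomputable def massAndLengths (γ : ℝ) {m : ℕ} (z : ℝ × ℝ × (Fin m → ℝ)) : Option (Fin m) → ℝ :=
  fun o => o.elim z.1 fun j => z.2.1 * z.1 ^ γ * z.2.2 j

/-- The mass coordinate, the normalized total length and the length proportions. -/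
noncomputable def massAndProportions (γ : ℝ) {m : ℕ} (v : Option (Fin m) → ℝ) :
    ℝ × ℝ × (Fin m → ℝ) :=
  (v none, (∑ j, v (some j)) / v none ^ γ, fun j => v (some j) / ∑ i, v (some i))

section JointLaw

variable {γ : ℝ} {m : ℕ}

@[fun_prop]
lemma measurable_massAndLengths : Measurable (massAndLengths γ (m := m)) := by
  refine measurable_pi_iff.2 fun o => ?_
  cases o with
  | none => exact measurable_fst
  | some j =>
    change Measurable fun z : ℝ × ℝ × (Fin m → ℝ) => z.2.1 * z.1 ^ γ * z.2.2 j
    fun_prop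

@[fun_prop]
lemma measurable_massAndProportions : Measurable (massAndProportions γ (m := m)) := by
  unfold massAndProportions
  fun_prop

lemma massAndProportions_massAndLengths {z : ℝ × ℝ × (Fin m → ℝ)} (h1 : 0 < z.1) (h2 : 0 < z.2.1)
    (h3 : ∑ j, z.2.2 j = 1) : massAndProportions γ (massAndLengths γ z) = z := by
  have h4 : (0 : ℝ) < z.1 ^ γ := Real.rpow_pos_of_pos h1 γ
  simp only [massAndProportions, massAndLengths, Option.elim, ← Finset.mul_sum, h3, mul_one]
  refine Prod.ext rfl (Prod.ext ?_ (funext fun j => ?_))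
  · simp only
    field_simp
  · simp only
    field_simp

/-- By independence the moment is a product of three Gamma quotients. The total length and the
Dirichlet factor together reduce to `Γ(θ) / Γ(θ + γ s)`, times the rising factorials of the
parameters; this shifts the argument of the beta factor from `θ` to `θ + γ s`. -/
lemma lintegral_prod_pow_massAndLengths [NeZero m] (hγ₀ : 0 < γ) {a : Fin m → ℝ}
    (ha : ∀ i, 0 < a i) {θ b : ℝ} (hθ : θ = γ * ∑ i, a i) (hb : 0 ≤ b) {τ : Measure ℝ}
    [IsProbabilityMeasure τ] (hτ0 : ∀ᵐ l ∂τ, 0 < l)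
    (hτ : ∀ p : ℕ, ∫⁻ l, ENNReal.ofReal (l ^ (p : ℝ)) ∂τ =
      ENNReal.ofReal (Real.Gamma (θ / γ + 1 + p) * Real.Gamma (θ + 1) /
        (Real.Gamma (θ / γ + 1) * Real.Gamma (θ + 1 + γ * p)))) (n : Option (Fin m) → ℕ) :
    ∫⁻ z, ENNReal.ofReal (∏ i, massAndLengths γ z i ^ n i)
        ∂(betaLaw θ b).prod (τ.prod (dirichletLaw a)) =
      ENNReal.ofReal (rising (θ + γ * ∑ j, (n (some j) : ℝ)) (n none) *
        (∏ j, rising (a j) (n (some j))) *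
        (Real.Gamma (θ + b) /
          Real.Gamma (θ + b + (γ * ∑ j, (n (some j) : ℝ) + n none)))) := by
  have hA : 0 < ∑ i, a i := Finset.sum_pos (fun i _ => ha i) Finset.univ_nonempty
  have hθ0 : 0 < θ := hθ ▸ mul_pos hγ₀ hA
  have := Dirichlet.isProbabilityMeasure ha
  have := isProbabilityMeasure_betaLaw hθ0 hb
  set s : ℝ := ∑ j, (n (some j) : ℝ) with hs
  have hs0 : 0 ≤ s := by positivity
  have hsN : s = ((∑ j, n (some j) : ℕ) : ℝ) := by push_cast; rfl
  have h1 : ∀ᵐ z ∂(betaLaw θ b).prod (τ.prod (dirichletLaw a)),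
      ENNReal.ofReal (∏ i, massAndLengths γ z i ^ n i) = ENNReal.ofReal (z.1 ^ (γ * s + n none)) *
        (ENNReal.ofReal (z.2.1 ^ s) * ENNReal.ofReal (∏ j, z.2.2 j ^ n (some j))) := by
    filter_upwards [Measure.quasiMeasurePreserving_fst.ae (ae_pos_betaLaw θ b),
      Measure.quasiMeasurePreserving_snd.ae (Measure.quasiMeasurePreserving_fst.ae hτ0)]
      with z hz1 hz2
    rw [← ENNReal.ofReal_mul (by positivity), ← ENNReal.ofReal_mul (by positivity),
      Fintype.prod_option]
    congr 1
    simp only [massAndLengths, Option.elim, mul_pow, Finset.prod_mul_distrib,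
      Finset.prod_pow_eq_pow_sum]
    rw [Real.rpow_add hz1, Real.rpow_mul hz1.le, hsN, Real.rpow_natCast, Real.rpow_natCast,
      Real.rpow_natCast]
    ring
  rw [lintegral_congr_ae h1, lintegral_prod_mul (f := fun w : ℝ => ENNReal.ofReal
      (w ^ (γ * s + n none))) (g := fun z : ℝ × (Fin m → ℝ) => ENNReal.ofReal (z.1 ^ s) *
        ENNReal.ofReal (∏ j, z.2 j ^ n (some j))) (by fun_prop) (by fun_prop),
    lintegral_prod_mul (f := fun l : ℝ => ENNReal.ofReal (l ^ s)) (g := fun d : Fin m → ℝ =>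
      ENNReal.ofReal (∏ j, d j ^ n (some j))) (by fun_prop) (Measurable.aemeasurable (by fun_prop)),
    lintegral_rpow_betaLaw hθ0 hb (by positivity), Dirichlet.lintegral_prod_pow ha, hsN, hτ, ← hsN,
    ← hs, ← ENNReal.ofReal_mul, ← ENNReal.ofReal_mul]
  · congr 1
    have hθγ : θ / γ = ∑ i, a i := by rw [hθ]; field_simp
    have e1 : 0 < θ / γ := by positivity
    have e2 : 0 < θ / γ + s := by positivity
    have e3 : 0 < θ + γ * s := by positivity
    rw [← hθγ, show θ + (γ * s + n none) = θ + γ * s + n none by ring, gamma_add_nat e3,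
      show θ / γ + 1 + s = θ / γ + s + 1 by ring, Real.Gamma_add_one e2.ne',
      show θ + 1 + γ * s = θ + γ * s + 1 by ring, Real.Gamma_add_one e3.ne',
      Real.Gamma_add_one e1.ne', Real.Gamma_add_one hθ0.ne']
    have g1 := Real.Gamma_pos_of_pos e1
    have g2 := Real.Gamma_pos_of_pos e2
    have g3 := Real.Gamma_pos_of_pos e3
    have g4 := Real.Gamma_pos_of_pos hθ0
    have g5 := Real.Gamma_pos_of_pos (show 0 < θ + b + (γ * s + n none) by positivity)
    field_simp
  · have g1 := Real.Gamma_pos_of_pos (show 0 < θ / γ + 1 by positivity)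
    have g2 := Real.Gamma_pos_of_pos (show 0 < θ / γ + 1 + s by positivity)
    have g3 := Real.Gamma_pos_of_pos (show 0 < θ + 1 by positivity)
    have g4 := Real.Gamma_pos_of_pos (show 0 < θ + 1 + γ * s by positivity)
    positivity
  · have g1 := Real.Gamma_pos_of_pos hθ0
    have g2 := Real.Gamma_pos_of_pos (show 0 < θ + (γ * s + n none) by positivity)
    have g3 := Real.Gamma_pos_of_pos (show 0 < θ + b by positivity)
    have g4 := Real.Gamma_pos_of_pos (show 0 < θ + b + (γ * s + n none) by positivity)
    positivity

/-- A mass and a vector of edge lengths whose joint moments are those of the limiting tree have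
the asserted beta, tilted Mittag-Leffler and Dirichlet distributions. -/
theorem map_massAndProportions_eq [NeZero m] (hγ₀ : 0 < γ) (hγ₁ : γ < 1) {a : Fin m → ℝ}
    (ha : ∀ i, 0 < a i) {θ b : ℝ} (hθ : θ = γ * ∑ i, a i) (hb : 0 ≤ b) {τ : Measure ℝ}
    [IsProbabilityMeasure τ] (hτ0 : ∀ᵐ l ∂τ, 0 < l)
    (hτ : ∀ p : ℕ, ∫⁻ l, ENNReal.ofReal (l ^ (p : ℝ)) ∂τ =
      ENNReal.ofReal (Real.Gamma (θ / γ + 1 + p) * Real.Gamma (θ + 1) /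
        (Real.Gamma (θ / γ + 1) * Real.Gamma (θ + 1 + γ * p))))
    {Ω : Type*} [MeasurableSpace Ω] {Q : Measure Ω} [IsProbabilityMeasure Q]
    {v : Ω → Option (Fin m) → ℝ} (hv : Measurable v) (hv0 : ∀ᵐ ω ∂Q, ∀ i, 0 ≤ v ω i)
    (hmom : ∀ n : Option (Fin m) → ℕ, Integrable (fun ω => ∏ i, v ω i ^ n i) Q ∧
      ∫ ω, ∏ i, v ω i ^ n i ∂Q = rising (θ + γ * ∑ j, (n (some j) : ℝ)) (n none) *
        (∏ j, rising (a j) (n (some j))) *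
        (Real.Gamma (θ + b) /
          Real.Gamma (θ + b + (γ * ∑ j, (n (some j) : ℝ) + n none)))) :
    Q.map (fun ω => massAndProportions γ (v ω)) =
      (betaLaw θ b).prod (τ.prod (dirichletLaw a)) := by
  have hA : 0 < ∑ i, a i := Finset.sum_pos (fun i _ => ha i) Finset.univ_nonempty
  have hθ0 : 0 < θ := hθ ▸ mul_pos hγ₀ hA
  have := Dirichlet.isProbabilityMeasure ha
  have := isProbabilityMeasure_betaLaw hθ0 hb
  have hG := Real.Gamma_pos_of_pos (show 0 < θ + b by positivity)
  set N := (betaLaw θ b).prod (τ.prod (dirichletLaw a)) with hN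
  have haeN : ∀ᵐ z ∂N, 0 < z.1 ∧ 0 < z.2.1 ∧ (∀ j, 0 < z.2.2 j) ∧ ∑ j, z.2.2 j = 1 := by
    filter_upwards [Measure.quasiMeasurePreserving_fst.ae (ae_pos_betaLaw θ b),
      Measure.quasiMeasurePreserving_snd.ae (Measure.quasiMeasurePreserving_fst.ae hτ0),
      Measure.quasiMeasurePreserving_snd.ae
        (Measure.quasiMeasurePreserving_snd.ae (Dirichlet.ae a))] with z h1 h2 h3
    exact ⟨h1, h2, h3⟩
  have hnonneg : ∀ᵐ z ∂N, ∀ i, 0 ≤ massAndLengths γ z i := by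
    filter_upwards [haeN] with z ⟨h1, h2, h3, _⟩ i
    cases i with
    | none => exact h1.le
    | some j =>
      have := h3 j
      change 0 ≤ z.2.1 * z.1 ^ γ * z.2.2 j
      positivity
  have hmS : MeasurableSet {z : Option (Fin m) → ℝ | ∀ i, 0 ≤ z i} := by
    rw [show {z : Option (Fin m) → ℝ | ∀ i, 0 ≤ z i} = ⋂ i, {z | 0 ≤ z i} by ext; simp]
    exact MeasurableSet.iInter fun i => measurableSet_le measurable_const (measurable_pi_apply i)
  have hΦ := measurable_massAndLengths (γ := γ) (m := m)
  have hmomN : ∀ n : Option (Fin m) → ℕ,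
      Integrable (fun z => ∏ i, massAndLengths γ z i ^ n i) N ∧
      ∫ z, ∏ i, massAndLengths γ z i ^ n i ∂N =
        rising (θ + γ * ∑ j, (n (some j) : ℝ)) (n none) * (∏ j, rising (a j) (n (some j))) *
        (Real.Gamma (θ + b) /
          Real.Gamma (θ + b + (γ * ∑ j, (n (some j) : ℝ) + n none))) := by
    intro n
    refine integrable_and_integral_eq_of_lintegral
      (Measurable.aestronglyMeasurable (by fun_prop)) ?_ ?_
      (lintegral_prod_pow_massAndLengths hγ₀ ha hθ hb hτ0 hτ n)
    · filter_upwards [hnonneg] with z hz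
      exact Finset.prod_nonneg fun i _ => pow_nonneg (hz i) _
    · have g1 := rising_nonneg (show 0 ≤ θ + γ * ∑ j, (n (some j) : ℝ) by positivity) (n none)
      have g2 := Finset.prod_nonneg fun j (_ : j ∈ Finset.univ) =>
        rising_nonneg (ha j).le (n (some j))
      have g3 := Real.Gamma_pos_of_pos
        (show 0 < θ + b + (γ * ∑ j, (n (some j) : ℝ) + n none) by positivity)
      positivity
  have := Measure.isProbabilityMeasure_map (μ := Q) hv.aemeasurable
  have := Measure.isProbabilityMeasure_map (μ := N) hΦ.aemeasurable
  have hprod : ∀ n : Option (Fin m) → ℕ, Measurable fun z : Option (Fin m) → ℝ =>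
    ∏ i, z i ^ n i := fun n => by fun_prop
  have hsingle : ∀ (i : Option (Fin m)) (p : ℕ) (z : Option (Fin m) → ℝ),
      ∏ j, z j ^ (Pi.single i p : Option (Fin m) → ℕ) j = z i ^ p := by
    intro i p z
    rw [Finset.prod_eq_single i]
    · simp
    · intro j _ hj; simp [hj]
    · simp
  have key : Q.map v = N.map (massAndLengths γ) := by
    -- The 6 comes from `gamma_lower_bound`. The base works for every coordinate because the sum of
    -- all `a i` dominates each `a j` and, since `γ < 1`, also `θ`.
    refine ext_of_moments (C := 6 * Real.Gamma (θ + b)) (b := ∑ i, a i + 1) ?_ ?_ ?_ ?_ ?_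
      (by positivity) ?_
    · exact (ae_map_iff hv.aemeasurable hmS).2 hv0
    · exact (ae_map_iff hΦ.aemeasurable hmS).2 hnonneg
    · exact fun n => (integrable_map_measure (hprod n).aestronglyMeasurable hv.aemeasurable).2
        (hmom n).1
    · exact fun n => (integrable_map_measure (hprod n).aestronglyMeasurable hΦ.aemeasurable).2
        (hmomN n).1
    · intro n
      rw [integral_map hv.aemeasurable (hprod n).aestronglyMeasurable,
        integral_map hΦ.aemeasurable (hprod n).aestronglyMeasurable, (hmom n).2, (hmomN n).2]
    · intro i p
      have h1 := (hmom (Pi.single i p)).2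
      simp only [hsingle] at h1
      rw [integral_map hv.aemeasurable (Measurable.aestronglyMeasurable (by fun_prop)), h1]
      have hΓ : ∀ y : ℝ, 0 ≤ y → Real.Gamma (θ + b) / Real.Gamma (θ + b + y) ≤
          6 * Real.Gamma (θ + b) := by
        intro y hy
        have h2 : 0 < θ + b + y := by positivity
        rw [div_le_iff₀ (Real.Gamma_pos_of_pos h2)]
        nlinarith [gamma_lower_bound h2]
      have hbound : ∀ x : ℝ, 0 ≤ x → x ≤ ∑ i, a i → ∀ y : ℝ, 0 ≤ y →
          rising x p * (Real.Gamma (θ + b) / Real.Gamma (θ + b + y)) ≤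
            6 * Real.Gamma (θ + b) * (∑ i, a i + 1) ^ p * p.factorial := by
        intro x hx hxA y hy
        have h3 : rising x p ≤ (∑ i, a i + 1) ^ p * p.factorial :=
          (rising_mono hx hxA p).trans (rising_le hA.le p)
        calc _ ≤ ((∑ i, a i + 1) ^ p * p.factorial) * (6 * Real.Gamma (θ + b)) :=
              mul_le_mul h3 (hΓ y hy) (div_nonneg hG.le (Real.Gamma_nonneg_of_nonneg (by positivity)))
                (by positivity)
          _ = _ := by ring
      cases i with
      | none =>
        simpa [rising_zero] using hbound θ hθ0.le (by rw [hθ]; nlinarith) p (by positivity)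
      | some j =>
        have h2 : ∏ i, rising (a i) ((Pi.single (some j) p : Option (Fin m) → ℕ) (some i)) =
            rising (a j) p := by
          rw [Finset.prod_eq_single j]
          · simp
          · intro i _ hi; simp [hi, rising_zero]
          · simp
        rw [h2, Pi.single_eq_of_ne (by simp : (none : Option (Fin m)) ≠ some j), rising_zero,
          one_mul]
        exact hbound (a j) (ha j).le (Finset.single_le_sum (fun i _ => (ha i).le)
          (Finset.mem_univ j)) _ (by positivity)
  have hΨ := measurable_massAndProportions (γ := γ) (m := m)
  rw [show (fun ω => massAndProportions γ (v ω)) = massAndProportions γ ∘ v from rfl,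
    ← Measure.map_map hΨ hv, key, Measure.map_map hΨ hΦ]
  conv_rhs => rw [← Measure.map_id (μ := N)]
  refine Measure.map_congr ?_
  filter_upwards [haeN] with z ⟨h1, h2, _, h4⟩
  exact massAndProportions_massAndLengths h1 h2 h4

end JointLaw

/-! ### Measurable versions of the limits and convergence of the reduced trees -/

section Limits

variable {Ω : Type*} [mΩ : MeasurableSpace Ω] {P : Measure Ω} {α γ : ℝ}
  {T : ℕ → Ω → Finset (Finset ℕ)} {k : ℕ}

lemma ae_cond_iff [IsFiniteMeasure P] {s : Set Ω} (hs : MeasurableSet s)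
    {p : Ω → Prop} : (∀ᵐ ω ∂P[|s], p ω) ↔ ∀ᵐ ω ∂P, ω ∈ s → p ω := by
  rw [ProbabilityTheory.cond, Measure.ae_ennreal_smul_measure_iff
    (ENNReal.inv_ne_zero.2 (measure_ne_top P s)), ae_restrict_iff' hs]

lemma ae_of_forall_ae_cond_tree [IsFiniteMeasure P] (hT : IsAlphaGammaSequence P α γ T)
    (hk : 1 ≤ k) {p : Ω → Prop}
    (h : ∀ t, P {ω | T k ω = t} ≠ 0 → ∀ᵐ ω ∂P[|{ω | T k ω = t}], p ω) : ∀ᵐ ω ∂P, p ω := by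
  have h1 : ∀ t, ∀ᵐ ω ∂P, T k ω = t → p ω := by
    intro t
    by_cases h0 : P {ω | T k ω = t} = 0
    · have : ∀ᵐ ω ∂P, ¬ T k ω = t := by
        rw [ae_iff]; simpa using h0
      filter_upwards [this] with ω hω hω'
      exact absurd hω' hω
    · exact (ae_cond_iff (hT.measurableSet_eq k hk t)).1 (h t h0)
  filter_upwards [ae_all_iff.2 h1] with ω hω
  exact hω _ rfl

/-- The scaled numbers of leaves attached to a reduced subtree and the scaled lengths of its edges
have measurable limits. -/
lemma exists_measurable_limits [IsProbabilityMeasure P] (hα₁ : α < 1) (hγ₀ : 0 < γ)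
    (hT : IsAlphaGammaSequence P α γ T) (hk : 1 ≤ k) :
    ∃ (W : Ω → ℝ) (X : Finset ℕ → Ω → ℝ), Measurable W ∧ (∀ C, Measurable (X C)) ∧
      (∀ C ω, C ∉ T k ω → X C ω = 0) ∧
      (∀ᵐ ω ∂P, Tendsto (fun i : ℕ =>
        ((attached (Finset.Icc 1 k) (T (k + i) ω)).card : ℝ) * ((k : ℝ) + i)⁻¹)
          atTop (𝓝 (W ω))) ∧
      ∀ᵐ ω ∂P, ∀ C ∈ T k ω, Tendsto (fun i : ℕ =>
        ((fibre (Finset.Icc 1 k) (T (k + i) ω) C).card : ℝ) * (((k : ℝ) + i) ^ γ)⁻¹)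
          atTop (𝓝 (X C ω)) := by
  classical
  have hm : ∀ i, Measurable fun ω =>
      ((attached (Finset.Icc 1 k) (T (k + i) ω)).card : ℝ) * ((k : ℝ) + i)⁻¹ := fun i =>
    hT.measurable_comp (by omega) fun t => ((attached (Finset.Icc 1 k) t).card : ℝ) *
      ((k : ℝ) + i)⁻¹
  have hmem : ∀ C, MeasurableSet {ω | C ∈ T k ω} := fun C =>
    measurableSet_setOfPred.2 (hT.measurable_comp hk fun t => C ∈ t)
  have hm' : ∀ C i, Measurable fun ω => if C ∈ T k ω then
      ((fibre (Finset.Icc 1 k) (T (k + i) ω) C).card : ℝ) * (((k : ℝ) + i) ^ γ)⁻¹ else 0 :=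
    fun C i => Measurable.ite (hmem C) (hT.measurable_comp (by omega) fun t =>
      ((fibre (Finset.Icc 1 k) t C).card : ℝ) * (((k : ℝ) + i) ^ γ)⁻¹) measurable_const
  obtain ⟨W, hW, hWlim⟩ := measurable_limit_of_tendsto_metrizable_ae (μ := P) (L := atTop)
    (fun i => (hm i).aemeasurable) (ae_of_forall_ae_cond_tree hT hk fun t ht =>
      exists_tendsto_attached hα₁ hγ₀ hT hk ht)
  have hlim : ∀ C, ∀ᵐ ω ∂P, ∃ l, Tendsto (fun i : ℕ => if C ∈ T k ω then
      ((fibre (Finset.Icc 1 k) (T (k + i) ω) C).card : ℝ) * (((k : ℝ) + i) ^ γ)⁻¹ else 0)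
      atTop (𝓝 l) := by
    refine fun C => ae_of_forall_ae_cond_tree hT hk fun t ht => ?_
    have h1 := cond_ae_traceShape (t := t) hα₁ hT hk
    by_cases hC : C ∈ t
    · filter_upwards [exists_tendsto_fibre hα₁ hγ₀ hT hk ht hC, h1] with ω hω hω'
      simpa [hω'.1, hC] using hω
    · filter_upwards [h1] with ω hω'
      exact ⟨0, by simp [hω'.1, hC]⟩
  choose X hX hXlim using fun C => measurable_limit_of_tendsto_metrizable_ae (μ := P) (L := atTop)
    (fun i => (hm' C i).aemeasurable) (hlim C)
  -- The value 0 off the tree makes the total length a sum over the fixed family of all subsets of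
  -- `[k]`, and so evidently measurable.
  refine ⟨W, fun C ω => if C ∈ T k ω then X C ω else 0, hW,
    fun C => Measurable.ite (hmem C) (hX C) measurable_const,
    fun C ω hC => if_neg hC, hWlim, ?_⟩
  filter_upwards [ae_all_iff.2 hXlim] with ω hω C hC
  simpa [hC] using hω C

lemma edgeLengthsConverge_of_tendsto (hT : IsAlphaGammaSequence P α γ T) (hk : 1 ≤ k) {ω : Ω}
    (hshape : ∀ i, traceShape (Finset.Icc 1 k) (T (k + i) ω) = T k ω) {len : Finset ℕ → ℝ}
    (h : ∀ C ∈ T k ω, Tendsto (fun i : ℕ =>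
      ((fibre (Finset.Icc 1 k) (T (k + i) ω) C).card : ℝ) * (((k : ℝ) + i) ^ γ)⁻¹)
        atTop (𝓝 (len C))) :
    EdgeLengthsConverge (fun n => (reducedSubtree (T n ω) k).scale ((n : ℝ) ^ γ)⁻¹)
      ⟨T k ω, len⟩ := by
  have hmem : ∀ i, T (k + i) ω ∈ trees (k + i) := fun i => hT.mem_trees _ (by omega) ω
  refine ⟨?_, fun C hC => ?_⟩
  · filter_upwards [eventually_ge_atTop k] with n hn
    obtain ⟨i, rfl⟩ := Nat.exists_eq_add_of_le hn
    exact (reducedSubtree_shape (hmem i) (Nat.le_add_right k i)).trans (hshape i)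
  · rw [← tendsto_add_atTop_iff_nat k]
    refine (h C hC).congr fun i => ?_
    rw [add_comm i k]
    change _ = (((k + i : ℕ) : ℝ) ^ γ)⁻¹ * (reducedSubtree (T (k + i) ω) k).len C
    rw [reducedSubtree_len (hmem i) hk (Nat.le_add_right k i) (by rw [hshape i]; exact hC),
      mul_comm, Nat.cast_add]

/-- The index is random but takes countably many values, each on a measurable event. -/
lemma measurable_apply_of_tree (hT : IsAlphaGammaSequence P α γ T) (hk : 1 ≤ k)
    {D : Finset ℕ → Ω → ℝ} (hD : ∀ C, Measurable (D C)) (f : Finset (Finset ℕ) → Finset ℕ) :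
    Measurable fun ω => D (f (T k ω)) ω := by
  intro E hE
  have : (fun ω => D (f (T k ω)) ω) ⁻¹' E = ⋃ t, {ω | T k ω = t} ∩ D (f t) ⁻¹' E := by
    ext ω; simp
  rw [this]
  exact MeasurableSet.iUnion fun t => (hT.measurableSet_eq k hk t).inter (hD _ hE)

end Limits

/-! ### Conditional laws given the tree, or given a set of trees -/

section Conditional

variable {Ω : Type*} [mΩ : MeasurableSpace Ω] {P : Measure Ω} [IsProbabilityMeasure P] {α γ : ℝ}
  {T : ℕ → Ω → Finset (Finset ℕ)} {k : ℕ} {t : Finset (Finset ℕ)}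

/-- Given the tree spanned by the first leaf only, the limiting edge length has a polynomially
tilted Mittag-Leffler distribution. -/
lemma exists_isMittagLefflerLaw_of_sequence (hα₁ : α < 1) (hγ₀ : 0 < γ) (hγα : γ ≤ α)
    (hT : IsAlphaGammaSequence P α γ T) : ∃ ν, IsMittagLefflerLaw γ ν := by
  obtain ⟨W, X, -, hX, -, hWlim, hXlim⟩ := exists_measurable_limits hα₁ hγ₀ hT le_rfl
  -- The first tree is deterministic, so the conditional moments for `k = 1` are unconditional ones.
  have huniv : {ω | T 1 ω = {{1}}} = Set.univ :=
    Set.eq_univ_of_forall fun ω => eq_of_mem_trees_one (hT.mem_trees 1 le_rfl ω)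
  have hP : P[|{ω | T 1 ω = {{1}}}] = P := by rw [huniv, cond_univ]
  have hmem : ∀ ω, {1} ∈ T 1 ω := fun ω => by
    rw [eq_of_mem_trees_one (hT.mem_trees 1 le_rfl ω)]; simp
  have hlim : ∀ᵐ ω ∂P, Tendsto (fun i : ℕ =>
        ((fibre (Finset.Icc 1 1) (T (1 + i) ω) {1}).card : ℝ) * ((((1 : ℕ) : ℝ) + i) ^ γ)⁻¹)
          atTop (𝓝 (X {1} ω)) := hXlim.mono fun ω hω => hω _ (hmem ω)
  have hX0 : ∀ᵐ ω ∂P, 0 ≤ X {1} ω := hlim.mono fun ω hω =>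
    ge_of_tendsto' hω fun i => by positivity
  have ha : 0 < (1 - α) / γ := div_pos (by linarith) hγ₀
  have hγa : γ * ((1 - α) / γ) = 1 - α := by field_simp
  have := Measure.isProbabilityMeasure_map (μ := P) (hX {1}).aemeasurable
  refine exists_isMittagLefflerLaw hγ₀ (hγα.trans_lt hα₁) ha (ν := P.map (X {1})) ?_ fun p => ?_
  · exact (ae_map_iff (hX {1}).aemeasurable measurableSet_Ici).2 hX0
  · have h1 := joint_moments (t := {{1}}) hα₁ hγ₀ hT le_rfl (by rw [huniv]; simp)
      (hP.symm ▸ hWlim) (X := X) (fun B hB => by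
        rw [Finset.mem_singleton] at hB
        subst hB
        exact hP.symm ▸ hlim) 0 fun _ => p
    simp only [hP, pow_zero, one_mul, Finset.prod_singleton, Finset.sum_singleton, rising_zero,
      Nat.cast_zero, add_zero, Nat.cast_one, edgeWeight, Finset.card_singleton, if_true] at h1
    rw [lintegral_map (by fun_prop) (hX {1}), hγa, ← h1.2,
      ofReal_integral_eq_lintegral_ofReal h1.1 (hX0.mono fun ω hω => pow_nonneg hω p)]

/-- The joint conditional law, given the tree `T k`, of the limits of the scaled number of attached
leaves, the normalized total length and the length proportions. -/
theorem cond_map_eq (hα₀ : 0 < α) (hα₁ : α < 1) (hγ₀ : 0 < γ) (hγα : γ ≤ α)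
    (hT : IsAlphaGammaSequence P α γ T) (hk : 1 ≤ k) (ht : P {ω | T k ω = t} ≠ 0)
    (htk : t ∈ trees k) {g : ℝ → ℝ} (hg : Measurable g) (hg0 : ∀ s, 0 ≤ g s)
    (hν : IsMittagLefflerLaw γ (volume.withDensity fun s => ENNReal.ofReal (g s)))
    {W : Ω → ℝ} {X : Finset ℕ → Ω → ℝ} (hW : Measurable W) (hX : ∀ C, Measurable (X C))
    (hWlim : ∀ᵐ ω ∂P, Tendsto (fun i : ℕ =>
        ((attached (Finset.Icc 1 k) (T (k + i) ω)).card : ℝ) * ((k : ℝ) + i)⁻¹)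
          atTop (𝓝 (W ω)))
    (hXlim : ∀ᵐ ω ∂P, ∀ C ∈ T k ω, Tendsto (fun i : ℕ =>
        ((fibre (Finset.Icc 1 k) (T (k + i) ω) C).card : ℝ) * (((k : ℝ) + i) ^ γ)⁻¹)
          atTop (𝓝 (X C ω)))
    {ℓ : ℕ} (hℓ : t.card = k + ℓ) {e : Fin (k + ℓ) → Finset ℕ} (he : Function.Injective e)
    (het : Set.range e = (t : Set (Finset ℕ))) :
    (P[|{ω | T k ω = t}]).map (fun ω => massAndProportions γ
        fun o : Option (Fin (k + ℓ)) => o.elim (W ω) fun j => X (e j) ω) =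
      (betaLaw (k * (1 - α) + ℓ * γ) (((k : ℝ) - 1) * α - ℓ * γ)).prod
        ((tiltedLaw α γ g k ℓ).prod (dirichletLaw fun j => edgeWeight α γ (e j) / γ)) := by
  have : NeZero (k + ℓ) := ⟨by omega⟩
  have := cond_isProbabilityMeasure ht
  have himage : t = Finset.univ.map ⟨e, he⟩ := by
    rw [← Finset.coe_inj, ← het]; simp
  have hsum : ∀ f : Finset ℕ → ℝ, ∑ B ∈ t, f B = ∑ j, f (e j) := fun f => by
    rw [himage, Finset.sum_map]; rfl
  have hprod : ∀ f : Finset ℕ → ℝ, ∏ B ∈ t, f B = ∏ j, f (e j) := fun f => by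
    rw [himage, Finset.prod_map]; rfl
  have hmem : ∀ j, e j ∈ t := fun j => by
    rw [← Finset.mem_coe, ← het]; exact Set.mem_range_self j
  have hac : P[|{ω | T k ω = t}] ≪ P := cond_absolutelyContinuous
  have hWlim' := hac.ae_le hWlim
  have hXlim' : ∀ B ∈ t, ∀ᵐ ω ∂P[|{ω | T k ω = t}], Tendsto (fun i : ℕ =>
      ((fibre (Finset.Icc 1 k) (T (k + i) ω) B).card : ℝ) * (((k : ℝ) + i) ^ γ)⁻¹)
        atTop (𝓝 (X B ω)) := by
    intro B hB
    filter_upwards [hac.ae_le hXlim, cond_ae_traceShape (t := t) hα₁ hT hk] with ω h1 h2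
    exact h1 B (h2.1 ▸ hB)
  have := isProbabilityMeasure_tiltedLaw hα₁ hγ₀ hg hg0 hν k ℓ
  have hθ : (k : ℝ) * (1 - α) + ℓ * γ = γ * ∑ j, edgeWeight α γ (e j) / γ := by
    rw [← sum_edgeWeight_eq htk hℓ, hsum, Finset.mul_sum]
    exact Finset.sum_congr rfl fun j _ => by field_simp
  refine map_massAndProportions_eq hγ₀ (hγα.trans_lt hα₁)
    (fun j => div_pos (edgeWeight_pos hα₁ hγ₀ _) hγ₀) hθ (betaParam_nonneg hα₀ hγα htk hℓ)
    (ae_pos_tiltedLaw hg hg0 hν k ℓ)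
    (fun p => lintegral_rpow_tiltedLaw hα₁ hγ₀ hg hg0 hν k ℓ rfl p.cast_nonneg) ?_ ?_ fun n => ?_
  · refine measurable_pi_iff.2 fun o => ?_
    cases o with
    | none => exact hW
    | some j => exact hX (e j)
  · filter_upwards [hWlim', ae_all_iff.2 fun j => hXlim' (e j) (hmem j)] with ω h1 h2 o
    cases o with
    | none => exact ge_of_tendsto' h1 fun i => by positivity
    | some j => exact ge_of_tendsto' (h2 j) fun i => by positivity
  · have h1 := joint_moments hα₁ hγ₀ hT hk ht hWlim' hXlim' (n none)
      (Function.extend e (fun j => n (some j)) 0)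
    simp only [hprod, hsum, he.extend_apply] at h1
    simp only [Fintype.prod_option, Option.elim]
    rw [← sum_edgeWeight_eq htk hℓ, hsum]
    -- The beta parameters add up to the total weight `k - α` of `T k`: the second one is the total
    -- weight of its branch points.
    have h2 : (∑ j, edgeWeight α γ (e j)) + (((k : ℝ) - 1) * α - ℓ * γ) = k - α := by
      rw [← hsum, sum_edgeWeight_eq htk hℓ]; ring
    rw [h2]
    exact h1

/-- Equality of the conditional laws given `T k = t` for all trees `t` in a set gives the law
conditionally on `T k` being in that set. -/
lemma cond_mem_map_eq (hT : IsAlphaGammaSequence P α γ T) (hk : 1 ≤ k)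
    {S : Set (Finset (Finset ℕ))} (hS : P {ω | T k ω ∈ S} ≠ 0) {E : Type*} [MeasurableSpace E]
    {F : Ω → E} (hF : Measurable F) {N : Measure E}
    (h : ∀ t ∈ S, P {ω | T k ω = t} ≠ 0 → (P[|{ω | T k ω = t}]).map F = N) :
    (P[|{ω | T k ω ∈ S}]).map F = N := by
  have hmS : MeasurableSet {ω | T k ω ∈ S} := measurableSet_setOfPred.2 (hT.measurable_comp hk (· ∈ S))
  refine Measure.ext fun A hA => ?_
  have hFA := hF hA
  have hdec : ∀ B : Set Ω, MeasurableSet B →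
      P ({ω | T k ω ∈ S} ∩ B) = ∑' t : S, P ({ω | T k ω = t} ∩ B) := by
    intro B hB
    rw [← measure_iUnion]
    · congr 1
      ext ω
      simp
    · intro t t' hne
      refine Set.disjoint_left.2 fun ω h1 h2 => hne (Subtype.ext (h1.1.symm.trans h2.1))
    · exact fun t => (hT.measurableSet_eq k hk t).inter hB
  have hterm : ∀ t : S, P ({ω | T k ω = t} ∩ F ⁻¹' A) = P {ω | T k ω = t} * N A := by
    intro t
    by_cases h0 : P {ω | T k ω = t} = 0
    · rw [h0, zero_mul]; exact measure_mono_null Set.inter_subset_left h0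
    · rw [← h t t.2 h0, Measure.map_apply hF hA, cond_apply (hT.measurableSet_eq k hk t),
        ENNReal.mul_inv_cancel_left h0 (measure_ne_top _ _)]
  have htot := hdec Set.univ MeasurableSet.univ
  simp only [Set.inter_univ] at htot
  rw [Measure.map_apply hF hA, cond_apply hmS, hdec _ hFA]
  simp only [hterm]
  rw [ENNReal.tsum_mul_right, ← htot, ENNReal.inv_mul_cancel_left hS (measure_ne_top _ _)]

end Conditional

/-! ### Enumerations of the edges -/

section Main

variable {Ω : Type*} [mΩ : MeasurableSpace Ω] {P : Measure Ω} {α γ : ℝ}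
  {T : ℕ → Ω → Finset (Finset ℕ)} {k : ℕ} {t : Finset (Finset ℕ)}

lemma sum_powerset_eq (hT : IsAlphaGammaSequence P α γ T) (hk : 1 ≤ k) {X : Finset ℕ → Ω → ℝ}
    (hX0 : ∀ C ω, C ∉ T k ω → X C ω = 0) {m : ℕ} {e : Fin m → Finset ℕ}
    (he : Function.Injective e) {ω : Ω} (het : Set.range e = (T k ω : Set (Finset ℕ))) :
    ∑ B ∈ (Finset.Icc 1 k).powerset, X B ω = ∑ j, X (e j) ω := by
  have himage : T k ω = Finset.univ.map ⟨e, he⟩ := by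
    rw [← Finset.coe_inj, ← het]; simp
  have hsub : T k ω ⊆ (Finset.Icc 1 k).powerset := fun B hB =>
    Finset.mem_powerset.2 ((hT.mem_trees k hk ω).1 B hB).2
  rw [← Finset.sum_subset hsub fun B _ hB => hX0 B ω hB, himage, Finset.sum_map]
  rfl

lemma mem_trees_of_measure_ne_zero (hT : IsAlphaGammaSequence P α γ T) (hk : 1 ≤ k)
    (ht : P {ω | T k ω = t} ≠ 0) : t ∈ trees k := by
  obtain ⟨ω, hω⟩ := nonempty_of_measure_ne_zero ht
  exact hω ▸ hT.mem_trees k hk ω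

lemma exists_enumeration (htk : t ∈ trees k) : ∃ (ℓ : ℕ) (e : Fin (k + ℓ) → Finset ℕ),
    t.card = k + ℓ ∧ Function.Injective e ∧ Set.range e = (t : Set (Finset ℕ)) := by
  have h1 := card_branchPoints_add htk
  have h2 : t.card = k + (branchPoints t).card := by omega
  refine ⟨_, fun j => ((t.equivFinOfCardEq h2).symm j : Finset ℕ), h2,
    Subtype.val_injective.comp (Equiv.injective _), ?_⟩
  rw [show (fun j => ((t.equivFinOfCardEq h2).symm j : Finset ℕ)) =
    Subtype.val ∘ (t.equivFinOfCardEq h2).symm from rfl, (Equiv.surjective _).range_comp]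
  simp

lemma dirichletParam_eq {ℓ : ℕ} (hγ₀ : 0 < γ) {e : Fin (k + ℓ) → Finset ℕ}
    (he : IsLeafFirstEnumeration k t e) :
    (fun j => edgeWeight α γ (e j) / γ) = dirichletParam α γ k (k + ℓ) := by
  funext j
  simp only [dirichletParam, edgeWeight, he.2.2 j]
  split_ifs
  · rfl
  · exact div_self hγ₀.ne'

end Main

end AlphaGamma

theorem theorem5 {Ω : Type*} [MeasurableSpace Ω] (P : Measure Ω) [IsProbabilityMeasure P]
    (α γ : ℝ) (hα₀ : 0 < α) (hα₁ : α < 1) (hγ₀ : 0 < γ) (hγα : γ ≤ α)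
    (T : ℕ → Ω → Finset (Finset ℕ)) (hT : IsAlphaGammaSequence P α γ T) :
    ∃ g : ℝ → ℝ, IsMittagLefflerDensity γ g ∧
      ∀ k : ℕ, 1 ≤ k →
        ∃ (R : Ω → EdgeLengthTree) (W L : Ω → ℝ) (D : Finset ℕ → Ω → ℝ),
          Measurable W ∧ Measurable L ∧ (∀ C, Measurable (D C)) ∧
          (∀ ω, (R ω).shape = T k ω) ∧
          (∀ᵐ ω ∂P, EdgeLengthsConverge
            (fun n => (reducedSubtree (T n ω) k).scale ((n : ℝ) ^ γ)⁻¹) (R ω)) ∧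
          (∀ᵐ ω ∂P, ∀ C ∈ T k ω, (R ω).len C = L ω * W ω ^ γ * D C ω) ∧
          -- conditionally on `T k` lying in any given set of trees with `k + ℓ` edges
          -- (such as a single tree, or the set of all of them), `W`, `L` and the enumerated
          -- `D` are independent with the asserted distributions
          ∀ (ℓ : ℕ) (S : Set (Finset (Finset ℕ))), (∀ t ∈ S, t ∈ trees k ∧ t.card = k + ℓ) →
            P {ω | T k ω ∈ S} ≠ 0 →
            ∀ e : Finset (Finset ℕ) → Fin (k + ℓ) → Finset ℕ,
              (∀ t ∈ S, IsLeafFirstEnumeration k t (e t)) →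
              (ProbabilityTheory.cond P {ω | T k ω ∈ S}).map
                  (fun ω => (W ω, L ω, fun j => D (e (T k ω) j) ω)) =
                (betaLaw (k * (1 - α) + ℓ * γ) (((k : ℝ) - 1) * α - ℓ * γ)).prod
                  ((tiltedLaw α γ g k ℓ).prod
                    (dirichletLaw (dirichletParam α γ k (k + ℓ)))) := by
  obtain ⟨ν, hν⟩ := exists_isMittagLefflerLaw_of_sequence hα₁ hγ₀ hγα hT
  obtain ⟨g, hg, rfl⟩ := hν.exists_density hγ₀ (hγα.trans_lt hα₁)
  refine ⟨g, hg, fun k hk => ?_⟩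
  obtain ⟨W, X, hW, hX, hX0, hWlim, hXlim⟩ := exists_measurable_limits hα₁ hγ₀ hT hk
  set s : Ω → ℝ := fun ω => ∑ B ∈ (Finset.Icc 1 k).powerset, X B ω with hs
  have hsm : Measurable s := Finset.measurable_sum _ fun B _ => hX B
  -- Here the total length is written with `s`, a sum that does not refer to `t`, so that the same
  -- `L` and `D` serve for all trees at once.
  have hlaw : ∀ (t : Finset (Finset ℕ)) (ht : P {ω | T k ω = t} ≠ 0) (ℓ : ℕ)
      (e : Fin (k + ℓ) → Finset ℕ), t.card = k + ℓ → Function.Injective e →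
      Set.range e = (t : Set (Finset ℕ)) →
      (P[|{ω | T k ω = t}]).map (fun ω => (W ω, s ω / W ω ^ γ, fun j => X (e j) ω / s ω)) =
        (betaLaw (k * (1 - α) + ℓ * γ) (((k : ℝ) - 1) * α - ℓ * γ)).prod
          ((tiltedLaw α γ g k ℓ).prod (dirichletLaw fun j => edgeWeight α γ (e j) / γ)) := by
    intro t ht ℓ e hℓ he het
    rw [← cond_map_eq hα₀ hα₁ hγ₀ hγα hT hk ht (mem_trees_of_measure_ne_zero hT hk ht) hg.1
      hg.2.1 hν hW hX hWlim hXlim hℓ he het]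
    refine Measure.map_congr ?_
    filter_upwards [ae_cond_mem (hT.measurableSet_eq k hk t)] with ω hω
    have hω' : T k ω = t := hω
    simp only [massAndProportions, Option.elim, hs,
      sum_powerset_eq hT hk hX0 he (hω'.symm ▸ het)]
  refine ⟨fun ω => ⟨T k ω, fun C => X C ω⟩, W, fun ω => s ω / W ω ^ γ, fun C ω => X C ω / s ω, hW,
    by fun_prop, fun C => (hX C).div hsm, fun ω => rfl, ?_, ?_, ?_⟩
  · filter_upwards [hT.ae_traceShape hα₁ hk, hXlim] with ω h1 h2
    exact edgeLengthsConverge_of_tendsto hT hk h1 h2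
  · refine ae_of_forall_ae_cond_tree hT hk fun t ht => ?_
    have htk := mem_trees_of_measure_ne_zero hT hk ht
    obtain ⟨ℓ, e, hℓ, he, het⟩ := exists_enumeration htk
    have hF : Measurable fun ω => (W ω, s ω / W ω ^ γ, fun j => X (e j) ω / s ω) := by fun_prop
    -- The product formula for the lengths needs nonzero divisors. The identified law supplies them:
    -- `W` and `L` are almost surely positive, hence so is `W ^ γ`, and `s` is not zero.
    have hpos : ∀ᵐ z ∂(P[|{ω | T k ω = t}]).map
        (fun ω => (W ω, s ω / W ω ^ γ, fun j => X (e j) ω / s ω)), 0 < z.1 ∧ 0 < z.2.1 := by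
      rw [hlaw t ht ℓ e hℓ he het]
      filter_upwards [Measure.quasiMeasurePreserving_fst.ae (ae_pos_betaLaw _ _),
        Measure.quasiMeasurePreserving_snd.ae
          (Measure.quasiMeasurePreserving_fst.ae (ae_pos_tiltedLaw hg.1 hg.2.1 hν k ℓ))]
        with z h1 h2 using ⟨h1, h2⟩
    filter_upwards [ae_of_ae_map hF.aemeasurable hpos] with ω ⟨h1, h2⟩ C _
    have h3 : 0 < W ω ^ γ := Real.rpow_pos_of_pos h1 γ
    have h4 : s ω ≠ 0 := fun h => by simp [h] at h2
    field_simp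
  · intro ℓ S hS hPS e he
    -- With the leaf edges enumerated first, the law is the same for all trees in `S`, so averaging
    -- over them does not change it.
    refine cond_mem_map_eq hT hk hPS ?_ fun t htS ht => ?_
    · exact hW.prodMk ((by fun_prop : Measurable fun ω => s ω / W ω ^ γ).prodMk
        (measurable_pi_iff.2 fun j => measurable_apply_of_tree hT hk
          (fun C => (hX C).div hsm) fun t => e t j))
    · rw [← dirichletParam_eq hγ₀ (he t htS), ← hlaw t ht ℓ (e t) (hS t htS).2 (he t htS).1
        (he t htS).2.1]
      refine Measure.map_congr ?_
      filter_upwards [ae_cond_mem (hT.measurableSet_eq k hk t)] with ω hω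
      have hω' : T k ω = t := hω
      rw [hω']
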